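/- **Theorem 1 (dressing method for the 2+1 dimensional generalization of the Kaup–Broer system).** *Setting.* Let $a,\alpha,\beta\in\mathbb C$ and, for $p=(u,v,t)\in\mathbb C^3$ and $\lambda\in\mathbb C\setminus\{0\}$, put $$\phi(\lambda;u,v,t)=\lambda u+a\lambda^{-1}v+(\alpha\lambda^2+a^2\beta\lambda^{-2})t .$$ Let $U\subseteq\mathbb C\setminus\{0\}$ be open and let $R(\lambda,w)$, the dressing function, be a distribution with compact support in $(\mathbb C\setminus\{0\})\times U$. Let $X$ be a complex Banach space, continuously embedded in the space of distributions on $U$, that contains the constant function $1$ and is closed under multiplication by functions holomorphic on $\mathbb C\setminus\{0\}$. Suppose that the map $x\mapsto\iint R(\cdot,w)x(w)\,dA(w)$, given by $R$ on the smooth elements of $X$, is extended to a continuous linear map from $X$ to the distributions on $\mathbb C\setminus\{0\}$ supported in a fixed compact subset of $\mathbb C\setminus\{0\}$ (continuous in the sense of a bound $|\iiiint R(\zeta,w)x(w)f(\zeta)\,dA(w)\,dA(\zeta)|\le C\|x\|\max_{j\le N}\sup_{K}|D^jf|$ with $K\subset\mathbb C\setminus\{0\}$ compact). Let $\Omega\subseteq\mathbb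 C^3$ be open and suppose that for every $p=(u,v,t)\in\Omega$ the formula $$\mathcal F\chi(\lambda;u,v,t)=\frac1\pi\iint_{\mathbb C}\iint_{\mathbb C}\frac{e^{\phi(w;u,v,t)-\phi(\zeta;u,v,t)}}{\lambda-\zeta}R(\zeta,w)\chi(w;u,v,t)\,dA(w)\,dA(\zeta),\qquad \lambda\in U,$$ defines a bounded operator $\mathcal F=\mathcal F_p$ on $X$ such that $\mathcal I-\mathcal F$ is a Fredholm operator of index $0$ with trivial null space. *Conclusion.* For every $p\in\Omega$ the equation $(\mathcal I-\mathcal F)\chi=1$ has a unique solution in $X$. It is the restriction to $U$ of a distribution $\chi(\cdot;p)$ on $\mathbb C$ which, among the distributions on $\mathbb C$ whose restriction to $U$ lies in $X$, is the unique solution of the integral equation $\chi=1+\mathcal F\chi$ on all of $\mathbb C$. It solves, in the sense of distributions on $\mathbb C$, the nonlocal $\bar\partial$-problem $$\frac{\partial\chi}{\partial\bar\lambda}(\lambda;u,v,t)=\iint_{\mathbb C}R(\lambda,w)e^{\phi(w;u,v,t)-\phi(\lambda;u,v,t)}\chi(w;u,v,t)\,dA(w),$$ it satisfies $\chi\to1$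 as $\lambda\to\infty$, and, in the same class of distributions, it is the only solution of the $\bar\partial$-problem with this normalization. Moreover $\chi$ is represented near $\lambda=0$ and near $\lambda=\infty$ by convergent expansions $$\chi(\lambda;u,v,t)=\sum_{n\ge0}\chi^0_n(u,v,t)\lambda^n,\qquad \chi(\lambda;u,v,t)=\sum_{n\ge0}\chi^\infty_n(u,v,t)\lambda^{-n},$$ whose coefficients are holomorphic on $\Omega$. Finally, let $V\subseteq\Omega$ be open, let $s=-\log\chi^0_0$ be a continuous branch on $V$ (that is, $s$ is continuous on $V$ and $e^{-s}=\chi_0^0$ there), and let $c=-(\chi^\infty_1)_v-\tfrac12s_{uv}$. Then $s$ and $c$ are holomorphic on $V$, and there is a holomorphic solution $\Pi$ of $\Pi_{uv}=2Pc$ on $V$, where $P=\alpha\partial_u^2-\beta\partial_v^2$, such that $$s_t+\alpha s_u^2-\beta s_v^2+\Pi=0,\qquad c_t+2\alpha(s_uc)_u-2\beta(s_vc)_v-2aPs+\tfrac12Ps_{uv}=0\quad\text{on }V.$$ -/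

import Mathlib

open MeasureTheory Filter Topology TopologicalSpace
open scoped Distributions ContDiff

noncomputable section

namespace KaupBroer

/-! ### Smooth functions, distributions, compactly supported distributions -/

/-- The punctured plane `ℂ ∖ {0}`. -/
def puncturedPlane : Opens ℂ := ⟨{0}ᶜ, isOpen_compl_singleton⟩

/-- Functions that are smooth on the open set `Ω` (their values off `Ω` play no role below). -/
def SmoothFn {E : Type*} [NormedAddCommGroup E] [NormedSpace ℝ E] (Ω : Opens E) :
    Submodule ℂ (E → ℂ) where
  carrier := {f | ContDiffOn ℝ ∞ f Ω}
  add_mem' := fun hf hg => ContDiffOn.add hf hg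
  zero_mem' := contDiffOn_const
  smul_mem' := fun c _ hf => ContDiffOn.const_smul c hf

/-- A distribution with compact support in the open set `Ω`: a linear form on the smooth functions
on `Ω` that is bounded by finitely many derivatives on a compact subset of `Ω`. -/
structure CompactDistribution {E : Type*} [NormedAddCommGroup E] [NormedSpace ℝ E]
    (Ω : Opens E) where
  toLin : SmoothFn Ω →ₗ[ℂ] ℂ
  bound : ∃ K : Set E, IsCompact K ∧ K ⊆ Ω ∧ ∃ (N : ℕ) (C : ℝ), ∀ (f : SmoothFn Ω) (M : ℝ), 0 ≤ M →
    (∀ z ∈ K, ∀ j ≤ N, ‖iteratedFDeriv ℝ j (f : E → ℂ) z‖ ≤ M) → ‖toLin f‖ ≤ C * M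

/-- Complex distributions on an open set `U ⊆ ℂ`: the continuous linear forms on the complex test
functions on `U`. -/
abbrev Distr (U : Opens ℂ) := 𝓓(U, ℂ) →L[ℂ] ℂ

/-- A test function on `U`, regarded as a test function on `ℂ`. -/
def extendTest {U : Opens ℂ} (ψ : 𝓓(U, ℂ)) : 𝓓((⊤ : Opens ℂ), ℂ) :=
  ⟨ψ, ψ.contDiff, ψ.hasCompactSupport, fun _ _ => trivial⟩

/-- The product of a smooth function on `U` and a test function on `U`. -/
def mulTest {U : Opens ℂ} (g : ℂ → ℂ) (hg : ContDiffOn ℝ ∞ g U) (ψ : 𝓓(U, ℂ)) : 𝓓(U, ℂ) where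
  toFun := fun z => g z * ψ z
  contDiff' := by
    rw [contDiff_iff_contDiffAt]
    intro z
    by_cases hz : z ∈ tsupport ψ
    · exact (hg.contDiffAt (U.isOpen.mem_nhds (ψ.tsupport_subset hz))).mul ψ.contDiff.contDiffAt
    · have h0 : (fun w => g w * ψ w) =ᶠ[𝓝 z] fun _ => 0 := by
        filter_upwards [notMem_tsupport_iff_eventuallyEq.mp hz] with w hw
        simp [hw]
      exact contDiffAt_const.congr_of_eventuallyEq h0
  hasCompactSupport' := ψ.hasCompactSupport.mul_left
  tsupport_subset' := (tsupport_mul_subset_right (f := g)).trans ψ.tsupport_subset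

/-- The operator `∂/∂λ̄ = (∂/∂x + i ∂/∂y)/2` on test functions. -/
def dbarTest (ψ : 𝓓((⊤ : Opens ℂ), ℂ)) : 𝓓((⊤ : Opens ℂ), ℂ) :=
  (1 / 2 : ℂ) • (LineDeriv.lineDerivOp (1 : ℂ) ψ
    + Complex.I • LineDeriv.lineDerivOp Complex.I ψ)

theorem locallyIntegrable_inv : LocallyIntegrable (fun z : ℂ => z⁻¹) volume := by
  refine locallyIntegrable_of_norm_le_rpow (C := 1) (α := 1) ?_ ?_ ?_
    measurable_inv.aestronglyMeasurable
  · simp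
  · simp
  · refine ae_of_all _ fun z => ?_
    rw [norm_inv, one_mul, Real.rpow_neg_one]

theorem contDiff_cauchy {U : Opens ℂ} (ψ : 𝓓(U, ℂ)) :
    ContDiff ℝ ∞ fun ζ : ℂ => (1 / (Real.pi : ℂ)) * ∫ l : ℂ, ψ l / (l - ζ) := by
  refine contDiff_const.mul ?_
  have h := ψ.hasCompactSupport.contDiff_convolution_left (ContinuousLinearMap.mul ℝ ℂ)
    (μ := volume) ψ.contDiff locallyIntegrable_inv.neg
  have e : (fun ζ : ℂ => ∫ l : ℂ, ψ l / (l - ζ)) =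
      convolution ψ (-fun z : ℂ => z⁻¹) (ContinuousLinearMap.mul ℝ ℂ) volume := by
    funext ζ
    refine integral_congr_ae (ae_of_all _ fun l => ?_)
    simp only [ContinuousLinearMap.mul_apply', Pi.neg_apply, div_eq_mul_inv, ← inv_neg, neg_sub]
  rw [e]
  exact h

/-- The Cauchy transform of test functions,
`ζ ↦ (1/π) ∬ ψ(λ) / (λ - ζ) dA(λ)`. -/
def cauchy {U : Opens ℂ} (ψ : 𝓓(U, ℂ)) : SmoothFn puncturedPlane :=
  ⟨fun ζ => (1 / (Real.pi : ℂ)) * ∫ l : ℂ, ψ l / (l - ζ), (contDiff_cauchy ψ).contDiffOn⟩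

/-- The distribution `χ` on `ℂ` is given by the continuous function `h` on the set `W`. -/
def RepresentedOn (χ : Distr ⊤) (h : ℂ → ℂ) (W : Set ℂ) : Prop :=
  ContinuousOn h W ∧
    ∀ ψ : 𝓓((⊤ : Opens ℂ), ℂ), tsupport ψ ⊆ W → χ ψ = ∫ l : ℂ, h l * ψ l

/-- `χ(λ) → 1` as `λ → ∞`. -/
def TendsToOneAtInfinity (χ : Distr ⊤) : Prop :=
  ∃ (h : ℂ → ℂ) (r : ℝ), RepresentedOn χ h {l | r < ‖l‖} ∧ Tendsto h (cocompact ℂ) (𝓝 1)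

/-- `χ` has a convergent expansion `∑ c0 n λⁿ` near `0` and a convergent expansion
`∑ cinf n λ⁻ⁿ` near `∞`. -/
def HasExpansions (χ : Distr ⊤) (c0 cinf : ℕ → ℂ) : Prop :=
  (∃ (h : ℂ → ℂ) (r : ℝ), 0 < r ∧ RepresentedOn χ h {l | ‖l‖ < r} ∧
    ∀ l : ℂ, ‖l‖ < r → HasSum (fun n => c0 n * l ^ n) (h l)) ∧
  (∃ (h : ℂ → ℂ) (r : ℝ), 0 < r ∧ RepresentedOn χ h {l | r < ‖l‖} ∧
    ∀ l : ℂ, r < ‖l‖ → HasSum (fun n => cinf n * l⁻¹ ^ n) (h l))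

/-! ### The space on which the integral operator acts -/

theorem contDiffOn_of_punctured {U : Opens ℂ} (hU : U ≤ puncturedPlane) {g : ℂ → ℂ}
    (hg : DifferentiableOn ℂ g {0}ᶜ) : ContDiffOn ℝ ∞ g U :=
  ((hg.contDiffOn isOpen_compl_singleton).restrict_scalars ℝ).mono hU

/-- A space `X` of generalized functions on the open set `U ⊆ ℂ ∖ {0}`: `X` embeds continuously
into the distributions on `U`, contains the constant function `1`, and is closed under
multiplication by functions holomorphic on `ℂ ∖ {0}`. -/
structure FunctionSpace (U : Opens ℂ) (X : Type*) [NormedAddCommGroup X] [NormedSpace ℂ X] where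
  le_punctured : U ≤ puncturedPlane
  toDistr : X →ₗ[ℂ] Distr U
  injective : Function.Injective toDistr
  continuous_apply : ∀ ψ : 𝓓(U, ℂ), Continuous fun x => toDistr x ψ
  one : X
  one_apply : ∀ ψ : 𝓓(U, ℂ), toDistr one ψ = ∫ w : ℂ, ψ w
  mul_mem : ∀ (g : ℂ → ℂ) (hg : DifferentiableOn ℂ g {0}ᶜ) (x : X), ∃ y : X, ∀ ψ : 𝓓(U, ℂ),
    toDistr y ψ = toDistr x (mulTest g (contDiffOn_of_punctured le_punctured hg) ψ)

section

variable {U : Opens ℂ} {X : Type*} [NormedAddCommGroup X] [NormedSpace ℂ X]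

/-- The product of an element of `X` and a function holomorphic on `ℂ ∖ {0}`. -/
def FunctionSpace.mul (S : FunctionSpace U X) (g : ℂ → ℂ) (hg : DifferentiableOn ℂ g {0}ᶜ)
    (x : X) : X :=
  (S.mul_mem g hg x).choose

/-- The set `(ℂ ∖ {0}) × U`. -/
def kernelDomain (U : Opens ℂ) : Opens (ℂ × ℂ) :=
  ⟨(puncturedPlane : Set ℂ) ×ˢ (U : Set ℂ), puncturedPlane.isOpen.prod U.isOpen⟩

/-- The function `(ζ, w) ↦ f(ζ) g(w)`. -/
def tensor (f : SmoothFn puncturedPlane) (g : SmoothFn U) : SmoothFn (kernelDomain U) :=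
  ⟨fun q => (f : ℂ → ℂ) q.1 * (g : ℂ → ℂ) q.2,
    ContDiffOn.mul
      (ContDiffOn.comp (t := (puncturedPlane : Set ℂ)) f.2 contDiff_fst.contDiffOn fun _ h => h.1)
      (ContDiffOn.comp (t := (U : Set ℂ)) g.2 contDiff_snd.contDiffOn fun _ h => h.2)⟩

/-- The integrals `∬∬ R(ζ, w) x(w) f(ζ) dA(w) dA(ζ)`, for `x ∈ X` and `f` smooth on `ℂ ∖ {0}`.
The dressing function `R` is a distribution with compact support in `(ℂ ∖ {0}) × U`. For smooth `x`
the integral is the value of `R` at `(ζ, w) ↦ f(ζ) x(w)`; its extension to the elements of `X` that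
are not smooth is continuous, so that `x ↦ ∬ R(·, w) x(w) dA(w)` is a continuous map from `X`
to the distributions with support in a fixed compact subset of `ℂ ∖ {0}`. -/
structure Pairing (S : FunctionSpace U X) (R : CompactDistribution (kernelDomain U)) where
  toFun : X →ₗ[ℂ] SmoothFn puncturedPlane →ₗ[ℂ] ℂ
  bound : ∃ K : Set ℂ, IsCompact K ∧ K ⊆ puncturedPlane ∧ ∃ (N : ℕ) (C : ℝ),
    ∀ (x : X) (f : SmoothFn puncturedPlane) (M : ℝ), 0 ≤ M →
      (∀ z ∈ K, ∀ j ≤ N, ‖iteratedFDeriv ℝ j (f : ℂ → ℂ) z‖ ≤ M) → ‖toFun x f‖ ≤ C * ‖x‖ * M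
  apply_smooth : ∀ (x : X) (g : SmoothFn U),
    (∀ ψ : 𝓓(U, ℂ), S.toDistr x ψ = ∫ w : ℂ, (g : ℂ → ℂ) w * ψ w) →
      ∀ f : SmoothFn puncturedPlane, toFun x f = R.toLin (tensor f g)

/-! ### The nonlocal ∂̄-problem -/

/-- The phase `φ(λ; u, v, t) = λ u + a λ⁻¹ v + (α λ² + a² β λ⁻²) t`. -/
def phase (a α β : ℂ) (p : ℂ × ℂ × ℂ) (l : ℂ) : ℂ :=
  l * p.1 + a * l⁻¹ * p.2.1 + (α * l ^ 2 + a ^ 2 * β * l⁻¹ ^ 2) * p.2.2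

theorem differentiableOn_phase (a α β : ℂ) (p : ℂ × ℂ × ℂ) :
    DifferentiableOn ℂ (phase a α β p) {0}ᶜ := by
  have h : DifferentiableOn ℂ (fun l : ℂ => l⁻¹) {0}ᶜ :=
    differentiableOn_id.inv fun _ h => h
  unfold phase
  fun_prop

variable {S : FunctionSpace U X} {R : CompactDistribution (kernelDomain U)}

/-- The distribution `λ ↦ ∬ R(λ, w) exp(φ(w) - φ(λ)) x(w) dA(w)`, applied to a smooth function `f`
of `λ`. -/
def Pairing.source (B : Pairing S R) (a α β : ℂ) (p : ℂ × ℂ × ℂ) (x : X)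
    (f : SmoothFn puncturedPlane) : ℂ :=
  B.toFun (S.mul (fun w => Complex.exp (phase a α β p w)) (differentiableOn_phase a α β p).cexp x)
    ⟨fun l => Complex.exp (-phase a α β p l) * (f : ℂ → ℂ) l,
      ContDiffOn.mul (contDiffOn_of_punctured le_rfl (differentiableOn_phase a α β p).neg.cexp) f.2⟩

/-- The bounded operator `A` on `X` is the integral operator
`x ↦ (1/π) ∬∬ exp(φ(w) - φ(ζ)) / (λ - ζ) R(ζ, w) x(w) dA(w) dA(ζ)`. -/
def Pairing.IsDressingOperator (B : Pairing S R) (a α β : ℂ) (p : ℂ × ℂ × ℂ) (A : X →L[ℂ] X) :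
    Prop :=
  ∀ (x : X) (ψ : 𝓓(U, ℂ)), S.toDistr (A x) ψ = B.source a α β p x (cauchy ψ)

/-- The restriction to `U` of the distribution `χ` on `ℂ` is the element `x` of `X`. -/
def FunctionSpace.IsRestriction (S : FunctionSpace U X) (χ : Distr ⊤) (x : X) : Prop :=
  ∀ ψ : 𝓓(U, ℂ), S.toDistr x ψ = χ (extendTest ψ)

/-- `χ` is a solution on `ℂ` of the integral equation
`χ(λ) = 1 + (1/π) ∬∬ exp(φ(w) - φ(ζ)) / (λ - ζ) R(ζ, w) χ(w) dA(w) dA(ζ)`. -/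
def Pairing.IsIntegralSolution (B : Pairing S R) (a α β : ℂ) (p : ℂ × ℂ × ℂ) (χ : Distr ⊤) : Prop :=
  ∃ x : X, S.IsRestriction χ x ∧ ∀ ψ : 𝓓((⊤ : Opens ℂ), ℂ),
    χ ψ = (∫ l : ℂ, ψ l) + B.source a α β p x (cauchy ψ)

/-- `χ` is a solution on `ℂ` of the nonlocal ∂̄-problem
`∂χ/∂λ̄ (λ) = ∬ R(λ, w) exp(φ(w) - φ(λ)) χ(w) dA(w)`, in the sense of distributions. -/
def Pairing.IsDbarSolution (B : Pairing S R) (a α β : ℂ) (p : ℂ × ℂ × ℂ) (χ : Distr ⊤) : Prop :=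
  ∃ x : X, S.IsRestriction χ x ∧ ∀ ψ : 𝓓((⊤ : Opens ℂ), ℂ),
    -χ (dbarTest ψ) = B.source a α β p x ⟨ψ, (ψ.contDiff.contDiffOn : ContDiffOn ℝ ∞ ψ _)⟩

end

/-! ### The 2+1 dimensional Kaup–Broer system in complex variables -/

/-- `∂/∂u`. -/
def Du (f : ℂ × ℂ × ℂ → ℂ) (p : ℂ × ℂ × ℂ) : ℂ := fderiv ℂ f p (1, 0, 0)

/-- `∂/∂v`. -/
def Dv (f : ℂ × ℂ × ℂ → ℂ) (p : ℂ × ℂ × ℂ) : ℂ := fderiv ℂ f p (0, 1, 0)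

/-- `∂/∂t`. -/
def Dt (f : ℂ × ℂ × ℂ → ℂ) (p : ℂ × ℂ × ℂ) : ℂ := fderiv ℂ f p (0, 0, 1)

/-- `P = α ∂²/∂u² - β ∂²/∂v²`. -/
def opP (α β : ℂ) (f : ℂ × ℂ × ℂ → ℂ) (p : ℂ × ℂ × ℂ) : ℂ :=
  α * Du (Du f) p - β * Dv (Dv f) p

/-- `s`, `c`, `Π` are holomorphic on the open set `V ⊆ ℂ³` and solve there
`s_t + α s_u² - β s_v² + Π = 0`,
`c_t + 2α (s_u c)_u - 2β (s_v c)_v - 2a P s + (1/2) P s_{uv} = 0`, and `Π_{uv} = 2 P c`. -/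
structure IsSolution (a α β : ℂ) (V : Set (ℂ × ℂ × ℂ)) (s c Pi : ℂ × ℂ × ℂ → ℂ) : Prop where
  holo_s : DifferentiableOn ℂ s V
  holo_c : DifferentiableOn ℂ c V
  holo_Pi : DifferentiableOn ℂ Pi V
  eq_s : ∀ p ∈ V, Dt s p + α * Du s p ^ 2 - β * Dv s p ^ 2 + Pi p = 0
  eq_c : ∀ p ∈ V, Dt c p + 2 * α * Du (fun q => Du s q * c q) p
    - 2 * β * Dv (fun q => Dv s q * c q) p - 2 * a * opP α β s p
    + 1 / 2 * opP α β (Du (Dv s)) p = 0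
  eq_Pi : ∀ p ∈ V, Du (Dv Pi) p = 2 * opP α β c p

end KaupBroer

end

open KaupBroer

namespace KaupBroer

/-! ### Derivative estimates for holomorphic functions, products and convolutions -/

section Estimates

open Metric
open scoped Pointwise

/-! A Fredholm operator of index 0 with trivial kernel is invertible, so the equation on `U` has
exactly one solution in `X`. Inserted into the source term of the ∂̄-problem, it gives a
distribution Λ with compact support in ℂ∖{0}, and 1 plus the Cauchy transform of Λ extends the
solution to ℂ (`cauchyDistr`). The Cauchy–Pompeiu formula (`integral_dbar_div`) shows that this
extension solves the ∂̄-problem. Conversely, by a Liouville argument (`distr_eq_zero_of_dbar`), a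
solution of the ∂̄-problem that tends to 1 is 1 plus the Cauchy transform of its own source, hence
solves the integral equation. Expanding 1/(λ-ζ) geometrically inside Λ (`hasSum_cauchyKernel`) gives
both expansions: with w_n = (1/π)∬ζⁿΛ(ζ), the coefficient of λ⁻ⁿ⁻¹ at infinity is w_n, and that of
λⁿ at 0 is δ_{n0} - w_{-n-1}.

No regularity of F_p in p is assumed; it comes from the structure of the kernel. Conjugation by e^φ
gives an operator G_p with kernel e^{φ(λ)-φ(ζ)}R(ζ,w)/(π(λ-ζ)) (integrated over ζ and w). Since φ is
a Laurent polynomial in λ, differentiation in p replaces 1/(λ-ζ) by a divided difference, a finite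
sum of products λ^m ζ^n (`phase_sub_phase`). Hence dG has finite rank: it is built from the waves
λ^m e^φ and the moment functionals with weight ζ^n e^{-φ}, which are smooth in p because their
derivatives are again waves and moments. So G is holomorphic in operator norm
(`hasFDerivAt_conjOp`), and so are z = e^φ χ = (1-G)⁻¹e^φ and all the w_n.

Differentiating (1-G)z = e^φ shows that 1-G maps each derivative of z to a combination of waves.
Comparing waves and using injectivity of 1-G yields a Lax pair. With g = w_0 and e^{-s} = 1 - w_{-1}
it reads z_uv + s_u z_v = (a + g_v)z and z_t = αz_uu + βz_vv + 2βs_v z_v - 2αg_u z (`lax_space`,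
`lax_time`). Taking moments turns the pair into recursions for the w_n (`coeff_space`,
`coeff_time`).

The rest is differential algebra. For n = -1 the recursions say that k = -w_{-2}e^s satisfies a k_u
= g_v + s_uv, and that s satisfies the first equation of the system with Π = -αs_uu - βs_vv + 2aβk_v
- 2αg_u; the relation for k then gives Π_uv = 2Pc. For n = 0, eliminating w_1 between the two
recursions gives the equation for c = -g_v - s_uv/2 (`density_eq`). -/

theorem norm_iteratedFDeriv_le_of_differentiableOn {f : ℂ → ℂ} {z : ℂ} {δ M : ℝ} (hδ : 0 < δ)
    (hf : DifferentiableOn ℂ f (closedBall z δ)) (hM : ∀ w ∈ closedBall z δ, ‖f w‖ ≤ M) (j : ℕ) :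
    ‖iteratedFDeriv ℝ j f z‖ ≤ j.factorial * M / δ ^ j := by
  have hcd : ContDiffAt ℂ j f z :=
    ((hf.mono ball_subset_closedBall).analyticAt (ball_mem_nhds z hδ)).contDiffAt
  have h := hcd.restrictScalars_iteratedFDeriv (𝕜 := ℝ)
  rw [← h, Function.comp_apply, ContinuousMultilinearMap.norm_restrictScalars,
    norm_iteratedFDeriv_eq_norm_iteratedDeriv]
  refine Complex.norm_iteratedDeriv_le_of_forall_mem_sphere_norm_le j hδ
    (DifferentiableOn.diffContOnCl (hf.mono closure_ball_subset_closedBall))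
    fun w hw => hM w (sphere_subset_closedBall hw)

/-- Cauchy estimates on discs of one fixed radius around the points of `K`. On holomorphic functions
a compactly supported distribution is therefore controlled by a supremum over a slightly larger
compact set, whatever its order. -/
theorem exists_compact_norm_iteratedFDeriv_le {K : Set ℂ} (hK : IsCompact K) {W : Set ℂ}
    (hW : IsOpen W) (hKW : K ⊆ W) : ∃ K' : Set ℂ, IsCompact K' ∧ K' ⊆ W ∧ ∀ N : ℕ, ∃ C : ℝ, 0 ≤ C ∧
      ∀ (f : ℂ → ℂ) (M : ℝ), 0 ≤ M → DifferentiableOn ℂ f K' → (∀ z ∈ K', ‖f z‖ ≤ M) →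
        ∀ z ∈ K, ∀ j ≤ N, ‖iteratedFDeriv ℝ j f z‖ ≤ C * M := by
  obtain ⟨δ, hδ, hsub⟩ := hK.exists_cthickening_subset_open hW hKW
  refine ⟨cthickening δ K, hK.cthickening, hsub, fun N =>
    ⟨∑ j ∈ Finset.range (N + 1), j.factorial / δ ^ j, by positivity,
      fun f M hM hf hb z hz j hj => ?_⟩⟩
  have hball : closedBall z δ ⊆ cthickening δ K := closedBall_subset_cthickening hz δ
  refine (norm_iteratedFDeriv_le_of_differentiableOn hδ (hf.mono hball)
    (fun w hw => hb w (hball hw)) j).trans ?_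
  rw [mul_div_right_comm]
  refine mul_le_mul_of_nonneg_right ?_ hM
  exact Finset.single_le_sum (f := fun j : ℕ => (j.factorial : ℝ) / δ ^ j)
    (fun i _ => by positivity) (Finset.mem_range.2 (by omega))

theorem exists_norm_iteratedFDeriv_mul_le {W : Set ℂ} (hW : IsOpen W) {K : Set ℂ}
    (hK : IsCompact K) (hKW : K ⊆ W) {g : ℂ → ℂ} (hg : ContDiffOn ℝ ∞ g W) (N : ℕ) :
    ∃ C : ℝ, 0 ≤ C ∧ ∀ (f : ℂ → ℂ) (M : ℝ), 0 ≤ M → ContDiffOn ℝ ∞ f W →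
      (∀ z ∈ K, ∀ j ≤ N, ‖iteratedFDeriv ℝ j f z‖ ≤ M) →
        ∀ z ∈ K, ∀ j ≤ N, ‖iteratedFDeriv ℝ j (fun w => g w * f w) z‖ ≤ C * M := by
  have hbd : ∀ i : ℕ, ∃ c : ℝ, 0 ≤ c ∧ ∀ z ∈ K, ‖iteratedFDeriv ℝ i g z‖ ≤ c := by
    intro i
    have hcont : ContinuousOn (iteratedFDeriv ℝ i g) K :=
      ((hg.continuousOn_iteratedFDerivWithin (m := i) (by exact_mod_cast le_top)
        hW.uniqueDiffOn).congr
        (fun z hz => (iteratedFDerivWithin_of_isOpen i hW hz).symm)).mono hKW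
    obtain ⟨c, hc⟩ := hK.exists_bound_of_continuousOn hcont
    exact ⟨max c 0, le_max_right _ _, fun z hz => (hc z hz).trans (le_max_left _ _)⟩
  choose c hc0 hc using hbd
  refine ⟨∑ j ∈ Finset.range (N + 1), ∑ i ∈ Finset.range (j + 1), (j.choose i : ℝ) * c i,
    Finset.sum_nonneg fun j _ => Finset.sum_nonneg fun i _ =>
      mul_nonneg (Nat.cast_nonneg _) (hc0 i), fun f M hM hf hb z hz j hj => ?_⟩
  have h := norm_iteratedFDerivWithin_mul_le hg hf hW.uniqueDiffOn (hKW hz) (n := j)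
    (by exact_mod_cast le_top)
  simp only [iteratedFDerivWithin_of_isOpen _ hW (hKW hz)] at h
  refine h.trans ?_
  calc _ ≤ ∑ i ∈ Finset.range (j + 1), (j.choose i : ℝ) * c i * M := by
        refine Finset.sum_le_sum fun i _ => ?_
        refine mul_le_mul (mul_le_mul_of_nonneg_left (hc i z hz) (Nat.cast_nonneg _))
          (hb z hz _ (by omega)) (norm_nonneg _) (mul_nonneg (Nat.cast_nonneg _) (hc0 i))
    _ = (∑ i ∈ Finset.range (j + 1), (j.choose i : ℝ) * c i) * M := by rw [Finset.sum_mul]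
    _ ≤ _ := by
        refine mul_le_mul_of_nonneg_right ?_ hM
        exact Finset.single_le_sum
          (f := fun j : ℕ => ∑ i ∈ Finset.range (j + 1), (j.choose i : ℝ) * c i)
          (fun j _ => Finset.sum_nonneg fun i _ => mul_nonneg (Nat.cast_nonneg _) (hc0 i))
          (Finset.mem_range.2 (by omega))

/-- All derivatives fall on the compactly supported factor, so `g` need only be locally integrable.
The induction replaces `f` by its derivative, whose values are linear maps; this is why the spaces
and the bilinear map `L` are quantified after `j`. -/
theorem norm_iteratedFDeriv_convolution_le {g : ℂ → ℂ} (hg : LocallyIntegrable g volume)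
    {K₁ K₂ : Set ℂ} (hK₁ : IsCompact K₁) (hK₂ : IsCompact K₂) (j : ℕ) :
    ∀ {E F : Type} [NormedAddCommGroup E] [NormedSpace ℝ E] [NormedAddCommGroup F]
      [NormedSpace ℝ F] (L : E →L[ℝ] ℂ →L[ℝ] F) {f : ℂ → E} {M : ℝ}, ContDiff ℝ ∞ f →
      tsupport f ⊆ K₁ → 0 ≤ M → (∀ z, ‖iteratedFDeriv ℝ j f z‖ ≤ M) →
      ∀ z ∈ K₂, ‖iteratedFDeriv ℝ j (convolution f g L volume) z‖ ≤
        ‖L‖ * (∫ w in K₂ - K₁, ‖g w‖) * M := by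
  induction j with
  | zero =>
    intro E F _ _ _ _ L f M hf hsupp hM hb z hz
    simp only [norm_iteratedFDeriv_zero] at hb ⊢
    have hcs : HasCompactSupport f := hK₁.of_isClosed_subset (isClosed_tsupport f) hsupp
    rw [convolution]
    have hsub : z +ᵥ (-K₁) ⊆ K₂ - K₁ := by
      rintro _ ⟨w, hw, rfl⟩
      exact ⟨z, hz, -w, hw, by simp⟩
    have hint : IntegrableOn (fun w => ‖g w‖) (K₂ - K₁) :=
      (hg.integrableOn_isCompact (by simpa [sub_eq_add_neg] using hK₂.add hK₁.neg)).norm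
    have hmeas : MeasurableSet K₁ := hK₁.measurableSet
    have hpt : (fun t => ‖g (z - t)‖) = fun t => ‖g (-(t - z))‖ := by ext t; simp
    have hmp : MeasurePreserving (fun t : ℂ => z - t) volume volume :=
      Measure.measurePreserving_sub_left volume z
    have hme : MeasurableEmbedding (fun t : ℂ => z - t) :=
      (MeasurableEquiv.subLeft z).measurableEmbedding
    have himg : K₁ ⊆ (fun t : ℂ => z - t) ⁻¹' (K₂ - K₁) := fun t ht => ⟨z, hz, t, ht, rfl⟩
    have hint1 : IntegrableOn (fun t => ‖g (z - t)‖) ((fun t : ℂ => z - t) ⁻¹' (K₂ - K₁)) :=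
      (hmp.integrableOn_comp_preimage hme (f := fun w => ‖g w‖)).2 hint
    calc ‖∫ t, L (f t) (g (z - t))‖ = ‖∫ t in K₁, L (f t) (g (z - t))‖ := by
          rw [setIntegral_eq_integral_of_forall_compl_eq_zero]
          intro t ht
          rw [image_eq_zero_of_notMem_tsupport (fun h => ht (hsupp h))]
          simp
      _ ≤ ∫ t in K₁, ‖L‖ * M * ‖g (z - t)‖ := by
          refine norm_integral_le_of_norm_le ((hint1.mono_set himg).const_mul _) ?_
          refine ae_of_all _ fun t => ?_
          refine (L.le_opNorm₂ _ _).trans ?_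
          gcongr
          exact hb t
      _ = ‖L‖ * M * ∫ t in K₁, ‖g (z - t)‖ := by rw [integral_const_mul]
      _ ≤ ‖L‖ * M * ∫ w in K₂ - K₁, ‖g w‖ := by
          refine mul_le_mul_of_nonneg_left ?_ (by positivity)
          rw [← hmp.setIntegral_preimage_emb hme (fun w => ‖g w‖)]
          exact setIntegral_mono_set hint1 (Eventually.of_forall fun t => by positivity)
            himg.eventuallyLE
      _ = _ := by ring
  | succ j ih =>
    intro E F _ _ _ _ L f M hf hsupp hM hb z hz
    have hcs : HasCompactSupport f := hK₁.of_isClosed_subset (isClosed_tsupport f) hsupp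
    have hfd : fderiv ℝ (convolution f g L volume) =
        convolution (fderiv ℝ f) g (L.precompL ℂ) volume := by
      ext1 x
      exact (hcs.hasFDerivAt_convolution_left L (hf.of_le (by exact_mod_cast le_top)) hg x).fderiv
    rw [← norm_iteratedFDeriv_fderiv, hfd]
    refine (ih (L.precompL ℂ) (f := fderiv ℝ f) (M := M) (hf.fderiv_right (by exact_mod_cast le_rfl))
      ((tsupport_fderiv_subset ℝ).trans hsupp) hM
      (fun w => by rw [norm_iteratedFDeriv_fderiv]; exact hb w) z hz).trans ?_
    gcongr
    exact ContinuousLinearMap.norm_precompL_le ℂ L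

end Estimates

/-! ### The Cauchy–Pompeiu formula -/

section CauchyPompeiu

/-- The operator `∂/∂λ̄`. -/
noncomputable def dbar (f : ℂ → ℂ) (z : ℂ) : ℂ :=
  (1 / 2 : ℂ) * (fderiv ℝ f z 1 + Complex.I * fderiv ℝ f z Complex.I)

-- In polar coordinates about `ζ` the Jacobian r cancels the singularity of 1/(l - ζ). What is left
-- is half the radial derivative of `f` plus i/2 times its angular derivative divided by r. The
-- radial part integrates to -f(ζ) along each ray, the angular part to 0 along each circle.
open Complex in
theorem integral_dbar_div {f : ℂ → ℂ} (hf : ContDiff ℝ 1 f) (hc : HasCompactSupport f) (ζ : ℂ) :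
    ∫ l : ℂ, dbar f l / (l - ζ) = -(Real.pi : ℂ) * f ζ := by
  have hfd : Continuous (fderiv ℝ f) := hf.continuous_fderiv one_ne_zero
  have hcomp : ∀ u v : ℝ × ℝ → ℂ, Continuous u → Continuous v →
      Continuous fun p => fderiv ℝ f (u p) (v p) :=
    fun u v hu hv => (hfd.comp hu).clm_apply hv
  obtain ⟨R, hR0, hR⟩ : ∃ R : ℝ, 0 < R ∧ ∀ w : ℂ, R ≤ ‖w‖ → w + ζ ∉ tsupport f := by
    obtain ⟨R, hR⟩ := hc.isBounded.exists_norm_le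
    refine ⟨|R| + ‖ζ‖ + 1, by positivity, fun w hw hmem => ?_⟩
    have h1 := hR _ hmem
    have h2 : ‖w‖ ≤ ‖w + ζ‖ + ‖ζ‖ := by simpa using norm_sub_le (w + ζ) ζ
    linarith [le_abs_self R]
  have hfd0 : ∀ w : ℂ, R ≤ ‖w‖ → fderiv ℝ f (w + ζ) = 0 := fun w hw =>
    fderiv_of_notMem_tsupport ℝ (hR w hw)
  -- polar coordinates
  set w : ℝ × ℝ → ℂ := fun p => p.1 * (Real.cos p.2 + Real.sin p.2 * I) with hw
  set u : ℝ × ℝ → ℂ := fun p => (Real.cos p.2 + Real.sin p.2 * I) with hu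
  have hwc : Continuous w := by fun_prop
  have huc : Continuous u := by fun_prop
  have hun : ∀ p, ‖u p‖ = 1 := fun p => by
    simp only [hu]; push_cast; rw [← Complex.exp_mul_I]; exact norm_exp_ofReal_mul_I _
  have hwn : ∀ p, ‖w p‖ = |p.1| := fun p => by
    have : w p = p.1 * u p := rfl
    rw [this, norm_mul, hun, mul_one]; simp
  -- `A` is the radial derivative and `B` the angular derivative divided by r; written through
  -- `fderiv`, both are continuous up to r = 0.
  set A : ℝ × ℝ → ℂ := fun p => fderiv ℝ f (w p + ζ) (u p)
  set B : ℝ × ℝ → ℂ := fun p => fderiv ℝ f (w p + ζ) (I * u p)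
  have hAc : Continuous A := hcomp _ _ (hwc.add continuous_const) huc
  have hBc : Continuous B := hcomp _ _ (hwc.add continuous_const) (continuous_const.mul huc)
  have hint : ∀ H : ℝ × ℝ → ℂ, Continuous H → (∀ p, R ≤ p.1 → H p = 0) →
      IntegrableOn H (Set.Ioi (0 : ℝ) ×ˢ Set.Ioo (-Real.pi) Real.pi) (volume.prod volume) := by
    intro H hH hH0
    have h1 : IntegrableOn H (Set.Icc 0 R ×ˢ Set.Icc (-Real.pi) Real.pi) (volume.prod volume) :=
      hH.continuousOn.integrableOn_compact (isCompact_Icc.prod isCompact_Icc)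
    refine h1.of_forall_sdiff_eq_zero (measurableSet_Ioi.prod measurableSet_Ioo) ?_
    rintro ⟨r, θ⟩ ⟨⟨h2, h3⟩, h4⟩
    refine hH0 _ (le_of_lt (not_le.1 fun h5 => h4 ⟨⟨le_of_lt h2, h5⟩, ⟨h3.1.le, h3.2.le⟩⟩))
  have hA0 : ∀ p : ℝ × ℝ, R ≤ p.1 → A p = 0 := fun p hp => by
    have := hfd0 (w p) (by rw [hwn]; exact hp.trans (le_abs_self _))
    simp [A, this]
  have hB0 : ∀ p : ℝ × ℝ, R ≤ p.1 → B p = 0 := fun p hp => by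
    have := hfd0 (w p) (by rw [hwn]; exact hp.trans (le_abs_self _))
    simp [B, this]
  have hdiff : Differentiable ℝ f := hf.differentiable one_ne_zero
  have hIA : ∫ p in Set.Ioi (0 : ℝ) ×ˢ Set.Ioo (-Real.pi) Real.pi, A p ∂(volume.prod volume) =
      -(2 * Real.pi : ℂ) * f ζ := by
    have hsw : IntegrableOn (fun p => A p.swap) (Set.Ioo (-Real.pi) Real.pi ×ˢ Set.Ioi (0 : ℝ))
        (volume.prod volume) := (hint A hAc hA0).swap
    rw [← setIntegral_prod_swap, setIntegral_prod _ hsw]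
    have : ∀ θ : ℝ, ∫ r in Set.Ioi (0 : ℝ), A (r, θ) = -f ζ := by
      intro θ
      have hd : ∀ r ∈ Set.Ici (0 : ℝ), HasDerivAt (fun r : ℝ => f (w (r, θ) + ζ)) (A (r, θ)) r := by
        intro r _
        have h1 : HasDerivAt (fun r : ℝ => w (r, θ) + ζ) (u (r, θ)) r := by
          have := ((hasDerivAt_id r).ofReal_comp.mul_const (u (r, θ))).add_const ζ
          simpa using this
        exact ((hdiff _).hasFDerivAt).comp_hasDerivAt r h1
      have hI : IntegrableOn (fun r => A (r, θ)) (Set.Ioi (0 : ℝ)) := by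
        have h1 : IntegrableOn (fun r => A (r, θ)) (Set.Icc 0 R) :=
          (hAc.comp (by fun_prop : Continuous fun r : ℝ => (r, θ))).continuousOn.integrableOn_compact
            isCompact_Icc
        refine h1.of_forall_sdiff_eq_zero measurableSet_Ioi ?_
        rintro r ⟨h2, h4⟩
        exact hA0 _ (le_of_lt (not_le.1 fun h5 => h4 ⟨le_of_lt h2, h5⟩))
      have ht : Tendsto (fun r : ℝ => f (w (r, θ) + ζ)) atTop (𝓝 0) := by
        refine tendsto_const_nhds.congr' ?_
        filter_upwards [eventually_ge_atTop R] with r hr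
        exact (image_eq_zero_of_notMem_tsupport
          (hR _ (by rw [hwn]; exact hr.trans (le_abs_self _)))).symm
      rw [integral_Ioi_of_hasDerivAt_of_tendsto' hd hI ht]
      simp [hw]
    simp only [Prod.swap_prod_mk, this]
    rw [setIntegral_const, measureReal_def, Real.volume_Ioo,
      ENNReal.toReal_ofReal (by linarith [Real.pi_pos]), real_smul]
    push_cast
    ring
  have hIB : ∫ p in Set.Ioi (0 : ℝ) ×ˢ Set.Ioo (-Real.pi) Real.pi, B p ∂(volume.prod volume) =
      0 := by
    rw [setIntegral_prod _ (hint B hBc hB0)]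
    refine (setIntegral_congr_fun measurableSet_Ioi fun r hr => ?_).trans
      (integral_zero _ _)
    have hr0 : (r : ℂ) ≠ 0 := by exact_mod_cast (ne_of_gt hr : r ≠ 0)
    have hd : ∀ θ ∈ Set.uIcc (-Real.pi) Real.pi,
        HasDerivAt (fun θ : ℝ => f (w (r, θ) + ζ)) ((r : ℂ) * B (r, θ)) θ := by
      intro θ _
      have h1 : HasDerivAt (fun θ : ℝ => w (r, θ) + ζ) (r • (I * u (r, θ))) θ := by
        have hcs := (Real.hasDerivAt_cos θ).ofReal_comp.add
          ((Real.hasDerivAt_sin θ).ofReal_comp.mul_const I)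
        have := (hcs.const_mul (r : ℂ)).add_const ζ
        refine this.congr_deriv ?_
        simp only [hu, real_smul]
        push_cast
        linear_combination (-(r : ℂ) * Complex.sin θ) * I_mul_I
      have h2 := ((hdiff _).hasFDerivAt).comp_hasDerivAt θ h1
      refine h2.congr_deriv ?_
      rw [map_smul, real_smul]
    have hI : IntervalIntegrable (fun θ => (r : ℂ) * B (r, θ)) volume (-Real.pi) Real.pi :=
      (continuous_const.mul (hBc.comp (by fun_prop : Continuous fun θ : ℝ => (r, θ)))).intervalIntegrable
        _ _
    have h := intervalIntegral.integral_eq_sub_of_hasDerivAt hd hI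
    rw [intervalIntegral.integral_const_mul] at h
    have h3 : w (r, Real.pi) = w (r, -Real.pi) := by simp [hw]
    rw [h3, sub_self, mul_eq_zero, or_iff_right hr0,
      intervalIntegral.integral_of_le (by linarith [Real.pi_pos]), integral_Ioc_eq_integral_Ioo] at h
    exact h
  have htr : ∫ l : ℂ, dbar f l / (l - ζ) = ∫ l : ℂ, dbar f (l + ζ) / l := by
    rw [← integral_add_right_eq_self _ ζ]
    simp
  rw [htr, ← Complex.integral_comp_polarCoord_symm, polarCoord_target]
  have hker : Set.EqOn (fun p : ℝ × ℝ => p.1 • (dbar f (Complex.polarCoord.symm p + ζ) /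
      Complex.polarCoord.symm p)) (fun p => (1 / 2 : ℂ) * A p + (I / 2) * B p)
      (Set.Ioi (0 : ℝ) ×ˢ Set.Ioo (-Real.pi) Real.pi) := by
    rintro ⟨r, θ⟩ ⟨hr, -⟩
    have hr0 : (r : ℂ) ≠ 0 := by exact_mod_cast (ne_of_gt hr : r ≠ 0)
    have hws : Complex.polarCoord.symm (r, θ) = w (r, θ) := by
      simp [hw, Complex.polarCoord_symm_apply]
    have hu0 : u (r, θ) ≠ 0 := by
      rw [← norm_ne_zero_iff, hun]; exact one_ne_zero
    have hwr : w (r, θ) = r * u (r, θ) := rfl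
    simp only [hws, A, B, dbar]
    set T := fderiv ℝ f (w (r, θ) + ζ)
    have e1 : u (r, θ) = Real.cos θ • (1 : ℂ) + Real.sin θ • I := by simp [hu]
    have e2 : I * u (r, θ) = -Real.sin θ • (1 : ℂ) + Real.cos θ • I := by
      simp only [hu, real_smul]; push_cast; linear_combination (Complex.sin θ) * I_mul_I
    have e3 : T (u (r, θ)) = Real.cos θ * T 1 + Real.sin θ * T I := by
      rw [e1, map_add, map_smul, map_smul, real_smul, real_smul]
    have e4 : T (I * u (r, θ)) = -Real.sin θ * T 1 + Real.cos θ * T I := by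
      rw [e2, map_add, map_smul, map_smul, real_smul, real_smul]; push_cast; ring
    rw [e3, e4, real_smul, hwr, mul_div_assoc', div_eq_iff (mul_ne_zero hr0 hu0)]
    simp only [hu]
    have hsq : (Real.cos θ : ℂ) ^ 2 + (Real.sin θ : ℂ) ^ 2 = 1 := by
      exact_mod_cast Real.cos_sq_add_sin_sq θ
    linear_combination (-(r : ℂ) / 2 * (T 1 + I * T I)) * hsq +
      ((r : ℂ) / 2 * (Real.sin θ ^ 2 * T 1 - Real.cos θ * Real.sin θ * T I)) * I_mul_I
  rw [setIntegral_congr_fun (measurableSet_Ioi.prod measurableSet_Ioo) hker, Measure.volume_eq_prod,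
    integral_add ((hint A hAc hA0).const_mul _) ((hint B hBc hB0).const_mul _),
    integral_const_mul, integral_const_mul, hIA, hIB]
  ring

end CauchyPompeiu

open scoped Pointwise

/-! ### Distributions and their local bounds -/

section TestFunctions

variable {U : Opens ℂ}

/-- A linear form on test functions that is bounded on each `𝓓_K` by finitely many derivatives is
continuous. -/
theorem exists_distr_of_bound (T : 𝓓(U, ℂ) →ₗ[ℂ] ℂ)
    (h : ∀ K : Set ℂ, IsCompact K → K ⊆ U → ∃ (N : ℕ) (C : ℝ), 0 ≤ C ∧ ∀ (ψ : 𝓓(U, ℂ)) (M : ℝ), 0 ≤ M →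
      tsupport ψ ⊆ K → (∀ z, ∀ j ≤ N, ‖iteratedFDeriv ℝ j ψ z‖ ≤ M) → ‖T ψ‖ ≤ C * M) :
    Continuous T := by
  rw [TestFunction.continuous_iff_continuous_comp]
  intro K hK
  obtain ⟨N, C, hC, hb⟩ := h K K.isCompact hK
  let Φ := ContDiffMapSupportedIn.mkCLMtoNormedSpace (𝕜 := ℂ) (E := ℂ) (F := ℂ) (n := ⊤) (K := K)
    (fun f => T (TestFunction.ofSupportedIn hK f))
    (fun f g => by rw [← map_add]; rfl) (fun c f => by rw [← map_smul]; rfl)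
    ⟨Finset.range (N + 1), C, hC, fun f => hb _ _ (apply_nonneg _ _)
      f.tsupport_subset fun z j hj => by
        refine (ContDiffMapSupportedIn.norm_iteratedFDeriv_apply_le_seminorm_top ℂ).trans ?_
        exact (Seminorm.le_def.1 (Finset.le_sup (f := fun i =>
          ContDiffMapSupportedIn.seminorm ℂ ℂ ℂ ⊤ K i) (Finset.mem_range.2 (by omega)))) f⟩
  exact Φ.continuous

theorem exists_bound_of_distr (T : Distr U) {K : Set ℂ} (hK : IsCompact K) (hKU : K ⊆ U) :
    ∃ (N : ℕ) (C : ℝ), 0 ≤ C ∧ ∀ (ψ : 𝓓(U, ℂ)) (M : ℝ), 0 ≤ M →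
      tsupport ψ ⊆ K → (∀ z ∈ K, ∀ j ≤ N, ‖iteratedFDeriv ℝ j ψ z‖ ≤ M) → ‖T ψ‖ ≤ C * M := by
  let K' : Compacts ℂ := ⟨K, hK⟩
  have hK' : (K' : Set ℂ) ⊆ U := hKU
  let S := T ∘L TestFunction.ofSupportedInCLM ℂ (n := ⊤) hK'
  obtain ⟨s, C, -, hC⟩ := Seminorm.bound_of_continuous
    (ContDiffMapSupportedIn.withSeminorms ℂ ℂ ℂ ⊤ K') ((normSeminorm ℂ ℂ).comp S.toLinearMap)
    (continuous_norm.comp S.continuous)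
  refine ⟨s.sup id, C, C.2, fun ψ M hM hψ hb => ?_⟩
  let f : 𝓓_{K'}(ℂ, ℂ) := .of_support_subset ψ.contDiff (subset_closure.trans hψ)
  have h1 : ‖T ψ‖ ≤ C * (s.sup (ContDiffMapSupportedIn.seminorm ℂ ℂ ℂ ⊤ K')) f := hC f
  refine h1.trans (mul_le_mul_of_nonneg_left ?_ C.2)
  refine Seminorm.finset_sup_apply_le hM fun i hi => ?_
  rw [ContDiffMapSupportedIn.seminorm_top_le_iff ℂ hM]
  exact fun z hz => hb z hz i (Finset.le_sup (f := id) hi)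

end TestFunctions

/-! ### The Cauchy transform and the operator ∂̄ -/

section CauchyTransform

/-- The Cauchy transform `ζ ↦ (1/π) ∬ f(λ) / (λ - ζ) dA(λ)`. -/
noncomputable def cauchyFn (f : ℂ → ℂ) (ζ : ℂ) : ℂ := (1 / (Real.pi : ℂ)) * ∫ l : ℂ, f l / (l - ζ)

theorem ofReal_pi_ne_zero : (Real.pi : ℂ) ≠ 0 := by exact_mod_cast Real.pi_ne_zero

theorem integral_div_sub_eq_convolution (f : ℂ → ℂ) :
    (fun ζ : ℂ => ∫ l : ℂ, f l / (l - ζ)) =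
      convolution f (-fun z : ℂ => z⁻¹) (ContinuousLinearMap.mul ℝ ℂ) volume := by
  funext ζ
  refine integral_congr_ae (ae_of_all _ fun l => ?_)
  simp only [ContinuousLinearMap.mul_apply', Pi.neg_apply, div_eq_mul_inv, ← inv_neg, neg_sub]

variable {f : ℂ → ℂ}

theorem integrable_div_sub (hf : Continuous f) (hc : HasCompactSupport f) (ζ : ℂ) :
    Integrable fun l : ℂ => f l / (l - ζ) := by
  have h := hc.convolutionExists_left (ContinuousLinearMap.mul ℝ ℂ) (μ := volume) hf
    locallyIntegrable_inv.neg ζ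
  refine h.congr (ae_of_all _ fun l => ?_)
  simp only [ContinuousLinearMap.mul_apply', Pi.neg_apply, div_eq_mul_inv, ← inv_neg, neg_sub]

theorem contDiff_cauchyFn {n : ℕ∞} (hf : ContDiff ℝ n f) (hc : HasCompactSupport f) :
    ContDiff ℝ n (cauchyFn f) := by
  refine contDiff_const.mul ?_
  rw [integral_div_sub_eq_convolution]
  exact hc.contDiff_convolution_left (ContinuousLinearMap.mul ℝ ℂ) hf locallyIntegrable_inv.neg

theorem fderiv_cauchyFn (hf : ContDiff ℝ 1 f) (hc : HasCompactSupport f) (ζ v : ℂ) :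
    fderiv ℝ (cauchyFn f) ζ v = cauchyFn (fun l => fderiv ℝ f l v) ζ := by
  have h := hc.hasFDerivAt_convolution_left (ContinuousLinearMap.mul ℝ ℂ) (μ := volume) hf
    locallyIntegrable_inv.neg ζ
  rw [← integral_div_sub_eq_convolution] at h
  have h1 := (h.const_mul (1 / (Real.pi : ℂ))).fderiv
  have hex := (hc.fderiv ℝ).convolutionExists_left ((ContinuousLinearMap.mul ℝ ℂ).precompL ℂ)
    (μ := volume) (hf.continuous_fderiv one_ne_zero) locallyIntegrable_inv.neg ζ
  have : cauchyFn f = fun y => 1 / (Real.pi : ℂ) * ∫ l : ℂ, f l / (l - y) := rfl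
  rw [this, h1, cauchyFn, smul_apply, smul_eq_mul, convolution_def,
    ContinuousLinearMap.integral_apply hex]
  congr 1
  refine integral_congr_ae (ae_of_all _ fun l => ?_)
  simp [ContinuousLinearMap.precompL_apply, div_eq_mul_inv, ← inv_neg]

theorem cauchyFn_add {g : ℂ → ℂ} (hf : Continuous f) (hc : HasCompactSupport f)
    (hg : Continuous g) (hgc : HasCompactSupport g) (ζ : ℂ) :
    cauchyFn (fun l => f l + g l) ζ = cauchyFn f ζ + cauchyFn g ζ := by
  simp only [cauchyFn, add_div]
  rw [integral_add (integrable_div_sub hf hc ζ) (integrable_div_sub hg hgc ζ), mul_add]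

theorem cauchyFn_const_mul (c : ℂ) (ζ : ℂ) :
    cauchyFn (fun l => c * f l) ζ = c * cauchyFn f ζ := by
  simp only [cauchyFn, mul_div_assoc]
  rw [integral_const_mul]
  ring

theorem cauchyFn_dbar (hf : ContDiff ℝ 1 f) (hc : HasCompactSupport f) (ζ : ℂ) :
    cauchyFn (dbar f) ζ = -f ζ := by
  rw [cauchyFn, integral_dbar_div hf hc]
  field_simp [ofReal_pi_ne_zero]

/-- The Cauchy transform is a convolution, so ∂̄ passes to `f`, and `cauchyFn_dbar` applies. -/
theorem dbar_cauchyFn (hf : ContDiff ℝ 1 f) (hc : HasCompactSupport f) (ζ : ℂ) :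
    dbar (cauchyFn f) ζ = -f ζ := by
  have hcont : ∀ v : ℂ, Continuous fun l => fderiv ℝ f l v := fun v =>
    (hf.continuous_fderiv one_ne_zero).clm_apply continuous_const
  have hcs : ∀ v : ℂ, HasCompactSupport fun l => fderiv ℝ f l v := fun v =>
    (hc.fderiv ℝ).comp_left (g := fun L : ℂ →L[ℝ] ℂ => L v) rfl
  rw [← cauchyFn_dbar hf hc, dbar, fderiv_cauchyFn hf hc, fderiv_cauchyFn hf hc,
    ← cauchyFn_const_mul (f := fun l => fderiv ℝ f l Complex.I),
    ← cauchyFn_add (hcont _) (hcs _) (g := fun l => Complex.I * fderiv ℝ f l Complex.I)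
      (continuous_const.mul (hcont _)) (hcs Complex.I).mul_left,
    ← cauchyFn_const_mul]
  rfl

theorem dbar_mul {f g : ℂ → ℂ} {z : ℂ} (hf : DifferentiableAt ℝ f z) (hg : DifferentiableAt ℝ g z) :
    dbar (fun w => f w * g w) z = f z * dbar g z + g z * dbar f z := by
  simp only [dbar, fderiv_fun_mul hf hg, add_apply, smul_apply, smul_eq_mul]
  ring

theorem dbar_eq_zero {f : ℂ → ℂ} {z : ℂ} (hf : DifferentiableAt ℂ f z) : dbar f z = 0 := by
  have h := hf.hasFDerivAt.restrictScalars ℝ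
  rw [dbar, h.fderiv]
  have h1 : fderiv ℂ f z Complex.I = Complex.I * fderiv ℂ f z 1 := by
    rw [← smul_eq_mul, ← map_smul, smul_eq_mul, mul_one]
  simp only [ContinuousLinearMap.coe_restrictScalars', h1]
  linear_combination (1 / 2 * fderiv ℂ f z 1) * Complex.I_mul_I

theorem differentiableAt_of_dbar_eq_zero {f : ℂ → ℂ} {z : ℂ} (hf : DifferentiableAt ℝ f z)
    (h : dbar f z = 0) : DifferentiableAt ℂ f z := by
  refine differentiableAt_complex_iff_differentiableAt_real.2 ⟨hf, ?_⟩
  rw [dbar] at h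
  rw [smul_eq_mul]
  linear_combination (-2 * Complex.I) * h + (fderiv ℝ f z Complex.I) * Complex.I_mul_I

/-- Cauchy–Pompeiu at the origin for l·f(l), which vanishes there and whose ∂̄-derivative divided by
l is that of `f`. -/
theorem integral_dbar (hf : ContDiff ℝ 1 f) (hc : HasCompactSupport f) : ∫ l : ℂ, dbar f l = 0 := by
  have h := integral_dbar_div (f := fun l => l * f l) (contDiff_id.mul hf) hc.mul_left 0
  simp only [zero_mul, mul_zero, sub_zero] at h
  rw [← h]
  refine integral_congr_ae ?_
  filter_upwards [(measure_eq_zero_iff_ae_notMem (μ := (volume : Measure ℂ)) (s := {0})).1 (by simp)]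
    with l hl
  rw [dbar_mul (f := fun w : ℂ => w) differentiableAt_id (hf.differentiable one_ne_zero l),
    dbar_eq_zero (f := fun w : ℂ => w) differentiableAt_id, mul_zero, add_zero,
    mul_div_cancel_left₀ _ (by simpa using hl)]

theorem dbarTest_apply (ψ : 𝓓((⊤ : Opens ℂ), ℂ)) (z : ℂ) : dbarTest ψ z = dbar ψ z := by
  have hd : ∀ v : ℂ, (LineDeriv.lineDerivOp v ψ : 𝓓((⊤ : Opens ℂ), ℂ)) z = fderiv ℝ ψ z v := by
    intro v
    rw [TestFunction.lineDerivOp_eq_lineDerivCLM ℝ, TestFunction.lineDerivCLM_apply_of_le (𝕜 := ℝ) (by simp),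
      (ψ.contDiff.differentiable (by simp)).differentiableAt.lineDeriv_eq_fderiv]
  change (1 / 2 : ℂ) * ((LineDeriv.lineDerivOp (1 : ℂ) ψ : 𝓓((⊤ : Opens ℂ), ℂ)) z + Complex.I *
    (LineDeriv.lineDerivOp Complex.I ψ : 𝓓((⊤ : Opens ℂ), ℂ)) z) = _
  rw [hd, hd]
  rfl

theorem cauchy_apply {U : Opens ℂ} (ψ : 𝓓(U, ℂ)) (ζ : ℂ) :
    (cauchy ψ : ℂ → ℂ) ζ = cauchyFn ψ ζ := rfl

/-- The derivatives of the Cauchy transform are bounded by those of the function. -/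
theorem exists_norm_iteratedFDeriv_cauchyFn_le {K₁ K₂ : Set ℂ} (hK₁ : IsCompact K₁)
    (hK₂ : IsCompact K₂) : ∃ C : ℝ, 0 ≤ C ∧ ∀ (f : ℂ → ℂ) (M : ℝ) (j : ℕ), ContDiff ℝ ∞ f →
      tsupport f ⊆ K₁ → 0 ≤ M → (∀ z, ‖iteratedFDeriv ℝ j f z‖ ≤ M) →
      ∀ z ∈ K₂, ‖iteratedFDeriv ℝ j (cauchyFn f) z‖ ≤ C * M := by
  have h0 : 0 ≤ (∫ w in K₂ - K₁, ‖(-fun z : ℂ => z⁻¹) w‖) :=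
    integral_nonneg fun _ => norm_nonneg _
  refine ⟨‖1 / (Real.pi : ℂ)‖ * (‖ContinuousLinearMap.mul ℝ ℂ‖ *
    (∫ w in K₂ - K₁, ‖(-fun z : ℂ => z⁻¹) w‖)), by positivity, fun f M j hf hsupp hM hb z hz => ?_⟩
  have hc : HasCompactSupport f := hK₁.of_isClosed_subset (isClosed_tsupport f) hsupp
  have hcd : ContDiff ℝ ∞ (convolution f (-fun z : ℂ => z⁻¹) (ContinuousLinearMap.mul ℝ ℂ)
      volume) :=
    hc.contDiff_convolution_left (ContinuousLinearMap.mul ℝ ℂ) hf locallyIntegrable_inv.neg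
  have he : cauchyFn f = (1 / (Real.pi : ℂ)) • convolution f (-fun z : ℂ => z⁻¹)
      (ContinuousLinearMap.mul ℝ ℂ) volume := by
    rw [← integral_div_sub_eq_convolution]; rfl
  rw [he, iteratedFDeriv_const_smul_apply ((hcd.of_le (by exact_mod_cast le_top)).contDiffAt),
    norm_smul, mul_assoc]
  exact mul_le_mul_of_nonneg_left (norm_iteratedFDeriv_convolution_le locallyIntegrable_inv.neg
    hK₁ hK₂ j (ContinuousLinearMap.mul ℝ ℂ) hf hsupp hM hb z hz) (norm_nonneg _)

/-- Once |ζ| is at least twice the radius of the support, |l - ζ| ≥ |ζ|/2 for every l in the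
support. -/
theorem exists_norm_cauchyFn_le_div (hf : Continuous f) (hc : HasCompactSupport f) :
    ∃ C R : ℝ, 0 ≤ C ∧ 0 < R ∧ tsupport f ⊆ Metric.ball 0 R ∧
      ∀ ζ : ℂ, R ≤ ‖ζ‖ → ‖cauchyFn f ζ‖ ≤ C / ‖ζ‖ := by
  obtain ⟨R, hR⟩ := hc.isBounded.exists_norm_le
  have hR' : ∀ x ∈ tsupport f, ‖x‖ ≤ |R| := fun x hx => (hR x hx).trans (le_abs_self R)
  refine ⟨‖1 / (Real.pi : ℂ)‖ * (2 * ∫ l, ‖f l‖), 2 * |R| + 1, ?_, by positivity, ?_, ?_⟩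
  · have := integral_nonneg (μ := volume) (f := fun l => ‖f l‖) fun l => norm_nonneg _
    positivity
  · intro x hx
    rw [mem_ball_zero_iff]
    linarith [hR' x hx, abs_nonneg R]
  · intro ζ hζ
    have hζ0 : 0 < ‖ζ‖ := by linarith [abs_nonneg R]
    rw [cauchyFn, norm_mul, mul_div_assoc]
    refine mul_le_mul_of_nonneg_left ?_ (norm_nonneg _)
    have hint : Integrable fun l => (2 / ‖ζ‖) * ‖f l‖ :=
      ((hf.integrable_of_hasCompactSupport hc).norm).const_mul _
    refine (norm_integral_le_of_norm_le hint (ae_of_all _ fun l => ?_)).trans_eq ?_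
    · by_cases hl : l ∈ tsupport f
      · rw [norm_div, div_eq_mul_inv, mul_comm]
        refine mul_le_mul_of_nonneg_right ?_ (norm_nonneg _)
        have h1 : ‖ζ‖ / 2 ≤ ‖l - ζ‖ := by
          have := norm_sub_norm_le ζ l
          rw [norm_sub_rev] at this
          linarith [hR' l hl]
        rw [inv_le_comm₀ (by linarith) (by positivity)]
        simpa using h1
      · simp [image_eq_zero_of_notMem_tsupport hl]
    · rw [integral_const_mul]
      ring

end CauchyTransform

/-! ### A Liouville theorem for distributions -/

section Liouville

/-- Smooth cutoff functions, equal to `1` on the disc of radius `R` and supported in the disc of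
radius `2R`, with gradient of order `1/R`. -/
theorem exists_cutoff : ∃ C : ℝ, 0 ≤ C ∧ ∀ R : ℝ, 0 < R → ∃ θ : ℂ → ℂ, ContDiff ℝ ∞ θ ∧
    (∀ z, ‖z‖ < R → θ z = 1) ∧ (∀ z, 2 * R ≤ ‖z‖ → θ z = 0) ∧ ∀ z, ‖dbar θ z‖ ≤ C / R := by
  let b : ContDiffBump (0 : ℂ) := ⟨1, 2, one_pos, one_lt_two⟩
  let θ₀ : ℂ → ℂ := fun z => (b z : ℂ)
  have hθ₀ : ContDiff ℝ ∞ θ₀ := Complex.ofRealCLM.contDiff.comp b.contDiff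
  have hcs : HasCompactSupport θ₀ := b.hasCompactSupport.comp_left (g := fun x : ℝ => (x : ℂ)) rfl
  obtain ⟨C, hC⟩ := (hθ₀.continuous_fderiv (by simp)).bounded_above_of_compact_support
    (hcs.fderiv ℝ)
  have hC0 : 0 ≤ C := (norm_nonneg _).trans (hC 0)
  refine ⟨C, hC0, fun R hR => ⟨fun z => θ₀ (R⁻¹ • z), hθ₀.comp (contDiff_const_smul _), ?_, ?_, ?_⟩⟩
  · intro z hz
    have : b (R⁻¹ • z) = 1 := b.one_of_mem_closedBall (by
      rw [mem_closedBall_zero_iff, norm_smul, norm_inv, Real.norm_of_nonneg hR.le]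
      change _ ≤ (1 : ℝ)
      rw [inv_mul_le_one₀ hR]; exact hz.le)
    change ((b (R⁻¹ • z) : ℝ) : ℂ) = 1
    rw [this, Complex.ofReal_one]
  · intro z hz
    have : b (R⁻¹ • z) = 0 := b.zero_of_le_dist (by
      rw [dist_zero_right, norm_smul, norm_inv, Real.norm_of_nonneg hR.le]
      change (2 : ℝ) ≤ _
      rw [le_inv_mul_iff₀ hR]; linarith)
    change ((b (R⁻¹ • z) : ℝ) : ℂ) = 0
    rw [this, Complex.ofReal_zero]
  · intro z
    have hd : HasFDerivAt (fun z => θ₀ (R⁻¹ • z))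
        ((fderiv ℝ θ₀ (R⁻¹ • z)).comp (R⁻¹ • ContinuousLinearMap.id ℝ ℂ)) z :=
      ((hθ₀.differentiable (by simp) _).hasFDerivAt).comp z ((hasFDerivAt_id z).const_smul R⁻¹)
    have hv : ∀ v : ℂ, ‖v‖ = 1 → ‖fderiv ℝ (fun z => θ₀ (R⁻¹ • z)) z v‖ ≤ C / R := by
      intro v hv
      rw [hd.fderiv]
      simp only [ContinuousLinearMap.comp_apply, smul_apply, ContinuousLinearMap.id_apply]
      refine ((fderiv ℝ θ₀ _).le_opNorm _).trans ?_
      rw [norm_smul, hv, norm_inv, Real.norm_of_nonneg hR.le, mul_one, div_eq_mul_inv]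
      exact mul_le_mul_of_nonneg_right (hC _) (by positivity)
    have h1 := hv 1 (by simp)
    have h2 := hv Complex.I (by simp)
    rw [dbar, norm_mul]
    have h3 := norm_add_le (fderiv ℝ (fun z => θ₀ (R⁻¹ • z)) z 1)
      (Complex.I * fderiv ℝ (fun z => θ₀ (R⁻¹ • z)) z Complex.I)
    rw [norm_mul, Complex.norm_I, one_mul] at h3
    have h4 : ‖(1 / 2 : ℂ)‖ = 1 / 2 := by norm_num
    rw [h4]
    linarith

/-- A distribution with vanishing `∂̄`-derivative that is represented near `∞` by a function with
limit `0` is zero. -/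
theorem distr_eq_zero_of_dbar {T : Distr ⊤} (h0 : ∀ ψ, T (dbarTest ψ) = 0) {h : ℂ → ℂ} {r : ℝ}
    (hrep : RepresentedOn T h {l | r < ‖l‖}) (ht : Tendsto h (cocompact ℂ) (𝓝 0)) : T = 0 := by
  ext ψ
  have hψ1 : ContDiff ℝ 1 ψ := ψ.contDiff.of_le (by exact_mod_cast le_top)
  obtain ⟨C₁, hC₁, hcut⟩ := exists_cutoff
  obtain ⟨C₂, R₂, hC₂, hR₂, hsupp, hdec⟩ :=
    exists_norm_cauchyFn_le_div ψ.continuous ψ.hasCompactSupport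
  have hcc : ContDiff ℝ ∞ (cauchyFn ψ) := contDiff_cauchyFn ψ.contDiff ψ.hasCompactSupport
  have hball : ∀ ε > 0, ‖T ψ‖ ≤ 4 * Real.pi * C₁ * C₂ * ε := by
    intro ε hε
    have hev : ∀ᶠ l in cocompact ℂ, ‖h l‖ ≤ ε := by
      have := (tendsto_zero_iff_norm_tendsto_zero.1 ht).eventually (Iic_mem_nhds hε)
      exact this
    rw [← Metric.cobounded_eq_cocompact, ← comap_norm_atTop, eventually_comap,
      eventually_atTop] at hev
    obtain ⟨R₃, hR₃⟩ := hev
    obtain ⟨R, hRR₂, hRR₃, hRr⟩ : ∃ R : ℝ, R₂ ≤ R ∧ R₃ ≤ R ∧ r < R :=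
      ⟨max R₂ (max R₃ (r + 1)), le_max_left _ _, (le_max_left _ _).trans (le_max_right _ _),
        lt_of_lt_of_le (lt_add_one r) ((le_max_right _ _).trans (le_max_right _ _))⟩
    have hR : 0 < R := hR₂.trans_le hRR₂
    obtain ⟨θ, hθ, hθ1, hθ0, hθd⟩ := hcut R hR
    have hfs : Function.support (fun z => θ z * cauchyFn ψ z) ⊆ Metric.closedBall 0 (2 * R) := by
      intro z hz
      rw [mem_closedBall_zero_iff]
      by_contra hlt
      exact hz (by simp [hθ0 z (not_le.1 hlt).le])
    let F : 𝓓((⊤ : Opens ℂ), ℂ) := ⟨fun z => θ z * cauchyFn ψ z, hθ.mul hcc,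
      HasCompactSupport.of_support_subset_isCompact (isCompact_closedBall 0 (2 * R)) hfs,
      fun _ _ => trivial⟩
    -- `T` does not see `dbarTest F`, and ∂̄ of the Cauchy transform of ψ is -ψ, so ψ cancels where
    -- θ = 1. What remains lives in the annulus R ≤ |z| ≤ 2R and is O(R⁻²): one factor 1/R is the
    -- decay of the Cauchy transform, the other the bound on ∂̄θ. The area is O(R²), so only the
    -- smallness ε of `h` survives.
    set χ := dbarTest F + ψ with hχ
    have hTχ : T ψ = T χ := by rw [hχ, map_add, h0, zero_add]
    have hθdiff : Differentiable ℝ θ := hθ.differentiable (by simp)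
    have hcdiff : Differentiable ℝ (cauchyFn ψ) := hcc.differentiable (by simp)
    have hval : ∀ z, χ z = dbar (fun z => θ z * cauchyFn ψ z) z + ψ z := fun z =>
      congrArg (· + ψ z) (dbarTest_apply F z)
    have hval' : ∀ z, χ z = θ z * -ψ z + cauchyFn ψ z * dbar θ z + ψ z := fun z => by
      rw [hval, dbar_mul (hθdiff z) (hcdiff z), dbar_cauchyFn hψ1 ψ.hasCompactSupport]
    have hψ0 : ∀ z : ℂ, R ≤ ‖z‖ → ψ z = 0 := fun z hz =>
      image_eq_zero_of_notMem_tsupport fun hmem => by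
        have := hsupp hmem
        rw [mem_ball_zero_iff] at this
        linarith
    have hdθ : ∀ z : ℂ, ‖z‖ < R → dbar θ z = 0 := fun z hz => by
      have : θ =ᶠ[𝓝 z] fun _ => 1 := by
        filter_upwards [(isOpen_lt continuous_norm continuous_const).mem_nhds hz] with w hw
        exact hθ1 w hw
      rw [dbar, this.fderiv_eq]
      simp
    have hin : ∀ z : ℂ, ‖z‖ < R → χ z = 0 := fun z hz => by
      rw [hval', hdθ z hz, hθ1 z hz]; ring
    have hout : ∀ z : ℂ, 2 * R < ‖z‖ → χ z = 0 := fun z hz => by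
      have : (fun z => θ z * cauchyFn ψ z) =ᶠ[𝓝 z] fun _ => 0 := by
        filter_upwards [(isOpen_lt continuous_const continuous_norm).mem_nhds hz] with w hw
        rw [hθ0 w (le_of_lt hw), zero_mul]
      rw [hval, dbar, this.fderiv_eq, hψ0 z (by linarith)]
      simp
    have hts : tsupport χ ⊆ {l | r < ‖l‖} := by
      have : tsupport χ ⊆ {l | R ≤ ‖l‖} :=
        closure_minimal (fun z hz => by
          by_contra hlt
          exact hz (hin z (not_le.1 hlt))) (isClosed_le continuous_const continuous_norm)
      exact this.trans fun z hz => hRr.trans_le hz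
    have hbd : ∀ z ∈ Metric.closedBall (0 : ℂ) (2 * R),
        ‖h z * χ z‖ ≤ ε * (C₂ / R * (C₁ / R)) := by
      intro z _
      by_cases hz : ‖z‖ < R
      · rw [hin z hz, mul_zero, norm_zero]; positivity
      · rw [not_lt] at hz
        rw [norm_mul]
        refine mul_le_mul (hR₃ ‖z‖ (hRR₃.trans hz) z rfl) ?_ (norm_nonneg _) hε.le
        rw [hval', hψ0 z hz, neg_zero, mul_zero, zero_add, add_zero, norm_mul]
        refine mul_le_mul ((hdec z (hRR₂.trans hz)).trans ?_) (hθd z) (norm_nonneg _)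
          (by positivity)
        exact div_le_div_of_nonneg_left hC₂ hR hz
    rw [hTχ, hrep.2 χ hts, ← setIntegral_eq_integral_of_forall_compl_eq_zero
      (s := Metric.closedBall (0 : ℂ) (2 * R)) (fun z hz => by
        rw [hout z (by simpa using hz), mul_zero])]
    refine (norm_setIntegral_le_of_norm_le_const measure_closedBall_lt_top hbd).trans_eq ?_
    rw [measureReal_def, Complex.volume_closedBall]
    simp only [ENNReal.toReal_mul, ENNReal.toReal_pow, ENNReal.toReal_ofReal (by positivity : 0 ≤ 2 * R),
      ENNReal.coe_toReal, NNReal.coe_real_pi]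
    field_simp
    ring
  have hlim : ‖T ψ‖ ≤ 0 := by
    have : Tendsto (fun ε : ℝ => 4 * Real.pi * C₁ * C₂ * ε) (𝓝[>] 0) (𝓝 0) := by
      have h1 : Tendsto (fun ε : ℝ => 4 * Real.pi * C₁ * C₂ * ε) (𝓝 0)
        (𝓝 (4 * Real.pi * C₁ * C₂ * 0)) := (continuous_const.mul continuous_id).tendsto 0
      rw [mul_zero] at h1
      exact h1.mono_left nhdsWithin_le_nhds
    refine ge_of_tendsto this ?_
    filter_upwards [self_mem_nhdsWithin] with ε hε using hball ε hε
  simpa using hlim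

end Liouville

theorem isCompact_phase_bound (a α β : ℂ) {K : Set ℂ} (hK : IsCompact K) (hK0 : K ⊆ puncturedPlane) :
    ∃ c : ℝ, 0 ≤ c ∧ ∀ z ∈ K, ∀ p : ℂ × ℂ × ℂ, ‖phase a α β p z‖ ≤ c * ‖p‖ := by
  have hinv : ContinuousOn (fun z : ℂ => z⁻¹) K := fun z hz =>
    (continuousAt_inv₀ (hK0 hz)).continuousWithinAt
  obtain ⟨c₁, h₁⟩ := hK.exists_bound_of_continuousOn (continuousOn_id (s := K))
  obtain ⟨c₂, h₂⟩ := hK.exists_bound_of_continuousOn (continuousOn_const.mul hinv :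
    ContinuousOn (fun z : ℂ => a * z⁻¹) K)
  obtain ⟨c₃, h₃⟩ := hK.exists_bound_of_continuousOn ((continuousOn_const.mul (continuousOn_id.pow 2)).add
    (continuousOn_const.mul (hinv.pow 2)) : ContinuousOn (fun z : ℂ => α * z ^ 2 + a ^ 2 * β * z⁻¹ ^ 2) K)
  refine ⟨|c₁| + |c₂| + |c₃|, by positivity, fun z hz p => ?_⟩
  have e1 : ‖p.1‖ ≤ ‖p‖ := norm_fst_le p
  have e2 : ‖p.2.1‖ ≤ ‖p‖ := (norm_fst_le p.2).trans (norm_snd_le p)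
  have e3 : ‖p.2.2‖ ≤ ‖p‖ := (norm_snd_le p.2).trans (norm_snd_le p)
  have f1 : ‖z‖ ≤ |c₁| := (h₁ z hz).trans (le_abs_self _)
  have f2 : ‖a * z⁻¹‖ ≤ |c₂| := (h₂ z hz).trans (le_abs_self _)
  have f3 : ‖α * z ^ 2 + a ^ 2 * β * z⁻¹ ^ 2‖ ≤ |c₃| := (h₃ z hz).trans (le_abs_self _)
  rw [phase]
  refine norm_add₃_le.trans ?_
  rw [norm_mul, norm_mul _ p.2.1, norm_mul _ p.2.2]
  have g1 := mul_le_mul f1 e1 (norm_nonneg _) (abs_nonneg _)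
  have g2 := mul_le_mul f2 e2 (norm_nonneg _) (abs_nonneg _)
  have g3 := mul_le_mul f3 e3 (norm_nonneg _) (abs_nonneg _)
  linarith

/-! ### Multiplication by holomorphic functions as bounded operators on X -/

section MulOperators

variable {U : Opens ℂ} {X : Type*} [NormedAddCommGroup X] [NormedSpace ℂ X]

theorem mulTest_apply {g : ℂ → ℂ} (hg : ContDiffOn ℝ ∞ g U) (ψ : 𝓓(U, ℂ)) (z : ℂ) :
    mulTest g hg ψ z = g z * ψ z := rfl

/-- The derivatives of `g` that the order of `T` on the support of ψ brings in are absorbed by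
Cauchy estimates. Uniform convergence of multipliers on one compact set then gives convergence of
the pairings. -/
theorem Distr.exists_norm_mulTest_le (hU : U ≤ puncturedPlane) (T : Distr U) (ψ : 𝓓(U, ℂ)) :
    ∃ (K : Set ℂ) (C : ℝ), IsCompact K ∧ K ⊆ puncturedPlane ∧ 0 ≤ C ∧
      ∀ (g : ℂ → ℂ) (hg : DifferentiableOn ℂ g {0}ᶜ) (M : ℝ), 0 ≤ M → (∀ z ∈ K, ‖g z‖ ≤ M) →
        ‖T (mulTest g (contDiffOn_of_punctured hU hg) ψ)‖ ≤ C * M := by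
  have hK : IsCompact (tsupport ψ) := ψ.hasCompactSupport
  have hKU : tsupport ψ ⊆ (puncturedPlane : Set ℂ) := ψ.tsupport_subset.trans hU
  obtain ⟨N, C₁, hC₁, h₁⟩ := exists_bound_of_distr T hK ψ.tsupport_subset
  obtain ⟨C₂, hC₂, h₂⟩ := exists_norm_iteratedFDeriv_mul_le puncturedPlane.isOpen hK hKU
    (ψ.contDiff.contDiffOn : ContDiffOn ℝ ∞ ψ _) N
  obtain ⟨K', hK', hK'0, h₃⟩ := exists_compact_norm_iteratedFDeriv_le hK puncturedPlane.isOpen hKU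
  obtain ⟨C₃, hC₃, h₃⟩ := h₃ N
  refine ⟨K', C₁ * (C₂ * C₃), hK', hK'0, by positivity, fun g hg M hM hb => ?_⟩
  have h4 := h₂ g (C₃ * M) (by positivity) (contDiffOn_of_punctured le_rfl hg)
    (h₃ g M hM (hg.mono hK'0) hb)
  have h5 := h₁ (mulTest g (contDiffOn_of_punctured hU hg) ψ) (C₂ * (C₃ * M)) (by positivity)
    (tsupport_mul_subset_right (f := g)) (fun z hz j hj => by
      have := h4 z hz j hj
      simp only [mul_comm (ψ _)] at this
      exact this)
  refine h5.trans_eq (by ring)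

variable (S : FunctionSpace U X)

theorem FunctionSpace.ext {x y : X} (h : ∀ ψ, S.toDistr x ψ = S.toDistr y ψ) : x = y :=
  S.injective (ContinuousLinearMap.ext h)

theorem FunctionSpace.toDistr_mul (g : ℂ → ℂ) (hg : DifferentiableOn ℂ g {0}ᶜ) (x : X)
    (ψ : 𝓓(U, ℂ)) : S.toDistr (S.mul g hg x) ψ =
      S.toDistr x (mulTest g (contDiffOn_of_punctured S.le_punctured hg) ψ) :=
  (S.mul_mem g hg x).choose_spec ψ

/-- Evaluation at a test function, as a continuous functional on `X`. -/
noncomputable def FunctionSpace.evalCLM (ψ : 𝓓(U, ℂ)) : X →L[ℂ] ℂ where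
  toFun x := S.toDistr x ψ
  map_add' x y := by rw [map_add]; rfl
  map_smul' c x := by rw [map_smul]; rfl
  cont := S.continuous_apply ψ

theorem FunctionSpace.evalCLM_apply (ψ : 𝓓(U, ℂ)) (x : X) : S.evalCLM ψ x = S.toDistr x ψ := rfl

variable [CompleteSpace X]

/-- Multiplication by a function holomorphic on the punctured plane is a bounded operator. -/
noncomputable def FunctionSpace.mulCLM (g : ℂ → ℂ) (hg : DifferentiableOn ℂ g {0}ᶜ) : X →L[ℂ] X where
  toFun := S.mul g hg
  map_add' x y := S.ext fun ψ => by
    simp only [S.toDistr_mul, map_add, add_apply]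
  map_smul' c x := S.ext fun ψ => by
    simp only [S.toDistr_mul, map_smul, smul_apply, RingHom.id_apply]
  cont := by
    -- The graph is closed because limits in `X` are identified by testing: pairings with ψ and with
    -- g·ψ are both continuous, and the embedding into distributions is injective.
    refine LinearMap.continuous_of_seq_closed_graph (𝕜 := ℂ) (E := X) (F := X)
      { toFun := S.mul g hg
        map_add' := fun x y => S.ext fun ψ => by simp only [S.toDistr_mul, map_add, add_apply]
        map_smul' := fun c x => S.ext fun ψ => by
          simp only [S.toDistr_mul, map_smul, smul_apply, RingHom.id_apply] } ?_
    intro u x y hu hy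
    refine S.ext fun ψ => ?_
    refine tendsto_nhds_unique (((S.continuous_apply ψ).tendsto y).comp hy) ?_
    have h := ((S.continuous_apply (mulTest g (contDiffOn_of_punctured S.le_punctured hg) ψ)).tendsto
      x).comp hu
    rw [← S.toDistr_mul g hg] at h
    refine h.congr fun n => ?_
    simp [S.toDistr_mul]

theorem FunctionSpace.toDistr_mulCLM (g : ℂ → ℂ) (hg : DifferentiableOn ℂ g {0}ᶜ) (x : X)
    (ψ : 𝓓(U, ℂ)) : S.toDistr (S.mulCLM g hg x) ψ =
      S.toDistr x (mulTest g (contDiffOn_of_punctured S.le_punctured hg) ψ) :=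
  S.toDistr_mul g hg x ψ

theorem FunctionSpace.eq_mulCLM {A : X →L[ℂ] X} {g : ℂ → ℂ} (hg : DifferentiableOn ℂ g {0}ᶜ)
    (h : ∀ x ψ, S.toDistr (A x) ψ =
      S.toDistr x (mulTest g (contDiffOn_of_punctured S.le_punctured hg) ψ)) : A = S.mulCLM g hg :=
  ContinuousLinearMap.ext fun x => S.ext fun ψ => by rw [h, S.toDistr_mulCLM]

theorem FunctionSpace.mulCLM_mul {f g : ℂ → ℂ} (hf : DifferentiableOn ℂ f {0}ᶜ)
    (hg : DifferentiableOn ℂ g {0}ᶜ) :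
    S.mulCLM f hf * S.mulCLM g hg = S.mulCLM (fun z => f z * g z) (hf.mul hg) := by
  refine S.eq_mulCLM _ fun x ψ => ?_
  rw [mul_apply_eq_comp, S.toDistr_mulCLM, S.toDistr_mulCLM]
  congr 1
  ext z
  simp only [mulTest_apply]
  ring

theorem FunctionSpace.mulCLM_add {f g : ℂ → ℂ} (hf : DifferentiableOn ℂ f {0}ᶜ)
    (hg : DifferentiableOn ℂ g {0}ᶜ) :
    S.mulCLM f hf + S.mulCLM g hg = S.mulCLM (fun z => f z + g z) (hf.add hg) := by
  refine S.eq_mulCLM _ fun x ψ => ?_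
  rw [add_apply, map_add, add_apply, S.toDistr_mulCLM, S.toDistr_mulCLM, ← map_add]
  congr 1
  ext z
  simp only [mulTest_apply, add_apply]
  ring

theorem FunctionSpace.mulCLM_smul {f : ℂ → ℂ} (c : ℂ) (hf : DifferentiableOn ℂ f {0}ᶜ) :
    c • S.mulCLM f hf = S.mulCLM (fun z => c * f z) (hf.const_mul c) := by
  refine S.eq_mulCLM _ fun x ψ => ?_
  rw [smul_apply, map_smul, smul_apply, S.toDistr_mulCLM, ← map_smul]
  congr 1
  ext z
  simp only [mulTest_apply, smul_apply, smul_eq_mul]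
  ring

theorem FunctionSpace.mulCLM_one :
    S.mulCLM (fun _ => 1) (differentiableOn_const 1) = 1 := by
  refine (S.eq_mulCLM _ fun x ψ => ?_).symm
  rw [one_apply_eq_self]
  congr 1
  ext z
  simp only [mulTest_apply, one_mul]

theorem FunctionSpace.mulCLM_congr {f g : ℂ → ℂ} (hf : DifferentiableOn ℂ f {0}ᶜ)
    (hg : DifferentiableOn ℂ g {0}ᶜ) (h : ∀ z ≠ 0, f z = g z) : S.mulCLM f hf = S.mulCLM g hg := by
  refine S.eq_mulCLM _ fun x ψ => ?_
  rw [S.toDistr_mulCLM]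
  congr 1
  ext z
  simp only [mulTest_apply]
  by_cases hz : z ∈ tsupport ψ
  · rw [h z (S.le_punctured (ψ.tsupport_subset hz))]
  · simp [image_eq_zero_of_notMem_tsupport hz]

theorem FunctionSpace.mulCLM_pow {f : ℂ → ℂ} (hf : DifferentiableOn ℂ f {0}ᶜ) (n : ℕ) :
    S.mulCLM f hf ^ n = S.mulCLM (fun z => f z ^ n) (hf.pow n) := by
  induction n with
  | zero =>
    rw [pow_zero, ← S.mulCLM_one]
    exact S.mulCLM_congr _ _ fun z _ => (pow_zero _).symm
  | succ n ih =>
    rw [pow_succ, ih, S.mulCLM_mul]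
    exact S.mulCLM_congr _ _ fun z _ => (pow_succ _ _).symm

/-- The operator series converges in norm. Applied to `x` and tested on ψ, its partial sums are
pairings with the Taylor polynomials of exp(f), which converge uniformly on the relevant compact
set. This makes multiplication by e^φ analytic in the parameters, although `X` has no explicit norm.
-/
theorem FunctionSpace.exp_mulCLM {f : ℂ → ℂ} (hf : DifferentiableOn ℂ f {0}ᶜ) :
    NormedSpace.exp (S.mulCLM f hf) = S.mulCLM (fun z => Complex.exp (f z)) hf.cexp := by
  refine S.eq_mulCLM _ fun x ψ => ?_
  have h1 : HasSum (fun n : ℕ => ((n.factorial : ℂ)⁻¹ • S.mulCLM f hf ^ n))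
      (NormedSpace.exp (S.mulCLM f hf)) := NormedSpace.exp_series_hasSum_exp' (𝕂 := ℂ) _
  have h2 := ((h1.mapL (ContinuousLinearMap.apply ℂ X x)).mapL (S.evalCLM ψ)).tendsto_sum_nat
  refine tendsto_nhds_unique h2 ?_
  obtain ⟨K, C, hK, hK0, hC, hb⟩ := Distr.exists_norm_mulTest_le S.le_punctured (S.toDistr x) ψ
  obtain ⟨c, hc⟩ := hK.exists_bound_of_continuousOn (hf.continuousOn.mono hK0)
  have hd : ∀ N : ℕ, DifferentiableOn ℂ
      (fun z => Complex.exp (f z) - ∑ n ∈ Finset.range N, f z ^ n / n.factorial) {0}ᶜ := fun N =>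
    hf.cexp.sub (DifferentiableOn.fun_sum fun n _ => (hf.pow n).div_const _)
  have key : ∀ N : ℕ, ∑ n ∈ Finset.range N, S.evalCLM ψ (ContinuousLinearMap.apply ℂ X x
      ((n.factorial : ℂ)⁻¹ • S.mulCLM f hf ^ n)) =
      S.toDistr x (mulTest (fun z => Complex.exp (f z))
        (contDiffOn_of_punctured S.le_punctured hf.cexp) ψ) -
      S.toDistr x (mulTest _ (contDiffOn_of_punctured S.le_punctured (hd N)) ψ) := by
    intro N
    have : ∀ n : ℕ, S.evalCLM ψ (ContinuousLinearMap.apply ℂ X x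
      ((n.factorial : ℂ)⁻¹ • S.mulCLM f hf ^ n)) = S.toDistr x ((n.factorial : ℂ)⁻¹ • mulTest _
        (contDiffOn_of_punctured S.le_punctured (hf.pow n)) ψ) := by
      intro n
      rw [ContinuousLinearMap.apply_apply, smul_apply, map_smul, S.mulCLM_pow, S.evalCLM_apply,
        S.toDistr_mulCLM, map_smul]
      rfl
    simp only [this]
    rw [← map_sum, ← map_sub]
    congr 1
    ext z
    have hs : ∀ (s : Finset ℕ) (F : ℕ → 𝓓(U, ℂ)), (∑ n ∈ s, F n) z = ∑ n ∈ s, F n z := by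
      intro s F
      induction s using Finset.cons_induction with
      | empty => rfl
      | cons n s hn ih => rw [Finset.sum_cons, Finset.sum_cons, add_apply, ih]
    rw [hs]
    simp only [sub_apply, smul_apply, mulTest_apply, smul_eq_mul]
    rw [sub_mul, sub_sub_cancel, Finset.sum_mul]
    refine Finset.sum_congr rfl fun n _ => ?_
    simp only [Pi.pow_apply]
    ring
  have hlim : Tendsto (fun N : ℕ => S.toDistr x (mulTest _ (contDiffOn_of_punctured S.le_punctured
      (hd N)) ψ)) atTop (𝓝 0) := by
    have h3 : Tendsto (fun N : ℕ => C * (|c| ^ N / N.factorial * 2)) atTop (𝓝 0) := by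
      simpa using ((FloorSemiring.tendsto_pow_div_factorial_atTop |c|).mul_const 2).const_mul C
    refine squeeze_zero_norm' ?_ h3
    -- `Complex.exp_bound'` requires |f z| to be at most half of N + 1.
    have h4 : ∀ᶠ N : ℕ in atTop, |c| * 2 ≤ (N : ℝ) :=
      tendsto_natCast_atTop_atTop.eventually_ge_atTop _
    filter_upwards [h4] with N hN
    refine hb _ (hd N) _ (by positivity) fun z hz => ?_
    have h5 : ‖f z‖ ≤ |c| := (hc z hz).trans (le_abs_self c)
    refine (Complex.exp_bound' ?_).trans ?_
    · rw [div_le_iff₀ (by positivity)]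
      push_cast
      linarith
    · gcongr
  simp only [key]
  simpa using tendsto_const_nhds.sub hlim

end MulOperators

/-! ### Linear maps on ℂ³ in coordinates -/

section CoordForm

variable {E : Type*} [NormedAddCommGroup E] [NormedSpace ℂ E]

/-- The linear map on `ℂ³` with the given values on the standard basis. -/
noncomputable def coordForm (x y z : E) : ℂ × ℂ × ℂ →L[ℂ] E :=
  (ContinuousLinearMap.fst ℂ ℂ (ℂ × ℂ)).smulRight x +
    (((ContinuousLinearMap.fst ℂ ℂ ℂ).comp (ContinuousLinearMap.snd ℂ ℂ (ℂ × ℂ))).smulRight y +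
    ((ContinuousLinearMap.snd ℂ ℂ ℂ).comp (ContinuousLinearMap.snd ℂ ℂ (ℂ × ℂ))).smulRight z)

theorem coordForm_apply (x y z : E) (h : ℂ × ℂ × ℂ) :
    coordForm x y z h = h.1 • x + (h.2.1 • y + h.2.2 • z) := rfl

theorem ContDiff.coordForm {F : Type*} [NormedAddCommGroup F] [NormedSpace ℂ F] {n : WithTop ℕ∞}
    {x y z : F → E} (hx : ContDiff ℂ n x) (hy : ContDiff ℂ n y) (hz : ContDiff ℂ n z) :
    ContDiff ℂ n fun p => coordForm (x p) (y p) (z p) :=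
  (contDiff_const.smulRight hx).add ((contDiff_const.smulRight hy).add
    (contDiff_const.smulRight hz))

theorem hasFDerivAt_of_sq_bound {F : Type*} [NormedAddCommGroup F] [NormedSpace ℂ F] {f : F → E}
    {f' : F →L[ℂ] E} {p : F} {C δ : ℝ} (hδ : 0 < δ)
    (h : ∀ v, ‖v‖ ≤ δ → ‖f (p + v) - f p - f' v‖ ≤ C * ‖v‖ ^ 2) : HasFDerivAt f f' p := by
  rw [hasFDerivAt_iff_isLittleO_nhds_zero]
  have h1 : (fun v => f (p + v) - f p - f' v) =O[𝓝 0] fun v => ‖v‖ ^ 2 := by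
    refine Asymptotics.IsBigO.of_bound C ?_
    filter_upwards [Metric.closedBall_mem_nhds (0 : F) hδ] with v hv
    rw [Real.norm_of_nonneg (by positivity)]
    exact h v (by simpa using hv)
  exact h1.trans_isLittleO (Asymptotics.isLittleO_norm_pow_id one_lt_two)

end CoordForm

/-! ### Moment functionals and their dependence on the parameters -/

section Functionals

variable {U : Opens ℂ} {X : Type*} [NormedAddCommGroup X] [NormedSpace ℂ X]
  {S : FunctionSpace U X} {R : CompactDistribution (kernelDomain U)}

/-- A function holomorphic on the punctured plane, as a smooth function. -/
def holoFn (g : ℂ → ℂ) (hg : DifferentiableOn ℂ g {0}ᶜ) : SmoothFn puncturedPlane :=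
  ⟨g, contDiffOn_of_punctured le_rfl hg⟩

theorem holoFn_apply (g : ℂ → ℂ) (hg : DifferentiableOn ℂ g {0}ᶜ) (z : ℂ) :
    (holoFn g hg : ℂ → ℂ) z = g z := rfl

theorem Pairing.exists_norm_le_of_differentiableOn (B : Pairing S R) : ∃ (K : Set ℂ) (C : ℝ),
    IsCompact K ∧ K ⊆ puncturedPlane ∧ 0 ≤ C ∧ ∀ (x : X) (f : SmoothFn puncturedPlane) (M : ℝ),
      0 ≤ M → DifferentiableOn ℂ (f : ℂ → ℂ) K → (∀ z ∈ K, ‖(f : ℂ → ℂ) z‖ ≤ M) →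
      ‖B.toFun x f‖ ≤ C * ‖x‖ * M := by
  obtain ⟨K, hK, hK0, N, C, hb⟩ := B.bound
  obtain ⟨K', hK', hK'0, h⟩ := exists_compact_norm_iteratedFDeriv_le hK puncturedPlane.isOpen hK0
  obtain ⟨C', hC', h⟩ := h N
  refine ⟨K', |C| * C', hK', hK'0, by positivity, fun x f M hM hf hfM => ?_⟩
  refine (hb x f (C' * M) (by positivity) (h f M hM hf hfM)).trans ?_
  calc C * ‖x‖ * (C' * M) ≤ |C| * ‖x‖ * (C' * M) := by
        gcongr
        exact le_abs_self C
    _ = |C| * C' * ‖x‖ * M := by ring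

/-- The bound sees a function only near a compact subset of ℂ∖{0}, so the conventional values at 0
of inverses and negative powers are harmless. -/
theorem Pairing.toFun_congr (B : Pairing S R) (x : X) {f g : SmoothFn puncturedPlane}
    (h : ∀ z ≠ 0, (f : ℂ → ℂ) z = (g : ℂ → ℂ) z) : B.toFun x f = B.toFun x g := by
  obtain ⟨K, hK, hK0, N, C, hb⟩ := B.bound
  rw [← sub_eq_zero, ← map_sub, ← norm_le_zero_iff]
  refine (hb x (f - g) 0 le_rfl fun z hz j _ => ?_).trans_eq (mul_zero _)
  have h0 : ((f - g : SmoothFn puncturedPlane) : ℂ → ℂ) =ᶠ[𝓝 z] fun _ => 0 := by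
    filter_upwards [puncturedPlane.isOpen.mem_nhds (hK0 hz)] with w hw
    simp [h w hw]
  rw [(h0.iteratedFDeriv ℝ j).eq_of_nhds]
  simp [iteratedFDeriv_fun_zero]

/-- The functional `x ↦ ∬∬ R(ζ, w) x(w) g(ζ) dA(w) dA(ζ)`, for `g` holomorphic on the punctured
plane. -/
noncomputable def Pairing.functional (B : Pairing S R) (g : ℂ → ℂ)
    (hg : DifferentiableOn ℂ g {0}ᶜ) : X →L[ℂ] ℂ :=
  LinearMap.mkContinuousOfExistsBound
    { toFun := fun x => B.toFun x (holoFn g hg)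
      map_add' := fun x y => by rw [map_add]; rfl
      map_smul' := fun c x => by rw [map_smul]; rfl } (by
    obtain ⟨K, C, hK, hK0, hC, hb⟩ := B.exists_norm_le_of_differentiableOn
    obtain ⟨c, hc⟩ := hK.exists_bound_of_continuousOn (hg.continuousOn.mono hK0)
    refine ⟨C * |c|, fun x => ?_⟩
    refine (hb x (holoFn g hg) |c| (abs_nonneg c) (hg.mono hK0)
      fun z hz => (hc z hz).trans (le_abs_self c)).trans_eq (by ring))

theorem Pairing.functional_apply (B : Pairing S R) (g : ℂ → ℂ) (hg : DifferentiableOn ℂ g {0}ᶜ)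
    (x : X) : B.functional g hg x = B.toFun x (holoFn g hg) := rfl

theorem differentiableOn_zpow_punctured (n : ℤ) : DifferentiableOn ℂ (fun z : ℂ => z ^ n) {0}ᶜ :=
  fun _ hz => (differentiableAt_zpow.2 (Or.inl hz)).differentiableWithinAt

variable (a α β : ℂ)

theorem differentiableOn_moment (n : ℤ) (p : ℂ × ℂ × ℂ) :
    DifferentiableOn ℂ (fun z => z ^ n * Complex.exp (-phase a α β p z)) {0}ᶜ :=
  (differentiableOn_zpow_punctured n).mul (differentiableOn_phase a α β p).neg.cexp

/-- The functional `x ↦ (1/π) ∬∬ ζⁿ exp(-φ(ζ)) R(ζ, w) x(w) dA(w) dA(ζ)`. -/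
noncomputable def Pairing.moment (B : Pairing S R) (n : ℤ) (p : ℂ × ℂ × ℂ) : X →L[ℂ] ℂ :=
  (1 / (Real.pi : ℂ)) • B.functional _ (differentiableOn_moment a α β n p)

theorem phase_add (p q : ℂ × ℂ × ℂ) (z : ℂ) :
    phase a α β (p + q) z = phase a α β p z + phase a α β q z := by
  simp only [phase, Prod.fst_add, Prod.snd_add]; ring

theorem phase_zero (z : ℂ) : phase a α β 0 z = 0 := by
  simp [phase]

/-- Differentiating e^{-φ} brings down minus a Laurent polynomial in ζ, which only shifts the index
of the moment. The remainder e^{-φ_h} - 1 + φ_h is holomorphic in ζ and O(‖h‖²) on the compact set,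
so the sup bound makes the derivative hold in the norm of functionals. -/
theorem Pairing.hasFDerivAt_moment (B : Pairing S R) (n : ℤ) (p : ℂ × ℂ × ℂ) :
    HasFDerivAt (B.moment a α β n)
      (coordForm (-B.moment a α β (n + 1) p) (-(a • B.moment a α β (n - 1) p))
        (-(α • B.moment a α β (n + 2) p + (a ^ 2 * β) • B.moment a α β (n - 2) p))) p := by
  obtain ⟨K, C, hK, hK0, hC, hb⟩ := B.exists_norm_le_of_differentiableOn
  obtain ⟨c, hc0, hc⟩ := isCompact_phase_bound a α β hK hK0
  obtain ⟨c', hc'⟩ := hK.exists_bound_of_continuousOn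
    ((differentiableOn_moment a α β n p).continuousOn.mono hK0)
  have hn : ∀ z ∈ K, ‖z ^ n * Complex.exp (-phase a α β p z)‖ ≤ |c'| := fun z hz =>
    (hc' z hz).trans (le_abs_self _)
  -- This radius gives |φ_h| ≤ c‖h‖ ≤ 1 on `K`, as the quadratic bound for exp requires.
  refine hasFDerivAt_of_sq_bound (C := ‖1 / (Real.pi : ℂ)‖ * (C * (|c'| * c ^ 2)))
    (δ := 1 / (c + 1)) (by positivity) fun h hh => ?_
  have hg : DifferentiableOn ℂ (fun z => z ^ n * Complex.exp (-phase a α β p z) *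
      (Complex.exp (-phase a α β h z) - 1 - -phase a α β h z)) {0}ᶜ :=
    (differentiableOn_moment a α β n p).mul
      (((differentiableOn_phase a α β h).neg.cexp.sub_const _).sub (differentiableOn_phase a α β h).neg)
  have key : B.moment a α β n (p + h) - B.moment a α β n p -
      coordForm (-B.moment a α β (n + 1) p) (-(a • B.moment a α β (n - 1) p))
        (-(α • B.moment a α β (n + 2) p + (a ^ 2 * β) • B.moment a α β (n - 2) p)) h =
      (1 / (Real.pi : ℂ)) • B.functional _ hg := by
    ext x
    simp only [coordForm_apply, Pairing.moment, sub_apply, add_apply, smul_apply, neg_apply,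
      Pairing.functional_apply, smul_eq_mul]
    have e : B.toFun x (holoFn _ hg) = B.toFun x
        (holoFn _ (differentiableOn_moment a α β n (p + h)) - holoFn _ (differentiableOn_moment a α β n p)
        + (h.1 • holoFn _ (differentiableOn_moment a α β (n + 1) p) +
        ((h.2.1 * a) • holoFn _ (differentiableOn_moment a α β (n - 1) p) +
        ((h.2.2 * α) • holoFn _ (differentiableOn_moment a α β (n + 2) p) +
        (h.2.2 * (a ^ 2 * β)) • holoFn _ (differentiableOn_moment a α β (n - 2) p))))) := by
      refine B.toFun_congr x fun z hz => ?_
      simp only [Submodule.coe_add, Submodule.coe_sub, Submodule.coe_smul, Pi.add_apply,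
        Pi.sub_apply, Pi.smul_apply, smul_eq_mul, holoFn_apply, phase_add, neg_add, Complex.exp_add]
      rw [zpow_add₀ hz, zpow_sub₀ hz, zpow_add₀ hz, zpow_sub₀ hz]
      simp only [phase, zpow_ofNat]
      field_simp
      ring
    rw [e]
    simp only [map_add, map_sub, map_smul, smul_eq_mul]
    ring
  rw [key, norm_smul, mul_assoc]
  refine mul_le_mul_of_nonneg_left ?_ (norm_nonneg _)
  refine ContinuousLinearMap.opNorm_le_bound _ (by positivity) fun x => ?_
  refine (hb x (holoFn _ hg) (|c'| * (c * ‖h‖) ^ 2) (by positivity) (hg.mono hK0)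
    fun z hz => ?_).trans_eq (by ring)
  rw [holoFn_apply, norm_mul]
  refine mul_le_mul (hn z hz) ?_ (norm_nonneg _) (abs_nonneg _)
  have h1 : ‖-phase a α β h z‖ ≤ c * ‖h‖ := by rw [norm_neg]; exact hc z hz h
  have h2 : c * ‖h‖ ≤ 1 := by
    refine (mul_le_mul_of_nonneg_left hh hc0).trans ?_
    rw [mul_one_div, div_le_one (by positivity)]
    linarith
  exact (Complex.norm_exp_sub_one_sub_id_le (h1.trans h2)).trans (by gcongr)

/-- The family of moments is closed under differentiation, so regularity bootstraps for all indices
at once. -/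
theorem Pairing.contDiff_moment (B : Pairing S R) (n : ℤ) : ContDiff ℂ ∞ (B.moment a α β n) := by
  rw [contDiff_infty]
  intro k
  induction k generalizing n with
  | zero =>
    exact contDiff_zero.2 (continuous_iff_continuousAt.2 fun p =>
      (B.hasFDerivAt_moment a α β n p).continuousAt)
  | succ k ih =>
    refine contDiff_succ_iff_fderiv.2 ⟨fun p => (B.hasFDerivAt_moment a α β n p).differentiableAt,
      fun h => absurd h (WithTop.natCast_ne_top k), ?_⟩
    have h1 : ContDiff ℂ k fun p => -B.moment a α β (n + 1) p := (ih (n + 1)).neg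
    have h2 : ContDiff ℂ k fun p => -(a • B.moment a α β (n - 1) p) :=
      ((ih (n - 1)).const_smul a).neg
    have h3 : ContDiff ℂ k fun p => -(α • B.moment a α β (n + 2) p +
        (a ^ 2 * β) • B.moment a α β (n - 2) p) :=
      (((ih (n + 2)).const_smul α).add ((ih (n - 2)).const_smul (a ^ 2 * β))).neg
    have h4 := ContDiff.coordForm h1 h2 h3
    have h5 : fderiv ℂ (B.moment a α β n) = fun p => coordForm (-B.moment a α β (n + 1) p)
        (-(a • B.moment a α β (n - 1) p))
        (-(α • B.moment a α β (n + 2) p + (a ^ 2 * β) • B.moment a α β (n - 2) p)) :=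
      funext fun p => (B.hasFDerivAt_moment a α β n p).fderiv
    rw [h5]
    exact h4

end Functionals

/-! ### Multiplication by the wave factor, and the waves -/

section PhaseOperators

variable {U : Opens ℂ} {X : Type*} [NormedAddCommGroup X] [NormedSpace ℂ X] [CompleteSpace X]
  (S : FunctionSpace U X) (a α β : ℂ)

/-- Multiplication by `λⁿ`. -/
noncomputable def FunctionSpace.zmul (n : ℤ) : X →L[ℂ] X :=
  S.mulCLM _ (differentiableOn_zpow_punctured n)

theorem FunctionSpace.zmul_mul (m n : ℤ) : S.zmul m * S.zmul n = S.zmul (m + n) := by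
  rw [FunctionSpace.zmul, FunctionSpace.zmul, S.mulCLM_mul]
  exact S.mulCLM_congr _ _ fun z hz => (zpow_add₀ hz m n).symm

theorem FunctionSpace.zmul_zero : S.zmul 0 = 1 := by
  rw [← S.mulCLM_one]
  exact S.mulCLM_congr _ _ fun z _ => zpow_zero z

/-- Multiplication by the phase, as a linear function of `p`. -/
noncomputable def FunctionSpace.phaseOp : ℂ × ℂ × ℂ →L[ℂ] X →L[ℂ] X :=
  coordForm (S.zmul 1) (a • S.zmul (-1)) (α • S.zmul 2 + (a ^ 2 * β) • S.zmul (-2))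

theorem FunctionSpace.phaseOp_eq (p : ℂ × ℂ × ℂ) :
    S.phaseOp a α β p = S.mulCLM _ (differentiableOn_phase a α β p) := by
  simp only [FunctionSpace.phaseOp, coordForm_apply, FunctionSpace.zmul, S.mulCLM_smul, S.mulCLM_add]
  refine S.mulCLM_congr _ _ fun z hz => ?_
  simp only [phase, zpow_neg, zpow_ofNat, inv_pow]
  ring

/-- Multiplication by `exp(φ(λ; p))`. -/
noncomputable def FunctionSpace.waveOp (p : ℂ × ℂ × ℂ) : X →L[ℂ] X :=
  S.mulCLM _ (differentiableOn_phase a α β p).cexp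

theorem FunctionSpace.waveOp_eq_exp :
    S.waveOp a α β = fun p => NormedSpace.exp (S.phaseOp a α β p) := by
  funext p
  rw [S.phaseOp_eq, S.exp_mulCLM, FunctionSpace.waveOp]

theorem FunctionSpace.waveOp_add (p q : ℂ × ℂ × ℂ) :
    S.waveOp a α β (p + q) = S.waveOp a α β p * S.waveOp a α β q := by
  simp only [FunctionSpace.waveOp, S.mulCLM_mul]
  exact S.mulCLM_congr _ _ fun z _ => by rw [phase_add, Complex.exp_add]

theorem FunctionSpace.waveOp_zero : S.waveOp a α β 0 = 1 := by
  rw [← S.mulCLM_one]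
  exact S.mulCLM_congr _ _ fun z _ => by rw [phase_zero, Complex.exp_zero]

theorem FunctionSpace.waveOp_mul_neg (p : ℂ × ℂ × ℂ) :
    S.waveOp a α β p * S.waveOp a α β (-p) = 1 := by
  rw [← S.waveOp_add, add_neg_cancel, S.waveOp_zero]

theorem FunctionSpace.waveOp_neg_mul (p : ℂ × ℂ × ℂ) :
    S.waveOp a α β (-p) * S.waveOp a α β p = 1 := by
  rw [← S.waveOp_add, neg_add_cancel, S.waveOp_zero]

theorem FunctionSpace.waveOp_mul_zmul (p : ℂ × ℂ × ℂ) (n : ℤ) :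
    S.waveOp a α β p * S.zmul n = S.zmul n * S.waveOp a α β p := by
  simp only [FunctionSpace.waveOp, FunctionSpace.zmul, S.mulCLM_mul]
  exact S.mulCLM_congr _ _ fun z _ => mul_comm _ _

theorem FunctionSpace.contDiff_waveOp : ContDiff ℂ ∞ (S.waveOp a α β) := by
  rw [S.waveOp_eq_exp]
  have h : ContDiff ℂ ∞ (NormedSpace.exp : (X →L[ℂ] X) → X →L[ℂ] X) :=
    contDiff_iff_contDiffAt.2 fun T => (NormedSpace.exp_analytic (𝕂 := ℂ) T).contDiffAt
  exact h.comp (S.phaseOp a α β).contDiff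

/-- The element `λⁿ exp(φ(λ; p))` of `X`. -/
noncomputable def FunctionSpace.wave (n : ℤ) (p : ℂ × ℂ × ℂ) : X :=
  S.zmul n (S.waveOp a α β p S.one)

theorem FunctionSpace.contDiff_wave (n : ℤ) : ContDiff ℂ ∞ (S.wave a α β n) :=
  (S.zmul n).contDiff.comp ((S.contDiff_waveOp a α β).clm_apply contDiff_const)

theorem FunctionSpace.zmul_wave (m n : ℤ) (p : ℂ × ℂ × ℂ) :
    S.zmul m (S.wave a α β n p) = S.wave a α β (m + n) p := by
  rw [FunctionSpace.wave, FunctionSpace.wave, ← S.zmul_mul, mul_apply_eq_comp]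

/-- By the group law of `waveOp`, the wave at q is `waveOp (q - p)` applied to the wave at p. Only
the derivative of the operator exponential at 0 is then needed. -/
theorem FunctionSpace.hasFDerivAt_wave (n : ℤ) (p : ℂ × ℂ × ℂ) :
    HasFDerivAt (S.wave a α β n)
      (coordForm (S.wave a α β (n + 1) p) (a • S.wave a α β (n - 1) p)
        (α • S.wave a α β (n + 2) p + (a ^ 2 * β) • S.wave a α β (n - 2) p)) p := by
  have h0 : HasFDerivAt (S.waveOp a α β) (S.phaseOp a α β) 0 := by
    rw [S.waveOp_eq_exp]
    have h1 : HasFDerivAt (NormedSpace.exp : (X →L[ℂ] X) → X →L[ℂ] X) (1 : _ →L[ℂ] _)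
        (S.phaseOp a α β 0) := by
      rw [map_zero]; exact hasFDerivAt_exp_zero
    exact h1.comp 0 (S.phaseOp a α β).hasFDerivAt
  have hsub : HasFDerivAt (fun q : ℂ × ℂ × ℂ => q - p) (ContinuousLinearMap.id ℂ _) p :=
    (hasFDerivAt_id p).sub_const p
  have h2 : HasFDerivAt (fun q => S.waveOp a α β (q - p)) (S.phaseOp a α β) p := by
    have h0' : HasFDerivAt (S.waveOp a α β) (S.phaseOp a α β) (p - p) := by rwa [sub_self]
    exact HasFDerivAt.comp (g := S.waveOp a α β) (f := fun q => q - p) p h0' hsub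
  have h3 : HasFDerivAt (fun q => S.waveOp a α β (q - p) (S.wave a α β n p))
      ((S.phaseOp a α β).flip (S.wave a α β n p)) p := by
    have := h2.clm_apply (hasFDerivAt_const (S.wave a α β n p) p)
    refine this.congr_fderiv ?_
    ext <;> simp
  have h4 : S.wave a α β n = fun q => S.waveOp a α β (q - p) (S.wave a α β n p) := by
    funext q
    rw [FunctionSpace.wave, FunctionSpace.wave, ← mul_apply_eq_comp, ← mul_apply_eq_comp,
      S.waveOp_mul_zmul, ← mul_apply_eq_comp, mul_assoc, ← S.waveOp_add, sub_add_cancel]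
  rw [h4]
  refine h3.congr_fderiv ?_
  refine ContinuousLinearMap.ext fun h => ?_
  simp only [ContinuousLinearMap.flip_apply, FunctionSpace.phaseOp, coordForm_apply, add_apply,
    smul_apply, S.zmul_wave, add_comm n, sub_eq_add_neg]

end PhaseOperators

/-! ### The divided difference of the phase -/

section Slope

variable (a α β : ℂ)

/-- The divided difference of the phase. -/
noncomputable def slopePhase (h : ℂ × ℂ × ℂ) (l ζ : ℂ) : ℂ :=
  h.1 - a * h.2.1 * (l ^ (-1 : ℤ) * ζ ^ (-1 : ℤ)) +
    h.2.2 * (α * (l ^ (1 : ℤ) + ζ ^ (1 : ℤ)) -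
      a ^ 2 * β * (l ^ (-1 : ℤ) * ζ ^ (-2 : ℤ) + l ^ (-2 : ℤ) * ζ ^ (-1 : ℤ)))

/-- This factorization drives the method: the factor l - ζ cancels the Cauchy kernel, and the
quotient is a finite sum of monomials l^m ζ^n, each of which becomes a rank-one operator in the
derivative of the conjugated dressing operator. -/
theorem phase_sub_phase (h : ℂ × ℂ × ℂ) {l ζ : ℂ} (hl : l ≠ 0) (hζ : ζ ≠ 0) :
    phase a α β h l - phase a α β h ζ = (l - ζ) * slopePhase a α β h l ζ := by
  simp only [phase, slopePhase, zpow_neg, zpow_ofNat]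
  field_simp
  ring

theorem exists_norm_slopePhase_le {K L : Set ℂ} (hK : IsCompact K) (hK0 : K ⊆ puncturedPlane)
    (hL : IsCompact L) (hL0 : L ⊆ puncturedPlane) :
    ∃ c : ℝ, 0 ≤ c ∧ ∀ l ∈ L, ∀ ζ ∈ K, ∀ h, ‖slopePhase a α β h l ζ‖ ≤ c * ‖h‖ := by
  have hcl : ∀ n : ℤ, ContinuousOn (fun q : ℂ × ℂ => q.1 ^ n) (L ×ˢ K) := fun n q hq =>
    ((continuousAt_zpow₀ q.1 n (Or.inl (hL0 hq.1))).comp continuousAt_fst).continuousWithinAt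
  have hcζ : ∀ n : ℤ, ContinuousOn (fun q : ℂ × ℂ => q.2 ^ n) (L ×ˢ K) := fun n q hq =>
    ((continuousAt_zpow₀ q.2 n (Or.inl (hK0 hq.2))).comp continuousAt_snd).continuousWithinAt
  obtain ⟨c₂, h₂⟩ := (hL.prod hK).exists_bound_of_continuousOn
    (f := fun q : ℂ × ℂ => a * (q.1 ^ (-1 : ℤ) * q.2 ^ (-1 : ℤ)))
    (continuousOn_const.mul ((hcl _).mul (hcζ _)))
  obtain ⟨c₃, h₃⟩ := (hL.prod hK).exists_bound_of_continuousOn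
    (f := fun q : ℂ × ℂ => α * (q.1 ^ (1 : ℤ) + q.2 ^ (1 : ℤ)) - a ^ 2 * β *
      (q.1 ^ (-1 : ℤ) * q.2 ^ (-2 : ℤ) + q.1 ^ (-2 : ℤ) * q.2 ^ (-1 : ℤ)))
    ((continuousOn_const.mul ((hcl _).add (hcζ _))).sub
      (continuousOn_const.mul (((hcl _).mul (hcζ _)).add ((hcl _).mul (hcζ _)))))
  refine ⟨1 + |c₂| + |c₃|, by positivity, fun l hl ζ hζ p => ?_⟩
  have e1 : ‖p.1‖ ≤ ‖p‖ := norm_fst_le p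
  have e2 : ‖p.2.1‖ ≤ ‖p‖ := (norm_fst_le p.2).trans (norm_snd_le p)
  have e3 : ‖p.2.2‖ ≤ ‖p‖ := (norm_snd_le p.2).trans (norm_snd_le p)
  have g2 := mul_le_mul e2 ((h₂ (l, ζ) ⟨hl, hζ⟩).trans (le_abs_self _)) (norm_nonneg _)
    (norm_nonneg _)
  have g3 := mul_le_mul e3 ((h₃ (l, ζ) ⟨hl, hζ⟩).trans (le_abs_self _)) (norm_nonneg _)
    (norm_nonneg _)
  rw [← norm_mul] at g2 g3
  have : slopePhase a α β p l ζ = p.1 - p.2.1 * (a * (l ^ (-1 : ℤ) * ζ ^ (-1 : ℤ))) +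
      p.2.2 * (α * (l ^ (1 : ℤ) + ζ ^ (1 : ℤ)) - a ^ 2 * β *
      (l ^ (-1 : ℤ) * ζ ^ (-2 : ℤ) + l ^ (-2 : ℤ) * ζ ^ (-1 : ℤ))) := by
    rw [slopePhase]; ring
  rw [this]
  refine (norm_add_le _ _).trans ?_
  have := norm_sub_le p.1 (p.2.1 * (a * (l ^ (-1 : ℤ) * ζ ^ (-1 : ℤ))))
  simp only at g2 g3
  linarith

end Slope

/-! ### Differentiating the conjugated Cauchy kernel in the parameters -/

section DressingFamily

variable {U : Opens ℂ} {X : Type*} [NormedAddCommGroup X] [NormedSpace ℂ X] [CompleteSpace X]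
  {S : FunctionSpace U X} {R : CompactDistribution (kernelDomain U)} (a α β : ℂ)

theorem smooth_exp_phase (hU : U ≤ puncturedPlane) (p : ℂ × ℂ × ℂ) :
    ContDiffOn ℝ ∞ (fun w => Complex.exp (phase a α β p w)) U :=
  contDiffOn_of_punctured hU (differentiableOn_phase a α β p).cexp

/-- The smooth function `exp(-φ(ζ)) (1/π) ∬ exp(φ(λ)) ψ(λ) / (λ - ζ) dA(λ)`. -/
noncomputable def gaugedCauchy (hU : U ≤ puncturedPlane) (p : ℂ × ℂ × ℂ) (ψ : 𝓓(U, ℂ)) :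
    SmoothFn puncturedPlane :=
  ⟨fun l => Complex.exp (-phase a α β p l) *
      (cauchy (mulTest _ (smooth_exp_phase a α β hU p) ψ) : ℂ → ℂ) l,
    ContDiffOn.mul (contDiffOn_of_punctured le_rfl (differentiableOn_phase a α β p).neg.cexp)
      (cauchy (mulTest _ (smooth_exp_phase a α β hU p) ψ)).2⟩

/-- The factor e^{-φ} is holomorphic off 0 and cancels the e^φ inside the transform. The result does
not depend on `p`, so differences for two parameters are holomorphic off 0. -/
theorem dbar_gaugedCauchy (hU : U ≤ puncturedPlane) (p : ℂ × ℂ × ℂ) (ψ : 𝓓(U, ℂ)) {z : ℂ}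
    (hz : z ≠ 0) : dbar (gaugedCauchy a α β hU p ψ : ℂ → ℂ) z = -ψ z := by
  set f := mulTest _ (smooth_exp_phase a α β hU p) ψ with hf
  have hf1 : ContDiff ℝ 1 f := f.contDiff.of_le (by exact_mod_cast le_top)
  have hd1 : DifferentiableAt ℂ (fun l => Complex.exp (-phase a α β p l)) z :=
    (differentiableOn_phase a α β p).neg.cexp.differentiableAt
      (isOpen_compl_singleton.mem_nhds hz)
  have hd2 : DifferentiableAt ℝ (cauchyFn f) z :=
    (contDiff_cauchyFn f.contDiff f.hasCompactSupport).differentiable (by simp) z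
  have h := dbar_mul (hd1.restrictScalars ℝ) hd2
  rw [dbar_cauchyFn hf1 f.hasCompactSupport, dbar_eq_zero hd1] at h
  refine h.trans ?_
  rw [hf, mulTest_apply, mul_zero, add_zero, mul_neg, ← mul_assoc, ← Complex.exp_add,
    neg_add_cancel, Complex.exp_zero, one_mul]

theorem differentiableAt_gaugedCauchy (hU : U ≤ puncturedPlane) (p : ℂ × ℂ × ℂ) (ψ : 𝓓(U, ℂ))
    {z : ℂ} (hz : z ≠ 0) : DifferentiableAt ℝ (gaugedCauchy a α β hU p ψ : ℂ → ℂ) z :=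
  (ContDiffOn.contDiffAt (gaugedCauchy a α β hU p ψ).2
    (puncturedPlane.isOpen.mem_nhds hz)).differentiableAt (by simp)

theorem differentiableAt_gaugedCauchy_sub (hU : U ≤ puncturedPlane) (p q : ℂ × ℂ × ℂ)
    (ψ : 𝓓(U, ℂ)) {z : ℂ} (hz : z ≠ 0) : DifferentiableAt ℂ
      (fun w => (gaugedCauchy a α β hU q ψ : ℂ → ℂ) w - (gaugedCauchy a α β hU p ψ : ℂ → ℂ) w) z := by
  have h1 := differentiableAt_gaugedCauchy a α β hU p ψ hz
  have h2 := differentiableAt_gaugedCauchy a α β hU q ψ hz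
  refine differentiableAt_of_dbar_eq_zero (h2.sub h1) ?_
  have h3 := dbar_gaugedCauchy a α β hU p ψ hz
  have h4 := dbar_gaugedCauchy a α β hU q ψ hz
  rw [dbar] at h3 h4 ⊢
  rw [fderiv_fun_sub h2 h1]
  simp only [sub_apply]
  linear_combination h4 - h3

/-- The derivative of the conjugated dressing operators with respect to the parameters. -/
noncomputable def Pairing.dressDeriv (B : Pairing S R) (p : ℂ × ℂ × ℂ) :
    ℂ × ℂ × ℂ →L[ℂ] X →L[ℂ] X :=
  coordForm ((B.moment a α β 0 p).smulRight (S.wave a α β 0 p))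
    (-(a • (B.moment a α β (-1) p).smulRight (S.wave a α β (-1) p)))
    (α • ((B.moment a α β 0 p).smulRight (S.wave a α β 1 p) +
        (B.moment a α β 1 p).smulRight (S.wave a α β 0 p)) -
      (a ^ 2 * β) • ((B.moment a α β (-2) p).smulRight (S.wave a α β (-1) p) +
        (B.moment a α β (-1) p).smulRight (S.wave a α β (-2) p)))

theorem Pairing.contDiff_dressDeriv (B : Pairing S R) : ContDiff ℂ ∞ (B.dressDeriv a α β) := by
  have h : ∀ m n : ℤ, ContDiff ℂ ∞ fun p =>
      (B.moment a α β m p).smulRight (S.wave a α β n p) := fun m n =>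
    (B.contDiff_moment a α β m).smulRight (S.contDiff_wave a α β n)
  exact ContDiff.coordForm (h 0 0) ((h (-1) (-1)).const_smul a).neg
    ((((h 0 1).add (h 1 0)).const_smul α).sub
      (((h (-2) (-1)).add (h (-1) (-2))).const_smul (a ^ 2 * β)))

theorem FunctionSpace.toDistr_wave (S : FunctionSpace U X) (n : ℤ) (p : ℂ × ℂ × ℂ) (ψ : 𝓓(U, ℂ)) :
    S.toDistr (S.wave a α β n p) ψ =
      ∫ l : ℂ, l ^ n * (Complex.exp (phase a α β p l) * ψ l) := by
  rw [FunctionSpace.wave, FunctionSpace.zmul, S.toDistr_mulCLM, FunctionSpace.waveOp,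
    S.toDistr_mulCLM, S.one_apply]
  refine integral_congr_ae (ae_of_all _ fun l => ?_)
  simp only [mulTest_apply]
  ring

/-- The remainder in the first-order expansion of `gaugedCauchy` with respect to the parameters. -/
theorem exists_gaugedCauchy_remainder_le (hU : U ≤ puncturedPlane) (p : ℂ × ℂ × ℂ) (ψ : 𝓓(U, ℂ))
    {K : Set ℂ} (hK : IsCompact K) (hK0 : K ⊆ puncturedPlane) :
    ∃ C δ : ℝ, 0 < δ ∧ 0 ≤ C ∧ ∀ h : ℂ × ℂ × ℂ, ‖h‖ ≤ δ → ∀ ζ ∈ K,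
      ‖(gaugedCauchy a α β hU (p + h) ψ : ℂ → ℂ) ζ - (gaugedCauchy a α β hU p ψ : ℂ → ℂ) ζ -
        (1 / (Real.pi : ℂ)) * (Complex.exp (-phase a α β p ζ) *
          ∫ l : ℂ, slopePhase a α β h l ζ * (Complex.exp (phase a α β p l) * ψ l))‖ ≤
        C * ‖h‖ ^ 2 := by
  have hL : IsCompact (tsupport ψ) := ψ.hasCompactSupport
  have hL0 : tsupport ψ ⊆ (puncturedPlane : Set ℂ) := ψ.tsupport_subset.trans hU
  obtain ⟨c₁, hc₁, h₁⟩ := isCompact_phase_bound a α β (hK.union hL) (Set.union_subset hK0 hL0)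
  obtain ⟨c₂, hc₂, h₂⟩ := exists_norm_slopePhase_le a α β hK hK0 hL hL0
  obtain ⟨c₃, h₃⟩ := hK.exists_bound_of_continuousOn
    ((differentiableOn_phase a α β p).neg.cexp.continuousOn.mono hK0)
  obtain ⟨c₄, h₄⟩ := (hL.prod hK).exists_bound_of_continuousOn
    (f := fun q : ℂ × ℂ => q.1 - q.2) (by fun_prop)
  set f : ℂ × ℂ × ℂ → 𝓓(U, ℂ) := fun q => mulTest _ (smooth_exp_phase a α β hU q) ψ with hf
  have hfa : ∀ q l, f q l = Complex.exp (phase a α β q l) * ψ l := fun _ _ => rfl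
  have hfi : Integrable (fun l => ‖f p l‖) :=
    ((f p).continuous.integrable_of_hasCompactSupport (f p).hasCompactSupport).norm
  have hfi0 : 0 ≤ ∫ l, ‖f p l‖ := integral_nonneg fun _ => norm_nonneg _
  refine ⟨‖1 / (Real.pi : ℂ)‖ * (|c₃| * (|c₄| * c₂ ^ 2) * ∫ l, ‖f p l‖), 1 / (2 * c₁ + 1),
    by positivity, by positivity, fun h hh ζ hζ => ?_⟩
  have hζ0 : ζ ≠ 0 := hK0 hζ
  have hslope : Integrable fun l => slopePhase a α β h l ζ * f p l := by
    have hz : ∀ n : ℤ, Integrable fun l => l ^ n * f p l := fun n => by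
      let g : 𝓓(U, ℂ) := mulTest _ (contDiffOn_of_punctured hU (differentiableOn_zpow_punctured n))
        (f p)
      exact g.continuous.integrable_of_hasCompactSupport g.hasCompactSupport
    have hi := ((((hz 0).const_mul h.1).sub ((hz (-1)).const_mul (a * h.2.1 * ζ ^ (-1 : ℤ)))).add
      ((((hz 1).const_mul (h.2.2 * α)).add ((hz 0).const_mul (h.2.2 * α * ζ ^ (1 : ℤ)))).sub
        (((hz (-1)).const_mul (h.2.2 * a ^ 2 * β * ζ ^ (-2 : ℤ))).add
          ((hz (-2)).const_mul (h.2.2 * a ^ 2 * β * ζ ^ (-1 : ℤ))))))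
    refine hi.congr (ae_of_all _ fun l => ?_)
    simp only [Pi.add_apply, Pi.sub_apply, slopePhase, zpow_zero]
    ring
  have hint : ∀ q, Integrable fun l => f q l / (l - ζ) := fun q =>
    integrable_div_sub (f q).continuous (f q).hasCompactSupport ζ
  have hval : ∀ q, (gaugedCauchy a α β hU q ψ : ℂ → ℂ) ζ = Complex.exp (-phase a α β q ζ) *
      ((1 / (Real.pi : ℂ)) * ∫ l, f q l / (l - ζ)) := fun q => rfl
  have hrem : (gaugedCauchy a α β hU (p + h) ψ : ℂ → ℂ) ζ - (gaugedCauchy a α β hU p ψ : ℂ → ℂ) ζ -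
        (1 / (Real.pi : ℂ)) * (Complex.exp (-phase a α β p ζ) *
          ∫ l : ℂ, slopePhase a α β h l ζ * (Complex.exp (phase a α β p l) * ψ l)) =
      (1 / (Real.pi : ℂ)) * ∫ l, Complex.exp (-phase a α β p ζ) *
        (Complex.exp (-phase a α β h ζ) * (f (p + h) l / (l - ζ)) - f p l / (l - ζ) -
          slopePhase a α β h l ζ * f p l) := by
    have hi1 : Integrable fun l => Complex.exp (-phase a α β h ζ) * (f (p + h) l / (l - ζ)) -
        f p l / (l - ζ) := ((hint (p + h)).const_mul _).sub (hint p)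
    rw [integral_const_mul, integral_sub hi1 hslope,
      integral_sub ((hint (p + h)).const_mul _) (hint p), integral_const_mul, hval, hval, phase_add,
      neg_add, Complex.exp_add]
    simp only [hfa]
    ring
  rw [hrem, norm_mul, mul_assoc]
  refine mul_le_mul_of_nonneg_left ?_ (norm_nonneg _)
  have hmaj : Integrable fun l => |c₃| * (|c₄| * (c₂ * ‖h‖) ^ 2) * ‖f p l‖ := hfi.const_mul _
  refine (norm_integral_le_of_norm_le hmaj ?_).trans_eq ?_
  · filter_upwards [(measure_eq_zero_iff_ae_notMem (μ := (volume : Measure ℂ)) (s := {ζ})).1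
      (by simp)] with l hl
    have hlζ : l - ζ ≠ 0 := sub_ne_zero.2 hl
    by_cases hlL : l ∈ tsupport ψ
    · have hl0 : l ≠ 0 := hL0 hlL
      -- The integrand is governed by (e^z - 1 - z)/(l - ζ). As z is divisible by l - ζ, the bound
      -- |z|² both removes the singularity and is quadratic in h; the radius 1/(2c₁ + 1) ensures |z|
      -- ≤ 1.
      set z := phase a α β h l - phase a α β h ζ with hz
      have hzs : z = (l - ζ) * slopePhase a α β h l ζ := phase_sub_phase a α β h hl0 hζ0
      have hz1 : ‖z‖ ≤ 1 := by
        have e1 := h₁ l (Or.inr hlL) h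
        have e2 := h₁ ζ (Or.inl hζ) h
        have e3 := mul_le_mul_of_nonneg_left hh (by positivity : 0 ≤ 2 * c₁)
        have e4 : 2 * c₁ * (1 / (2 * c₁ + 1)) ≤ 1 := by
          rw [mul_one_div, div_le_one (by positivity)]
          linarith
        have := norm_sub_le (phase a α β h l) (phase a α β h ζ)
        rw [← hz] at this
        linarith
      have hexp : Complex.exp (-phase a α β h ζ) * (f (p + h) l / (l - ζ)) - f p l / (l - ζ) -
          slopePhase a α β h l ζ * f p l = (Complex.exp z - 1 - z) / (l - ζ) * f p l := by
        have e5 : slopePhase a α β h l ζ = z / (l - ζ) := by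
          rw [hzs, mul_div_cancel_left₀ _ hlζ]
        rw [e5, hfa, hfa, phase_add, Complex.exp_add, hz, sub_eq_add_neg (phase a α β h l),
          Complex.exp_add]
        ring
      rw [hexp, norm_mul, norm_mul, ← mul_assoc]
      refine mul_le_mul_of_nonneg_right ?_ (norm_nonneg _)
      refine mul_le_mul ((h₃ ζ hζ).trans (le_abs_self _)) ?_ (norm_nonneg _) (abs_nonneg _)
      rw [norm_div, div_le_iff₀ (norm_pos_iff.2 hlζ)]
      refine (Complex.norm_exp_sub_one_sub_id_le hz1).trans ?_
      rw [hzs, norm_mul, mul_pow]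
      have e6 : ‖slopePhase a α β h l ζ‖ ^ 2 ≤ (c₂ * ‖h‖) ^ 2 := by
        have := h₂ l hlL ζ hζ h
        gcongr
      have e7 : ‖l - ζ‖ ≤ |c₄| := (h₄ (l, ζ) ⟨hlL, hζ⟩).trans (le_abs_self _)
      calc ‖l - ζ‖ ^ 2 * ‖slopePhase a α β h l ζ‖ ^ 2
          ≤ (|c₄| * ‖l - ζ‖) * (c₂ * ‖h‖) ^ 2 := by
            refine mul_le_mul ?_ e6 (by positivity) (by positivity)
            rw [pow_two]
            gcongr
        _ = _ := by ring
    · have hψ0 : ψ l = 0 := image_eq_zero_of_notMem_tsupport hlL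
      simp [hfa, hψ0]
  · rw [integral_const_mul]
    ring

/-- Weak form of the differentiability of the conjugated operators, valid at every `p` in ℂ³. The
first-order remainder is holomorphic on ℂ∖{0}, so the pointwise estimate of
`exists_gaugedCauchy_remainder_le` suffices and no derivatives of the remainder need be bounded. -/
theorem Pairing.hasFDerivAt_gaugedCauchy (B : Pairing S R) (p : ℂ × ℂ × ℂ) (y : X) (ψ : 𝓓(U, ℂ)) :
    HasFDerivAt (fun q => B.toFun y (gaugedCauchy a α β S.le_punctured q ψ))
      ((S.evalCLM ψ).comp ((B.dressDeriv a α β p).flip y)) p := by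
  obtain ⟨K, C, hK, hK0, hC, hb⟩ := B.exists_norm_le_of_differentiableOn
  obtain ⟨C', δ, hδ, hC', hr⟩ :=
    exists_gaugedCauchy_remainder_le a α β S.le_punctured p ψ hK hK0
  refine hasFDerivAt_of_sq_bound (C := C * ‖y‖ * C') hδ fun h hh => ?_
  set m : ℤ → ℂ := fun n => S.toDistr (S.wave a α β n p) ψ with hm
  set e : ℤ → SmoothFn puncturedPlane := fun n => holoFn _ (differentiableOn_moment a α β n p) with he
  set r : SmoothFn puncturedPlane := gaugedCauchy a α β S.le_punctured (p + h) ψ -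
    gaugedCauchy a α β S.le_punctured p ψ - (1 / (Real.pi : ℂ)) • ((h.1 * m 0) • e 0 -
      (a * h.2.1 * m (-1)) • e (-1) + ((h.2.2 * α) • (m 1 • e 0 + m 0 • e 1) -
        (h.2.2 * (a ^ 2 * β)) • (m (-1) • e (-2) + m (-2) • e (-1)))) with hrdef
  have hdiff : B.toFun y (gaugedCauchy a α β S.le_punctured (p + h) ψ) -
      B.toFun y (gaugedCauchy a α β S.le_punctured p ψ) -
      (S.evalCLM ψ).comp ((B.dressDeriv a α β p).flip y) h = B.toFun y r := by
    simp only [hrdef, map_sub, map_add, map_smul, ContinuousLinearMap.comp_apply,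
      ContinuousLinearMap.flip_apply, Pairing.dressDeriv, coordForm_apply, add_apply, smul_apply,
      sub_apply, neg_apply, ContinuousLinearMap.smulRight_apply, map_neg, S.evalCLM_apply, hm, he,
      Pairing.moment, Pairing.functional_apply, smul_eq_mul]
    ring
  rw [hdiff]
  refine (hb y r (C' * ‖h‖ ^ 2) (by positivity) ?_ ?_).trans_eq (by ring)
  · intro z hz
    have hz0 : z ≠ 0 := hK0 hz
    have he' : ∀ n, DifferentiableAt ℂ (e n : ℂ → ℂ) z := fun n =>
      (differentiableOn_moment a α β n p).differentiableAt (isOpen_compl_singleton.mem_nhds hz0)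
    refine DifferentiableAt.differentiableWithinAt ?_
    exact (differentiableAt_gaugedCauchy_sub a α β S.le_punctured p (p + h) ψ hz0).sub
      (((((he' 0).const_smul (h.1 * m 0)).sub ((he' (-1)).const_smul (a * h.2.1 * m (-1)))).add
        (((((he' 0).const_smul (m 1)).add ((he' 1).const_smul (m 0))).const_smul (h.2.2 * α)).sub
        ((((he' (-2)).const_smul (m (-1))).add ((he' (-1)).const_smul (m (-2)))).const_smul
          (h.2.2 * (a ^ 2 * β))))).const_smul (1 / (Real.pi : ℂ)))
  · intro ζ hζ
    refine le_of_eq_of_le ?_ (hr h hh ζ hζ)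
    congr 1
    simp only [hrdef, Submodule.coe_sub, Submodule.coe_add, Submodule.coe_smul, Pi.sub_apply,
      Pi.add_apply, Pi.smul_apply, smul_eq_mul, he, holoFn_apply]
    congr 2
    have hz : ∀ n : ℤ, Integrable fun l => l ^ n * (Complex.exp (phase a α β p l) * ψ l) := fun n => by
      let g : 𝓓(U, ℂ) := mulTest _ (contDiffOn_of_punctured S.le_punctured
        (differentiableOn_zpow_punctured n)) (mulTest _ (smooth_exp_phase a α β S.le_punctured p) ψ)
      exact g.continuous.integrable_of_hasCompactSupport g.hasCompactSupport
    have hi : ∫ l : ℂ, slopePhase a α β h l ζ * (Complex.exp (phase a α β p l) * ψ l) =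
        h.1 * m 0 - a * h.2.1 * ζ ^ (-1 : ℤ) * m (-1) + ((h.2.2 * α * m 1 +
          h.2.2 * α * ζ ^ (1 : ℤ) * m 0) - (h.2.2 * a ^ 2 * β * ζ ^ (-2 : ℤ) * m (-1) +
          h.2.2 * a ^ 2 * β * ζ ^ (-1 : ℤ) * m (-2))) := by
      simp only [hm, S.toDistr_wave]
      set E : ℤ → ℂ → ℂ := fun n l => l ^ n * (Complex.exp (phase a α β p l) * ψ l) with hE
      have h2 : ∀ (m n : ℤ) (c d : ℂ), Integrable fun l => c * E m l + d * E n l :=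
        fun m n c d => ((hz m).const_mul c).add ((hz n).const_mul d)
      have h3 : ∀ (m n : ℤ) (c d : ℂ), ∫ l, (c * E m l + d * E n l) =
          c * (∫ l, E m l) + d * ∫ l, E n l := fun m n c d => by
        rw [integral_add ((hz m).const_mul c) ((hz n).const_mul d), integral_const_mul,
          integral_const_mul]
      have h4 : (fun l => slopePhase a α β h l ζ * (Complex.exp (phase a α β p l) * ψ l)) =
          fun l => (h.1 * E 0 l + -(a * h.2.1 * ζ ^ (-1 : ℤ)) * E (-1) l) +
            ((h.2.2 * α * E 1 l + h.2.2 * α * ζ ^ (1 : ℤ) * E 0 l) +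
            (-(h.2.2 * a ^ 2 * β * ζ ^ (-2 : ℤ)) * E (-1) l +
              -(h.2.2 * a ^ 2 * β * ζ ^ (-1 : ℤ)) * E (-2) l)) := by
        funext l
        simp only [slopePhase, hE, zpow_zero]
        ring
      have h5 : Integrable fun l => (h.2.2 * α * E 1 l + h.2.2 * α * ζ ^ (1 : ℤ) * E 0 l) +
            (-(h.2.2 * a ^ 2 * β * ζ ^ (-2 : ℤ)) * E (-1) l +
              -(h.2.2 * a ^ 2 * β * ζ ^ (-1 : ℤ)) * E (-2) l) := (h2 _ _ _ _).add (h2 _ _ _ _)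
      rw [h4, integral_add (h2 _ _ _ _) h5, integral_add (h2 _ _ _ _) (h2 _ _ _ _), h3, h3, h3]
      ring
    rw [hi]
    simp only [zpow_zero]
    ring

end DressingFamily

/-! ### Partial derivatives on ℂ³ -/

section PartialDerivatives

variable {E : Type*} [NormedAddCommGroup E] [NormedSpace ℂ E]

/-- The derivative in the direction `v`. -/
noncomputable def pd (v : ℂ × ℂ × ℂ) (f : ℂ × ℂ × ℂ → E) (p : ℂ × ℂ × ℂ) : E := fderiv ℂ f p v

variable {V : Set (ℂ × ℂ × ℂ)} {f g : ℂ × ℂ × ℂ → E} {p : ℂ × ℂ × ℂ}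

theorem ContDiffOn.pd (hV : IsOpen V) (hf : ContDiffOn ℂ ∞ f V) (v : ℂ × ℂ × ℂ) :
    ContDiffOn ℂ ∞ (pd v f) V :=
  ((contDiffOn_infty_iff_fderiv_of_isOpen hV).1 hf).2.clm_apply contDiffOn_const

theorem pd_congr (hV : IsOpen V) (h : Set.EqOn f g V) (hp : p ∈ V) (v : ℂ × ℂ × ℂ) :
    pd v f p = pd v g p := by
  have : f =ᶠ[𝓝 p] g := by
    filter_upwards [hV.mem_nhds hp] with q hq using h hq
  rw [pd, pd, this.fderiv_eq]

theorem ContDiffOn.differentiableAt_of_isOpen (hV : IsOpen V) (hf : ContDiffOn ℂ ∞ f V)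
    (hp : p ∈ V) : DifferentiableAt ℂ f p :=
  (hf.contDiffAt (hV.mem_nhds hp)).differentiableAt (by simp)

theorem pd_comm (hV : IsOpen V) (hf : ContDiffOn ℂ ∞ f V) (hp : p ∈ V) (v w : ℂ × ℂ × ℂ) :
    pd v (pd w f) p = pd w (pd v f) p := by
  have h1 : ContDiffOn ℂ ∞ (fderiv ℂ f) V := ((contDiffOn_infty_iff_fderiv_of_isOpen hV).1 hf).2
  have h2 : DifferentiableAt ℂ (fderiv ℂ f) p :=
    ContDiffOn.differentiableAt_of_isOpen hV h1 hp
  have key : ∀ v w, pd v (pd w f) p = fderiv ℂ (fderiv ℂ f) p v w := by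
    intro v w
    have := (h2.hasFDerivAt.clm_apply (hasFDerivAt_const w p)).fderiv
    change fderiv ℂ (fun q => fderiv ℂ f q w) p v = _
    rw [this]
    simp
  rw [key, key]
  have hs : IsSymmSndFDerivAt ℂ f p :=
    (hf.contDiffAt (hV.mem_nhds hp)).isSymmSndFDerivAt (by
      rw [minSmoothness_of_isRCLikeNormedField]
      exact WithTop.coe_le_coe.2 (le_top : (2 : ℕ∞) ≤ ⊤))
  exact hs.eq v w

end PartialDerivatives

/-! ### Holomorphy of the conjugated operators and of the solution -/

section Conjugated

variable {U : Opens ℂ} {X : Type*} [NormedAddCommGroup X] [NormedSpace ℂ X] [CompleteSpace X]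
  {S : FunctionSpace U X} {R : CompactDistribution (kernelDomain U)} {a α β : ℂ}

variable (S a α β) in
/-- The dressing operators, conjugated by multiplication by `exp(φ)`. -/
noncomputable def conjOp (F : ℂ × ℂ × ℂ → X →L[ℂ] X) (p : ℂ × ℂ × ℂ) : X →L[ℂ] X :=
  S.waveOp a α β p * F p * S.waveOp a α β (-p)

theorem toDistr_conjOp {B : Pairing S R} {F : ℂ × ℂ × ℂ → X →L[ℂ] X} {p : ℂ × ℂ × ℂ}
    (hF : B.IsDressingOperator a α β p (F p)) (y : X) (ψ : 𝓓(U, ℂ)) :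
    S.toDistr (conjOp S a α β F p y) ψ = B.toFun y (gaugedCauchy a α β S.le_punctured p ψ) := by
  rw [conjOp, mul_apply_eq_comp, mul_apply_eq_comp, FunctionSpace.waveOp, S.toDistr_mulCLM, hF,
    Pairing.source]
  change B.toFun (S.waveOp a α β p (S.waveOp a α β (-p) y)) _ = _
  rw [← mul_apply_eq_comp, S.waveOp_mul_neg, one_apply_eq_self]
  rfl

/-- Tested on `y` and ψ, this is the fundamental theorem of calculus for `gaugedCauchy`. That
function exists for all parameters, so the segment may leave the domain of the dressing operators:
only its endpoints matter. The integrand is continuous in operator norm, so the tested identities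
assemble into one of operators. -/
theorem conjOp_sub {B : Pairing S R} {F : ℂ × ℂ × ℂ → X →L[ℂ] X} {p q : ℂ × ℂ × ℂ}
    (hp : B.IsDressingOperator a α β p (F p)) (hq : B.IsDressingOperator a α β q (F q)) :
    conjOp S a α β F q - conjOp S a α β F p =
      ∫ t in (0 : ℝ)..1, B.dressDeriv a α β (p + (t : ℂ) • (q - p)) (q - p) := by
  have hline : Continuous fun t : ℝ => p + (t : ℂ) • (q - p) := by fun_prop
  have hDc : Continuous fun t : ℝ => B.dressDeriv a α β (p + (t : ℂ) • (q - p)) (q - p) :=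
    (((B.contDiff_dressDeriv a α β).continuous).comp hline).clm_apply continuous_const
  refine ContinuousLinearMap.ext fun y => S.ext fun ψ => ?_
  let Λ : (X →L[ℂ] X) →L[ℂ] ℂ := (S.evalCLM ψ).comp (ContinuousLinearMap.apply ℂ X y)
  have h1 : S.toDistr ((∫ t in (0 : ℝ)..1,
      B.dressDeriv a α β (p + (t : ℂ) • (q - p)) (q - p)) y) ψ =
      ∫ t in (0 : ℝ)..1, Λ (B.dressDeriv a α β (p + (t : ℂ) • (q - p)) (q - p)) :=
    (Λ.intervalIntegral_comp_comm (hDc.intervalIntegrable 0 1)).symm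
  rw [h1, sub_apply, map_sub, sub_apply, toDistr_conjOp hp, toDistr_conjOp hq]
  have hd : ∀ t ∈ Set.uIcc (0 : ℝ) 1, HasDerivAt
      (fun t : ℝ => B.toFun y (gaugedCauchy a α β S.le_punctured (p + (t : ℂ) • (q - p)) ψ))
      (Λ (B.dressDeriv a α β (p + (t : ℂ) • (q - p)) (q - p))) t := by
    intro t _
    have hl : HasDerivAt (fun t : ℂ => p + t • (q - p)) (q - p) (t : ℂ) := by
      simpa using ((hasDerivAt_id (t : ℂ)).smul_const (q - p)).const_add p
    have h2 := (B.hasFDerivAt_gaugedCauchy a α β (p + (t : ℂ) • (q - p)) y ψ).comp_hasDerivAt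
      (t : ℂ) hl
    exact h2.comp_ofReal
  rw [intervalIntegral.integral_eq_sub_of_hasDerivAt hd
    ((Λ.continuous.comp hDc).intervalIntegrable 0 1)]
  simp

/-- The integral formula upgrades weak to norm differentiability: the remainder is an average of
increments of `dressDeriv`, which is norm continuous. -/
theorem hasFDerivAt_conjOp {B : Pairing S R} {F : ℂ × ℂ × ℂ → X →L[ℂ] X} {Ω : Set (ℂ × ℂ × ℂ)}
    (hΩ : IsOpen Ω) (hF : ∀ p ∈ Ω, B.IsDressingOperator a α β p (F p)) {p : ℂ × ℂ × ℂ}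
    (hp : p ∈ Ω) : HasFDerivAt (conjOp S a α β F) (B.dressDeriv a α β p) p := by
  refine HasFDerivAt.of_isLittleO (Asymptotics.isLittleO_iff.2 fun ε hε => ?_)
  have hcont := (B.contDiff_dressDeriv a α β).continuous.continuousAt (x := p)
  obtain ⟨δ, hδ, hball⟩ := Metric.continuousAt_iff.1 hcont ε hε
  filter_upwards [hΩ.mem_nhds hp, Metric.ball_mem_nhds p hδ] with q hq hqδ
  have hline : Continuous fun t : ℝ => p + (t : ℂ) • (q - p) := by fun_prop
  have hDc : Continuous fun t : ℝ => B.dressDeriv a α β (p + (t : ℂ) • (q - p)) (q - p) :=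
    (((B.contDiff_dressDeriv a α β).continuous).comp hline).clm_apply continuous_const
  have h1 : conjOp S a α β F q - conjOp S a α β F p - B.dressDeriv a α β p (q - p) =
      ∫ t in (0 : ℝ)..1, (B.dressDeriv a α β (p + (t : ℂ) • (q - p)) (q - p) -
        B.dressDeriv a α β p (q - p)) := by
    rw [intervalIntegral.integral_sub (hDc.intervalIntegrable 0 1)
      (continuous_const.intervalIntegrable 0 1), conjOp_sub (hF p hp) (hF q hq)]
    simp
  rw [h1]
  refine (intervalIntegral.norm_integral_le_of_norm_le_const (C := ε * ‖q - p‖)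
    fun t ht => ?_).trans_eq (by simp)
  rw [Set.uIoc_of_le zero_le_one] at ht
  rw [← sub_apply]
  refine (ContinuousLinearMap.le_opNorm _ _).trans ?_
  refine mul_le_mul_of_nonneg_right ?_ (norm_nonneg _)
  rw [← dist_eq_norm]
  refine (hball ?_).le
  rw [dist_eq_norm, add_sub_cancel_left, norm_smul, Complex.norm_real, Real.norm_of_nonneg ht.1.le]
  rw [Metric.mem_ball, dist_eq_norm] at hqδ
  calc t * ‖q - p‖ ≤ 1 * ‖q - p‖ := by gcongr; exact ht.2
    _ < δ := by rwa [one_mul]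

theorem contDiffOn_conjOp {B : Pairing S R} {F : ℂ × ℂ × ℂ → X →L[ℂ] X} {Ω : Set (ℂ × ℂ × ℂ)}
    (hΩ : IsOpen Ω) (hF : ∀ p ∈ Ω, B.IsDressingOperator a α β p (F p)) :
    ContDiffOn ℂ ∞ (conjOp S a α β F) Ω := by
  rw [contDiffOn_infty_iff_fderiv_of_isOpen hΩ]
  refine ⟨fun p hp => (hasFDerivAt_conjOp hΩ hF hp).differentiableAt.differentiableWithinAt, ?_⟩
  exact (B.contDiff_dressDeriv a α β).contDiffOn.congr fun p hp => (hasFDerivAt_conjOp hΩ hF hp).fderiv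

/-- Index 0 and trivial kernel give a cokernel of `finrank` 0; it is finite-dimensional, hence
trivial. -/
theorem isUnit_of_isFredholm {A : X →L[ℂ] X} (h : A.IsFredholm) (h0 : A.toLinearMap.index = 0)
    (hker : A.toLinearMap.ker = ⊥) : IsUnit A := by
  rw [ContinuousLinearMap.isUnit_iff_bijective]
  refine ⟨LinearMap.ker_eq_bot.1 hker, ?_⟩
  have hfin : Module.Finite ℂ (X ⧸ A.toLinearMap.range) := h.finite_coker
  rw [LinearMap.index_eq_finrank_sub, hker] at h0
  have h1 : Module.finrank ℂ (X ⧸ A.toLinearMap.range) = 0 := by simpa using h0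
  have h2 : Subsingleton (X ⧸ A.toLinearMap.range) := Module.finrank_zero_iff.1 h1
  exact LinearMap.range_eq_top.1 (Submodule.Quotient.subsingleton_iff.1 h2)

theorem isUnit_one_sub_conjOp {F : ℂ × ℂ × ℂ → X →L[ℂ] X} {p : ℂ × ℂ × ℂ} (h : IsUnit (1 - F p)) :
    IsUnit (1 - conjOp S a α β F p) := by
  have h1 : 1 - conjOp S a α β F p = S.waveOp a α β p * (1 - F p) * S.waveOp a α β (-p) := by
    rw [conjOp, mul_sub, sub_mul, mul_one, S.waveOp_mul_neg]
  have hu : IsUnit (S.waveOp a α β p) :=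
    ⟨⟨_, _, S.waveOp_mul_neg a α β p, S.waveOp_neg_mul a α β p⟩, rfl⟩
  have hu' : IsUnit (S.waveOp a α β (-p)) :=
    ⟨⟨_, _, S.waveOp_neg_mul a α β p, S.waveOp_mul_neg a α β p⟩, rfl⟩
  rw [h1]
  exact (hu.mul h).mul hu'

variable (S a α β) in
/-- The solution of the dressed equation, multiplied by `exp(φ)`. -/
noncomputable def waveSol (F : ℂ × ℂ × ℂ → X →L[ℂ] X) (p : ℂ × ℂ × ℂ) : X :=
  Ring.inverse (1 - conjOp S a α β F p) (S.wave a α β 0 p)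

theorem apply_waveSol {F : ℂ × ℂ × ℂ → X →L[ℂ] X} {p : ℂ × ℂ × ℂ} (h : IsUnit (1 - F p)) :
    (1 - conjOp S a α β F p) (waveSol S a α β F p) = S.wave a α β 0 p := by
  rw [waveSol, ← mul_apply_eq_comp, Ring.mul_inverse_cancel _ (isUnit_one_sub_conjOp h),
    one_apply_eq_self]

theorem contDiffOn_waveSol {B : Pairing S R} {F : ℂ × ℂ × ℂ → X →L[ℂ] X} {Ω : Set (ℂ × ℂ × ℂ)}
    (hΩ : IsOpen Ω) (hF : ∀ p ∈ Ω, B.IsDressingOperator a α β p (F p))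
    (hu : ∀ p ∈ Ω, IsUnit (1 - F p)) : ContDiffOn ℂ ∞ (waveSol S a α β F) Ω := by
  have h1 : ContDiffOn ℂ ∞ (fun p => 1 - conjOp S a α β F p) Ω :=
    contDiffOn_const.sub (contDiffOn_conjOp hΩ hF)
  have h2 : ContDiffOn ℂ ∞ (fun p => Ring.inverse (1 - conjOp S a α β F p)) Ω := fun p hp => by
    obtain ⟨u, hu⟩ := isUnit_one_sub_conjOp (S := S) (a := a) (α := α) (β := β) (hu p hp)
    have h3 := contDiffAt_ringInverse ℂ (n := ∞) u
    rw [hu] at h3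
    exact h3.comp_contDiffWithinAt (f := fun p => 1 - conjOp S a α β F p) p (h1 p hp)
  exact h2.clm_apply (S.contDiff_wave a α β 0).contDiffOn

/-- Differentiation of an equation `(1 - G) z = r`. -/
theorem apply_pd {B : Pairing S R} {F : ℂ × ℂ × ℂ → X →L[ℂ] X} {Ω : Set (ℂ × ℂ × ℂ)}
    (hΩ : IsOpen Ω) (hF : ∀ p ∈ Ω, B.IsDressingOperator a α β p (F p))
    {z r : ℂ × ℂ × ℂ → X} {V : Set (ℂ × ℂ × ℂ)} (hV : IsOpen V) (hVΩ : V ⊆ Ω)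
    (h : ∀ p ∈ V, (1 - conjOp S a α β F p) (z p) = r p) {p : ℂ × ℂ × ℂ} (hp : p ∈ V)
    (hz : DifferentiableAt ℂ z p) (v : ℂ × ℂ × ℂ) :
    (1 - conjOp S a α β F p) (pd v z p) = pd v r p + B.dressDeriv a α β p v (z p) := by
  have h1 : HasFDerivAt (fun q => 1 - conjOp S a α β F q) (-B.dressDeriv a α β p) p := by
    simpa using (hasFDerivAt_conjOp hΩ hF (hVΩ hp)).const_sub 1
  have h2 := (h1.clm_apply hz.hasFDerivAt).fderiv
  have h3 : pd v r p = pd v (fun q => (1 - conjOp S a α β F q) (z q)) p :=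
    pd_congr hV (fun q hq => (h q hq).symm) hp v
  rw [h3]
  simp only [pd]
  rw [h2]
  simp

end Conjugated

/-! ### Rules for partial derivatives -/

section PartialDerivativeRules

variable {E : Type*} [NormedAddCommGroup E] [NormedSpace ℂ E] {p : ℂ × ℂ × ℂ}

theorem pd_smul {c : ℂ × ℂ × ℂ → ℂ} {x : ℂ × ℂ × ℂ → E} (hc : DifferentiableAt ℂ c p)
    (hx : DifferentiableAt ℂ x p) (v : ℂ × ℂ × ℂ) :
    pd v (fun q => c q • x q) p = pd v c p • x p + c p • pd v x p := by
  simp only [pd]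
  rw [fderiv_fun_smul hc hx]
  simp [add_comm]

theorem pd_add {x y : ℂ × ℂ × ℂ → E} (hx : DifferentiableAt ℂ x p) (hy : DifferentiableAt ℂ y p)
    (v : ℂ × ℂ × ℂ) : pd v (fun q => x q + y q) p = pd v x p + pd v y p := by
  simp only [pd]
  rw [fderiv_fun_add hx hy]
  rfl

theorem pd_const_mul {c : ℂ × ℂ × ℂ → ℂ} (hc : DifferentiableAt ℂ c p) (k : ℂ) (v : ℂ × ℂ × ℂ) :
    pd v (fun q => k * c q) p = k * pd v c p := by
  simp only [pd]
  rw [fderiv_const_mul hc]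
  rfl

theorem pd_const_sub (c : ℂ × ℂ × ℂ → ℂ) (k : ℂ) (v : ℂ × ℂ × ℂ) :
    pd v (fun q => k - c q) p = -pd v c p := by
  simp only [pd]
  rw [fderiv_const_sub]
  rfl

end PartialDerivativeRules

/-- The direction of `u` in `ℂ³`. -/
abbrev eU : ℂ × ℂ × ℂ := (1, 0, 0)
/-- The direction of `v` in `ℂ³`. -/
abbrev eV : ℂ × ℂ × ℂ := (0, 1, 0)
/-- The direction of `t` in `ℂ³`. -/
abbrev eT : ℂ × ℂ × ℂ := (0, 0, 1)

/-! ### The auxiliary linear problem and the recursions for the coefficients -/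

section Lax

variable {U : Opens ℂ} {X : Type*} [NormedAddCommGroup X] [NormedSpace ℂ X] [CompleteSpace X]
  {S : FunctionSpace U X} {R : CompactDistribution (kernelDomain U)} {a α β : ℂ}

theorem pd_wave_u (S : FunctionSpace U X) (a α β : ℂ) (n : ℤ) (p : ℂ × ℂ × ℂ) :
    pd eU (S.wave a α β n) p = S.wave a α β (n + 1) p := by
  rw [pd, (S.hasFDerivAt_wave a α β n p).fderiv, coordForm_apply]; simp

theorem pd_wave_v (S : FunctionSpace U X) (a α β : ℂ) (n : ℤ) (p : ℂ × ℂ × ℂ) :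
    pd eV (S.wave a α β n) p = a • S.wave a α β (n - 1) p := by
  rw [pd, (S.hasFDerivAt_wave a α β n p).fderiv, coordForm_apply]; simp

theorem pd_wave_t (S : FunctionSpace U X) (a α β : ℂ) (n : ℤ) (p : ℂ × ℂ × ℂ) :
    pd eT (S.wave a α β n) p =
      α • S.wave a α β (n + 2) p + (a ^ 2 * β) • S.wave a α β (n - 2) p := by
  rw [pd, (S.hasFDerivAt_wave a α β n p).fderiv, coordForm_apply]; simp

theorem differentiableAt_wave (S : FunctionSpace U X) (a α β : ℂ) (n : ℤ) (p : ℂ × ℂ × ℂ) :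
    DifferentiableAt ℂ (S.wave a α β n) p :=
  (S.hasFDerivAt_wave a α β n p).differentiableAt

theorem fderiv_moment_apply (B : Pairing S R) (n : ℤ) {z : ℂ × ℂ × ℂ → X} {p : ℂ × ℂ × ℂ}
    (hz : DifferentiableAt ℂ z p) (v : ℂ × ℂ × ℂ) :
    pd v (fun q => B.moment a α β n q (z q)) p = B.moment a α β n p (pd v z p) +
      coordForm (-B.moment a α β (n + 1) p) (-(a • B.moment a α β (n - 1) p))
        (-(α • B.moment a α β (n + 2) p + (a ^ 2 * β) • B.moment a α β (n - 2) p)) v (z p) := by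
  simp only [pd]
  rw [((B.hasFDerivAt_moment a α β n p).clm_apply hz.hasFDerivAt).fderiv]
  simp

theorem moment_pd_u (B : Pairing S R) (n : ℤ) {z : ℂ × ℂ × ℂ → X} {p : ℂ × ℂ × ℂ}
    (hz : DifferentiableAt ℂ z p) : B.moment a α β n p (pd eU z p) =
      pd eU (fun q => B.moment a α β n q (z q)) p + B.moment a α β (n + 1) p (z p) := by
  rw [fderiv_moment_apply B n hz, coordForm_apply]; simp

theorem moment_pd_v (B : Pairing S R) (n : ℤ) {z : ℂ × ℂ × ℂ → X} {p : ℂ × ℂ × ℂ}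
    (hz : DifferentiableAt ℂ z p) : B.moment a α β n p (pd eV z p) =
      pd eV (fun q => B.moment a α β n q (z q)) p + a * B.moment a α β (n - 1) p (z p) := by
  rw [fderiv_moment_apply B n hz, coordForm_apply]; simp

theorem moment_pd_t (B : Pairing S R) (n : ℤ) {z : ℂ × ℂ × ℂ → X} {p : ℂ × ℂ × ℂ}
    (hz : DifferentiableAt ℂ z p) : B.moment a α β n p (pd eT z p) =
      pd eT (fun q => B.moment a α β n q (z q)) p + (α * B.moment a α β (n + 2) p (z p) +
        a ^ 2 * β * B.moment a α β (n - 2) p (z p)) := by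
  rw [fderiv_moment_apply B n hz, coordForm_apply]; simp; ring

theorem dressDeriv_u (B : Pairing S R) (p : ℂ × ℂ × ℂ) (x : X) :
    B.dressDeriv a α β p eU x = B.moment a α β 0 p x • S.wave a α β 0 p := by
  rw [Pairing.dressDeriv, coordForm_apply]; simp

theorem dressDeriv_v (B : Pairing S R) (p : ℂ × ℂ × ℂ) (x : X) :
    B.dressDeriv a α β p eV x = -(a * B.moment a α β (-1) p x) • S.wave a α β (-1) p := by
  rw [Pairing.dressDeriv, coordForm_apply]; simp [smul_smul]

theorem dressDeriv_t (B : Pairing S R) (p : ℂ × ℂ × ℂ) (x : X) :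
    B.dressDeriv a α β p eT x =
      α • (B.moment a α β 0 p x • S.wave a α β 1 p + B.moment a α β 1 p x • S.wave a α β 0 p) -
      (a ^ 2 * β) • (B.moment a α β (-2) p x • S.wave a α β (-1) p +
        B.moment a α β (-1) p x • S.wave a α β (-2) p) := by
  rw [Pairing.dressDeriv, coordForm_apply]; simp

/-- The coefficients of the expansions of the solution, up to sign and index. -/
noncomputable def coeff (B : Pairing S R) (a α β : ℂ) (F : ℂ × ℂ × ℂ → X →L[ℂ] X) (n : ℤ)
    (p : ℂ × ℂ × ℂ) : ℂ :=
  B.moment a α β n p (waveSol S a α β F p)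

/-- Standing assumptions on a family of dressing operators on the open set `Ω`. -/
structure DressingFamily (B : Pairing S R) (a α β : ℂ) (F : ℂ × ℂ × ℂ → X →L[ℂ] X)
    (Ω : Set (ℂ × ℂ × ℂ)) : Prop where
  isOpen : IsOpen Ω
  dressing : ∀ p ∈ Ω, B.IsDressingOperator a α β p (F p)
  isUnit : ∀ p ∈ Ω, IsUnit (1 - F p)

variable {B : Pairing S R} {F : ℂ × ℂ × ℂ → X →L[ℂ] X} {Ω : Set (ℂ × ℂ × ℂ)}

namespace DressingFamily

theorem contDiffOn_sol (H : DressingFamily B a α β F Ω) : ContDiffOn ℂ ∞ (waveSol S a α β F) Ω :=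
  contDiffOn_waveSol H.isOpen H.dressing H.isUnit

theorem contDiffOn_coeff (H : DressingFamily B a α β F Ω) (n : ℤ) :
    ContDiffOn ℂ ∞ (coeff B a α β F n) Ω :=
  (B.contDiff_moment a α β n).contDiffOn.clm_apply H.contDiffOn_sol

theorem differentiableAt_coeff (H : DressingFamily B a α β F Ω) (n : ℤ) {p : ℂ × ℂ × ℂ}
    (hp : p ∈ Ω) : DifferentiableAt ℂ (coeff B a α β F n) p :=
  (H.contDiffOn_coeff n).differentiableAt_of_isOpen H.isOpen hp

theorem differentiableAt_sol (H : DressingFamily B a α β F Ω) {p : ℂ × ℂ × ℂ}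
    (hp : p ∈ Ω) : DifferentiableAt ℂ (waveSol S a α β F) p :=
  H.contDiffOn_sol.differentiableAt_of_isOpen H.isOpen hp

theorem differentiableAt_pd_sol (H : DressingFamily B a α β F Ω) {p : ℂ × ℂ × ℂ}
    (hp : p ∈ Ω) (v : ℂ × ℂ × ℂ) : DifferentiableAt ℂ (pd v (waveSol S a α β F)) p :=
  (H.contDiffOn_sol.pd H.isOpen v).differentiableAt_of_isOpen H.isOpen hp

theorem injective (H : DressingFamily B a α β F Ω) {p : ℂ × ℂ × ℂ} (hp : p ∈ Ω) :
    Function.Injective (1 - conjOp S a α β F p : X →L[ℂ] X) :=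
  (ContinuousLinearMap.isUnit_iff_bijective.1 (isUnit_one_sub_conjOp (H.isUnit p hp))).1

/-- As for the other derivatives below, the finite-rank derivative of the conjugated operator
contributes waves whose coefficients are moments of the solution. -/
theorem apply_u (H : DressingFamily B a α β F Ω) {p : ℂ × ℂ × ℂ} (hp : p ∈ Ω) :
    (1 - conjOp S a α β F p) (pd eU (waveSol S a α β F) p) =
      S.wave a α β 1 p + coeff B a α β F 0 p • S.wave a α β 0 p := by
  rw [apply_pd H.isOpen H.dressing H.isOpen subset_rfl (fun q hq => apply_waveSol (H.isUnit q hq))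
    hp (H.differentiableAt_sol hp), pd_wave_u, dressDeriv_u]
  rfl

theorem apply_v (H : DressingFamily B a α β F Ω) {p : ℂ × ℂ × ℂ} (hp : p ∈ Ω) :
    (1 - conjOp S a α β F p) (pd eV (waveSol S a α β F) p) =
      (a * (1 - coeff B a α β F (-1) p)) • S.wave a α β (-1) p := by
  rw [apply_pd H.isOpen H.dressing H.isOpen subset_rfl (fun q hq => apply_waveSol (H.isUnit q hq))
    hp (H.differentiableAt_sol hp), pd_wave_v, dressDeriv_v]
  change a • S.wave a α β (-1) p + -(a * coeff B a α β F (-1) p) • S.wave a α β (-1) p = _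
  module

theorem apply_t (H : DressingFamily B a α β F Ω) {p : ℂ × ℂ × ℂ} (hp : p ∈ Ω) :
    (1 - conjOp S a α β F p) (pd eT (waveSol S a α β F) p) =
      α • S.wave a α β 2 p + (a ^ 2 * β) • S.wave a α β (-2) p +
      (α • (coeff B a α β F 0 p • S.wave a α β 1 p + coeff B a α β F 1 p • S.wave a α β 0 p) -
      (a ^ 2 * β) • (coeff B a α β F (-2) p • S.wave a α β (-1) p +
        coeff B a α β F (-1) p • S.wave a α β (-2) p)) := by
  rw [apply_pd H.isOpen H.dressing H.isOpen subset_rfl (fun q hq => apply_waveSol (H.isUnit q hq))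
    hp (H.differentiableAt_sol hp), pd_wave_t, dressDeriv_t]
  rfl

theorem moment_sol_v (H : DressingFamily B a α β F Ω) (n : ℤ) {p : ℂ × ℂ × ℂ} (hp : p ∈ Ω) :
    B.moment a α β n p (pd eV (waveSol S a α β F) p) =
      pd eV (coeff B a α β F n) p + a * coeff B a α β F (n - 1) p :=
  moment_pd_v B n (H.differentiableAt_sol hp)

theorem moment_sol_u (H : DressingFamily B a α β F Ω) (n : ℤ) {p : ℂ × ℂ × ℂ} (hp : p ∈ Ω) :
    B.moment a α β n p (pd eU (waveSol S a α β F) p) =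
      pd eU (coeff B a α β F n) p + coeff B a α β F (n + 1) p :=
  moment_pd_u B n (H.differentiableAt_sol hp)

theorem apply_uv (H : DressingFamily B a α β F Ω) {p : ℂ × ℂ × ℂ} (hp : p ∈ Ω) :
    (1 - conjOp S a α β F p) (pd eU (pd eV (waveSol S a α β F)) p) =
      (-(a * pd eU (coeff B a α β F (-1)) p)) • S.wave a α β (-1) p +
      (a + pd eV (coeff B a α β F 0) p) • S.wave a α β 0 p := by
  have hw := H.differentiableAt_coeff (-1) hp
  rw [apply_pd H.isOpen H.dressing H.isOpen subset_rfl (fun q hq => H.apply_v hq)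
    hp (H.differentiableAt_pd_sol hp eV), dressDeriv_u, H.moment_sol_v 0 hp,
    pd_smul (by fun_prop) (differentiableAt_wave S a α β _ p), pd_wave_u,
    pd_const_mul (by fun_prop), pd_const_sub]
  norm_num
  module

theorem apply_uu (H : DressingFamily B a α β F Ω) {p : ℂ × ℂ × ℂ} (hp : p ∈ Ω) :
    (1 - conjOp S a α β F p) (pd eU (pd eU (waveSol S a α β F)) p) =
      S.wave a α β 2 p + coeff B a α β F 0 p • S.wave a α β 1 p +
      (2 * pd eU (coeff B a α β F 0) p + coeff B a α β F 1 p) • S.wave a α β 0 p := by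
  have hw := H.differentiableAt_coeff 0 hp
  have hd := fun n => differentiableAt_wave S a α β n p
  rw [apply_pd H.isOpen H.dressing H.isOpen subset_rfl (fun q hq => H.apply_u hq)
    hp (H.differentiableAt_pd_sol hp eU), dressDeriv_u, H.moment_sol_u 0 hp,
    pd_add (y := fun q => coeff B a α β F 0 q • S.wave a α β 0 q) (hd 1) (hw.smul (hd 0)), pd_smul hw (hd 0), pd_wave_u, pd_wave_u]
  norm_num
  module

theorem apply_vv (H : DressingFamily B a α β F Ω) {p : ℂ × ℂ × ℂ} (hp : p ∈ Ω) :
    (1 - conjOp S a α β F p) (pd eV (pd eV (waveSol S a α β F)) p) =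
      (-(a * (2 * pd eV (coeff B a α β F (-1)) p + a * coeff B a α β F (-2) p))) •
        S.wave a α β (-1) p +
      (a ^ 2 * (1 - coeff B a α β F (-1) p)) • S.wave a α β (-2) p := by
  have hw := H.differentiableAt_coeff (-1) hp
  rw [apply_pd H.isOpen H.dressing H.isOpen subset_rfl (fun q hq => H.apply_v hq)
    hp (H.differentiableAt_pd_sol hp eV), dressDeriv_v, H.moment_sol_v (-1) hp,
    pd_smul (by fun_prop) (differentiableAt_wave S a α β _ p), pd_wave_v,
    pd_const_mul (by fun_prop), pd_const_sub]
  norm_num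
  module

/-- The first equation of the auxiliary linear problem. -/
theorem lax_space (H : DressingFamily B a α β F Ω) {p : ℂ × ℂ × ℂ} (hp : p ∈ Ω) {σ : ℂ}
    (hσ : pd eU (coeff B a α β F (-1)) p = σ * (1 - coeff B a α β F (-1) p)) :
    pd eU (pd eV (waveSol S a α β F)) p + σ • pd eV (waveSol S a α β F) p =
      (a + pd eV (coeff B a α β F 0) p) • waveSol S a α β F p := by
  -- Under 1 - G, `hσ` makes the waves of index -1 cancel, and the remaining multiple of the wave of
  -- index 0 is the image of the same multiple of the solution.
  apply H.injective hp
  rw [map_add, map_smul, map_smul, H.apply_uv hp, H.apply_v hp, apply_waveSol (H.isUnit p hp), hσ]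
  module

/-- The second equation of the auxiliary linear problem. -/
theorem lax_time (H : DressingFamily B a α β F Ω) {p : ℂ × ℂ × ℂ} (hp : p ∈ Ω) {τ : ℂ}
    (hτ : pd eV (coeff B a α β F (-1)) p = τ * (1 - coeff B a α β F (-1) p)) :
    pd eT (waveSol S a α β F) p = α • pd eU (pd eU (waveSol S a α β F)) p +
      β • pd eV (pd eV (waveSol S a α β F)) p + (2 * β * τ) • pd eV (waveSol S a α β F) p -
      (2 * α * pd eU (coeff B a α β F 0) p) • waveSol S a α β F p := by
  -- The second derivatives account for the waves of index 2, 1 and -2. What is left at index -1 is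
  -- 2aβ times the v-derivative of the coefficient -1, which `hτ` turns into a multiple of the image
  -- of z_v; at index 0 a multiple of the image of z is left.
  apply H.injective hp
  rw [map_sub, map_add, map_add, map_smul, map_smul, map_smul, map_smul, H.apply_uu hp,
    H.apply_vv hp, H.apply_t hp, H.apply_v hp, apply_waveSol (H.isUnit p hp), hτ]
  module

/-- The n-th moment of the first Lax equation; the neighbouring indices appear because the moment
functionals themselves depend on `p`. -/
theorem coeff_space (H : DressingFamily B a α β F Ω) (n : ℤ) {p : ℂ × ℂ × ℂ} (hp : p ∈ Ω) {σ : ℂ}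
    (hσ : pd eU (coeff B a α β F (-1)) p = σ * (1 - coeff B a α β F (-1) p)) :
    pd eU (pd eV (coeff B a α β F n)) p + a * pd eU (coeff B a α β F (n - 1)) p +
      pd eV (coeff B a α β F (n + 1)) p + a * coeff B a α β F n p +
      σ * (pd eV (coeff B a α β F n) p + a * coeff B a α β F (n - 1) p) =
      (a + pd eV (coeff B a α β F 0) p) * coeff B a α β F n p := by
  have h := congrArg (B.moment a α β n p) (H.lax_space hp hσ)
  rw [map_add, map_smul, map_smul, moment_pd_u B n (H.differentiableAt_pd_sol hp eV),
    H.moment_sol_v n hp, H.moment_sol_v (n + 1) hp,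
    pd_congr H.isOpen (fun q hq => H.moment_sol_v n hq) hp,
    pd_add (((H.contDiffOn_coeff n).pd H.isOpen eV).differentiableAt_of_isOpen H.isOpen hp)
      ((H.differentiableAt_coeff _ hp).const_mul a),
    pd_const_mul (H.differentiableAt_coeff _ hp), add_sub_cancel_right] at h
  simp only [smul_eq_mul] at h
  change _ = (a + pd eV (coeff B a α β F 0) p) * coeff B a α β F n p at h
  linear_combination h

theorem coeff_time (H : DressingFamily B a α β F Ω) (n : ℤ) {p : ℂ × ℂ × ℂ} (hp : p ∈ Ω) {τ : ℂ}
    (hτ : pd eV (coeff B a α β F (-1)) p = τ * (1 - coeff B a α β F (-1) p)) :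
    pd eT (coeff B a α β F n) p =
      α * (pd eU (pd eU (coeff B a α β F n)) p + 2 * pd eU (coeff B a α β F (n + 1)) p) +
      β * (pd eV (pd eV (coeff B a α β F n)) p + 2 * a * pd eV (coeff B a α β F (n - 1)) p) +
      2 * β * τ * (pd eV (coeff B a α β F n) p + a * coeff B a α β F (n - 1) p) -
      2 * α * pd eU (coeff B a α β F 0) p * coeff B a α β F n p := by
  have h := congrArg (B.moment a α β n p) (H.lax_time hp hτ)
  have hd : ∀ v m, DifferentiableAt ℂ (pd v (coeff B a α β F m)) p := fun v m =>
    ((H.contDiffOn_coeff m).pd H.isOpen v).differentiableAt_of_isOpen H.isOpen hp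
  rw [map_sub, map_add, map_add, map_smul, map_smul, map_smul, map_smul,
    moment_pd_u B n (H.differentiableAt_pd_sol hp eU),
    moment_pd_v B n (H.differentiableAt_pd_sol hp eV), moment_pd_t B n (H.differentiableAt_sol hp),
    H.moment_sol_v n hp, H.moment_sol_v (n - 1) hp, H.moment_sol_u (n + 1) hp,
    pd_congr H.isOpen (fun q hq => H.moment_sol_v n hq) hp,
    pd_congr H.isOpen (fun q hq => H.moment_sol_u n hq) hp,
    pd_add (hd _ _) ((H.differentiableAt_coeff _ hp).const_mul a),
    pd_add (hd _ _) (H.differentiableAt_coeff _ hp),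
    pd_const_mul (H.differentiableAt_coeff _ hp)] at h
  simp only [smul_eq_mul, add_assoc, sub_sub] at h
  norm_num at h
  change pd eT (coeff B a α β F n) p + (α * coeff B a α β F (n + 2) p +
    a ^ 2 * β * coeff B a α β F (n - 2) p) = _ at h
  change _ = _ - _ * coeff B a α β F n p at h
  linear_combination h

end DressingFamily

end Lax

/-! ### From the recursions to the Kaup–Broer system -/

section DifferentialAlgebra

variable {A : Type*} [CommRing A] [Algebra ℂ A] {Du Dv Dt : Derivation ℂ A A}
  {a α β s g m x y w n : A}

/-- The quantity `Π` of the Kaup–Broer system in a differential algebra. -/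
def potential (Du Dv : Derivation ℂ A A) (a α β s g k : A) : A :=
  -(α * Du (Du s)) - β * Dv (Dv s) + 2 * (a * (β * Dv k)) - 2 * (α * Du g)

/-- The spatial recursion at index -1, divided by x = e^{-s}; here y = e^s, m = w_{-1}, n = w_{-2}
and g = w_0. It supplies the u-antiderivative of g_v + s_uv that enters Π. -/
theorem derivation_ratio (hxy : x * y = 1) (hm : m = 1 - x) (hu : Du x = -(Du s * x)) (hv : Dv x = -(Dv s * x))
    (h : Du (Dv m) + a * Du n + Dv g + a * m + Du s * (Dv m + a * n) = (a + Dv g) * m) :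
    a * Du (-(n * y)) = Dv g + Du (Dv s) := by
  have hy : Du y = Du s * y := by
    have h1 := congrArg Du hxy
    simp only [Derivation.leibniz, Derivation.map_one_eq_zero, smul_eq_mul, hu] at h1
    linear_combination y * h1 + (Du s * y - Du y) * hxy
  subst hm
  simp only [map_sub, map_neg, map_zero, Derivation.leibniz, Derivation.map_one_eq_zero, smul_eq_mul, hu, hv,
    hy] at h ⊢
  linear_combination -y * h + (Dv g + Du (Dv s)) * hxy

/-- The time recursion at index -1, divided by e^{-s}. -/
theorem potential_eq (hxy : x * y = 1) (hm : m = 1 - x) (hu : Du x = -(Du s * x))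
    (hv : Dv x = -(Dv s * x)) (ht : Dt x = -(Dt s * x))
    (h : Dt m = α * (Du (Du m) + 2 * Du g) + β * (Dv (Dv m) + 2 * a * Dv n) +
      2 * β * Dv s * (Dv m + a * n) - 2 * α * Du g * m) :
    Dt s + α * Du s ^ 2 - β * Dv s ^ 2 + potential Du Dv a α β s g (-(n * y)) = 0 := by
  have hy : Dv y = Dv s * y := by
    have h1 := congrArg Dv hxy
    simp only [Derivation.leibniz, Derivation.map_one_eq_zero, smul_eq_mul, hv] at h1
    linear_combination y * h1 + (Dv s * y - Dv y) * hxy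
  subst hm
  simp only [potential, map_sub, map_neg, map_zero, Derivation.leibniz, Derivation.map_one_eq_zero,
    smul_eq_mul, hu, hv, ht, hy] at h ⊢
  linear_combination y * h - (Dt s + α * Du s ^ 2 - β * Dv s ^ 2 - α * Du (Du s) -
    β * Dv (Dv s) - 2 * α * Du g) * hxy

variable {k c r : A}

/-- Only the term of Π with k is not a derivative of s or g. Two v-derivatives of `hk` express its
uv-derivative through g and s. The element r is the constant 1/2. -/
theorem potential_uv (huv : ∀ f, Dv (Du f) = Du (Dv f)) (ha : Du a = 0 ∧ Dv a = 0)
    (hα : Du α = 0 ∧ Dv α = 0) (hβ : Du β = 0 ∧ Dv β = 0) (hr : Du r = 0 ∧ Dv r = 0)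
    (hr2 : 2 * r = 1) (hk : a * Du k = Dv g + Du (Dv s)) :
    Du (Dv (potential Du Dv a α β s g k)) =
      2 * (α * Du (Du (-Dv g - r * Du (Dv s))) - β * Dv (Dv (-Dv g - r * Du (Dv s)))) := by
  have h1 := congrArg (fun f => Dv (Dv f)) hk
  have h2 : Du (2 : A) = 0 ∧ Dv (2 : A) = 0 := by
    constructor
    · simpa using Du.map_natCast 2
    · simpa using Dv.map_natCast 2
  simp only [potential, map_add, map_sub, map_neg, Derivation.leibniz, smul_eq_mul, huv,
    ha.1, ha.2, hα.1, hα.2, hβ.1, hβ.2, hr.1, hr.2, h2.1, h2.2, mul_zero, add_zero] at h1 ⊢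
  linear_combination 2 * β * h1 + (α * Du (Du (Du (Dv s))) - β * Du (Dv (Dv (Dv s)))) * hr2

/-- The recursions at index 0 involve w = w_1 only through w_v and w_u, so the u-derivative of the
first, times 2α, and the v-derivative of the second eliminate it. The uv-derivative of the equation
for s removes s_uvt from c_t, and `hq` removes Π. -/
theorem density_eq (huv : ∀ f, Dv (Du f) = Du (Dv f)) (hut : ∀ f, Dt (Du f) = Du (Dt f))
    (hvt : ∀ f, Dt (Dv f) = Dv (Dt f))
    (ha : Du a = 0 ∧ Dv a = 0) (hα : Du α = 0 ∧ Dv α = 0) (hβ : Du β = 0 ∧ Dv β = 0)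
    (hr : Du r = 0 ∧ Dv r = 0 ∧ Dt r = 0) (hr2 : 2 * r = 1)
    (hm : m = 1 - x) (hu : Du x = -(Du s * x)) (hv : Dv x = -(Dv s * x))
    (h1 : Du (Dv g) + a * Du m + Dv w + a * g + Du s * (Dv g + a * m) = (a + Dv g) * g)
    (h2 : Dt g = α * (Du (Du g) + 2 * Du w) + β * (Dv (Dv g) + 2 * a * Dv m) +
      2 * β * Dv s * (Dv g + a * m) - 2 * α * Du g * g) {q : A}
    (hs : Dt s + α * Du s ^ 2 - β * Dv s ^ 2 + q = 0)
    (hc : c = -Dv g - r * Du (Dv s))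
    (hq : Du (Dv q) = 2 * (α * Du (Du c) - β * Dv (Dv c))) :
    Dt c + 2 * α * Du (Du s * c) - 2 * β * Dv (Dv s * c) -
      2 * a * (α * Du (Du s) - β * Dv (Dv s)) +
      r * (α * Du (Du (Du (Dv s))) - β * Dv (Dv (Du (Dv s)))) = 0 := by
  have hh : Dv (2 : A) = 0 := by simpa using Dv.map_natCast 2
  subst hm hc
  have h3 := congrArg Du h1
  have h4 := congrArg Dv h2
  have h5 := congrArg (fun f => Du (Dv f)) hs
  simp only [map_add, map_sub, map_neg, map_zero, Derivation.leibniz, smul_eq_mul, huv, hut, hvt,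
    ha.1, ha.2, hα.1, hα.2, hβ.1, hβ.2, hr.1, hr.2.1, hr.2.2, hh, mul_zero, add_zero,
    zero_add, Derivation.map_one_eq_zero, hu, hv, pow_two] at h1 h2 h3 h4 h5 hq ⊢
  linear_combination -h4 - 2 * α * h3 - r * h5 + r * hq -
    (α * (Du (Du (Dv g)) + r * Du (Du (Du (Dv s)))) -
      β * (Dv (Dv (Dv g)) + r * Du (Dv (Dv (Dv s))))) * hr2

theorem exists_potential {k : ℂ → A} {a α β : ℂ} {w : ℤ → A}
    (hk : ∀ z, Du (k z) = 0 ∧ Dv (k z) = 0 ∧ Dt (k z) = 0) (hr2 : 2 * k (1 / 2) = 1)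
    (huv : ∀ f, Dv (Du f) = Du (Dv f)) (hut : ∀ f, Dt (Du f) = Du (Dt f))
    (hvt : ∀ f, Dt (Dv f) = Dv (Dt f))
    (hxy : x * y = 1) (hm : w (-1) = 1 - x) (hu : Du x = -(Du s * x))
    (hv : Dv x = -(Dv s * x)) (ht : Dt x = -(Dt s * x))
    (r1 : ∀ n, Du (Dv (w n)) + k a * Du (w (n - 1)) + Dv (w (n + 1)) + k a * w n +
      Du s * (Dv (w n) + k a * w (n - 1)) = (k a + Dv (w 0)) * w n)
    (r2 : ∀ n, Dt (w n) = k α * (Du (Du (w n)) + 2 * Du (w (n + 1))) +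
      k β * (Dv (Dv (w n)) + 2 * k a * Dv (w (n - 1))) +
      2 * k β * Dv s * (Dv (w n) + k a * w (n - 1)) - 2 * k α * Du (w 0) * w n)
    (hc : c = -Dv (w 0) - k (1 / 2) * Du (Dv s)) :
    ∃ q, Dt s + k α * Du s ^ 2 - k β * Dv s ^ 2 + q = 0 ∧
      Du (Dv q) = 2 * (k α * Du (Du c) - k β * Dv (Dv c)) ∧
      Dt c + 2 * k α * Du (Du s * c) - 2 * k β * Dv (Dv s * c) -
        2 * k a * (k α * Du (Du s) - k β * Dv (Dv s)) +
        k (1 / 2) * (k α * Du (Du (Du (Dv s))) - k β * Dv (Dv (Du (Dv s)))) = 0 := by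
  have e1 := derivation_ratio hxy hm hu hv (r1 (-1))
  have e2 := potential_eq hxy hm hu hv ht (r2 (-1))
  have hk' : ∀ z, Du (k z) = 0 ∧ Dv (k z) = 0 := fun z => ⟨(hk z).1, (hk z).2.1⟩
  have e3 := potential_uv (α := k α) (β := k β) huv (hk' _) (hk' _) (hk' _) (hk' _) hr2 e1
  rw [neg_add_cancel, ← hc] at e3
  rw [neg_add_cancel] at e2
  exact ⟨_, e2, e3, density_eq huv hut hvt (hk' _) (hk' _) (hk' _) (hk _) hr2 hm hu hv (r1 0) (r2 0)
    e2 hc e3⟩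

end DifferentialAlgebra

/-! ### The differential algebra of holomorphic functions on V -/

section HolomorphicAlgebra

/-- The algebra of the holomorphic functions on the open set `V ⊆ ℂ³`. -/
noncomputable def HoloAlg (V : Opens (ℂ × ℂ × ℂ)) : Subalgebra ℂ (V → ℂ) where
  carrier := {f | ∃ g : ℂ × ℂ × ℂ → ℂ, ContDiffOn ℂ ∞ g V ∧ ∀ q : V, f q = g q}
  mul_mem' := by
    rintro f₁ f₂ ⟨g₁, h₁, e₁⟩ ⟨g₂, h₂, e₂⟩
    exact ⟨fun q => g₁ q * g₂ q, h₁.mul h₂, fun q => by simp [e₁, e₂]⟩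
  add_mem' := by
    rintro f₁ f₂ ⟨g₁, h₁, e₁⟩ ⟨g₂, h₂, e₂⟩
    exact ⟨fun q => g₁ q + g₂ q, h₁.add h₂, fun q => by simp [e₁, e₂]⟩
  algebraMap_mem' := fun c => ⟨fun _ => c, contDiffOn_const, fun _ => rfl⟩

variable {V : Opens (ℂ × ℂ × ℂ)} {f g : ℂ × ℂ × ℂ → ℂ}

/-- A holomorphic function on `V`, as an element of the algebra. -/
def HoloAlg.ofFn (f : ℂ × ℂ × ℂ → ℂ) (hf : ContDiffOn ℂ ∞ f V) : HoloAlg V :=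
  ⟨fun q => f q, f, hf, fun _ => rfl⟩

/-- Evaluation at a point of `V`. -/
noncomputable def HoloAlg.ev (q : V) : HoloAlg V →ₐ[ℂ] ℂ :=
  (Pi.evalAlgHom ℂ (fun _ : V => ℂ) q).comp (HoloAlg V).val

theorem HoloAlg.ev_ofFn (q : V) (hf : ContDiffOn ℂ ∞ f V) : HoloAlg.ev q (HoloAlg.ofFn f hf) = f q := rfl

theorem HoloAlg.ext_ev {x y : HoloAlg V} (h : ∀ q, HoloAlg.ev q x = HoloAlg.ev q y) : x = y :=
  Subtype.ext (funext h)

theorem HoloAlg.ofFn_inj {hf : ContDiffOn ℂ ∞ f V} {hg : ContDiffOn ℂ ∞ g V} :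
    HoloAlg.ofFn f hf = HoloAlg.ofFn g hg ↔ ∀ p ∈ V, f p = g p :=
  ⟨fun h p hp => congrFun (congrArg Subtype.val h) ⟨p, hp⟩,
    fun h => Subtype.ext (funext fun q => h q q.2)⟩

theorem HoloAlg.exists_ofFn (x : HoloAlg V) : ∃ f, ∃ hf : ContDiffOn ℂ ∞ f V, x = HoloAlg.ofFn f hf := by
  obtain ⟨x, g, hg, e⟩ := x
  exact ⟨g, hg, Subtype.ext (funext e)⟩

/-- The partial derivative of an element of the algebra. -/
noncomputable def HoloAlg.pdFun (v : ℂ × ℂ × ℂ) (x : HoloAlg V) : HoloAlg V :=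
  HoloAlg.ofFn (pd v (HoloAlg.exists_ofFn x).choose) ((HoloAlg.exists_ofFn x).choose_spec.choose.pd V.isOpen v)

theorem HoloAlg.pdFun_ofFn (v : ℂ × ℂ × ℂ) (hf : ContDiffOn ℂ ∞ f V) :
    HoloAlg.pdFun v (HoloAlg.ofFn f hf) = HoloAlg.ofFn (pd v f) (hf.pd V.isOpen v) := by
  have h := (HoloAlg.exists_ofFn (HoloAlg.ofFn f hf)).choose_spec
  obtain ⟨h1, h2⟩ := h
  exact HoloAlg.ofFn_inj.2 fun p hp =>
    pd_congr V.isOpen (fun q hq => (HoloAlg.ofFn_inj.1 h2 q hq).symm) hp v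

/-- Partial derivatives as derivations. -/
noncomputable def HoloAlg.D (v : ℂ × ℂ × ℂ) : Derivation ℂ (HoloAlg V) (HoloAlg V) :=
  Derivation.mk'
    { toFun := HoloAlg.pdFun v
      map_add' := fun x y => by
        obtain ⟨f, hf, rfl⟩ := (HoloAlg.exists_ofFn x)
        obtain ⟨g, hg, rfl⟩ := (HoloAlg.exists_ofFn y)
        change HoloAlg.pdFun v (HoloAlg.ofFn (fun q => f q + g q) (hf.add hg)) = _
        simp only [HoloAlg.pdFun_ofFn]
        exact HoloAlg.ext_ev fun p => pd_add (hf.differentiableAt_of_isOpen V.isOpen p.2)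
          (hg.differentiableAt_of_isOpen V.isOpen p.2) v
      map_smul' := fun c x => by
        obtain ⟨f, hf, rfl⟩ := (HoloAlg.exists_ofFn x)
        change HoloAlg.pdFun v (HoloAlg.ofFn (fun q => c * f q) (contDiffOn_const.mul hf)) = _
        simp only [HoloAlg.pdFun_ofFn]
        exact HoloAlg.ext_ev fun p =>
          pd_const_mul (hf.differentiableAt_of_isOpen V.isOpen p.2) c v }
    fun x y => by
      obtain ⟨f, hf, rfl⟩ := (HoloAlg.exists_ofFn x)
      obtain ⟨g, hg, rfl⟩ := (HoloAlg.exists_ofFn y)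
      change HoloAlg.pdFun v (HoloAlg.ofFn (fun q => f q * g q) (hf.mul hg)) =
        HoloAlg.ofFn f hf * HoloAlg.pdFun v (HoloAlg.ofFn g hg) +
          HoloAlg.ofFn g hg * HoloAlg.pdFun v (HoloAlg.ofFn f hf)
      simp only [HoloAlg.pdFun_ofFn]
      refine (HoloAlg.ofFn_inj (hg := (hf.mul (hg.pd V.isOpen v)).add
        (hg.mul (hf.pd V.isOpen v)))).2 fun p hp => ?_
      have := pd_smul (hf.differentiableAt_of_isOpen V.isOpen hp)
        (hg.differentiableAt_of_isOpen V.isOpen hp) v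
      simp only [smul_eq_mul] at this
      rw [this]
      ring

theorem HoloAlg.D_ofFn (v : ℂ × ℂ × ℂ) (hf : ContDiffOn ℂ ∞ f V) :
    HoloAlg.D v (HoloAlg.ofFn f hf) = HoloAlg.ofFn (pd v f) (hf.pd V.isOpen v) :=
  HoloAlg.pdFun_ofFn v hf

theorem HoloAlg.D_comm (v w : ℂ × ℂ × ℂ) (x : HoloAlg V) :
    HoloAlg.D v (HoloAlg.D w x) = HoloAlg.D w (HoloAlg.D v x) := by
  obtain ⟨f, hf, rfl⟩ := (HoloAlg.exists_ofFn x)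
  simp only [HoloAlg.D_ofFn]
  exact HoloAlg.ofFn_inj.2 fun p hp => pd_comm V.isOpen hf hp v w

end HolomorphicAlgebra

/-- A continuous logarithm of a holomorphic function is holomorphic. -/
theorem contDiffOn_of_exp_neg {V : Set (ℂ × ℂ × ℂ)} (hV : IsOpen V) {s x : ℂ × ℂ × ℂ → ℂ}
    (hs : ContinuousOn s V) (hx : ContDiffOn ℂ ∞ x V) (h : ∀ p ∈ V, Complex.exp (-s p) = x p) :
    ContDiffOn ℂ ∞ s V := by
  intro p hp
  have hx0 : x p ≠ 0 := by rw [← h p hp]; exact Complex.exp_ne_zero _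
  -- Near `p` the principal logarithm of x(q)/x(p) equals s(p) - s(q): the quotient is close to 1,
  -- and by continuity of s the difference has imaginary part between -π and π.
  have hd : ContDiffAt ℂ ∞ (fun q => s p - Complex.log (x q / x p)) p := by
    refine contDiffAt_const.sub (ContDiffAt.comp p (Complex.contDiffAt_log ?_)
      ((hx.contDiffAt (hV.mem_nhds hp)).div_const _))
    rw [div_self hx0]
    exact Complex.one_mem_slitPlane
  refine (hd.congr_of_eventuallyEq ?_).contDiffWithinAt
  have hc : ContinuousAt (fun q => s p - s q) p :=
    continuousAt_const.sub (hs.continuousAt (hV.mem_nhds hp))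
  have hn : ∀ᶠ q in 𝓝 p, ‖s p - s q‖ < Real.pi := by
    refine hc.norm.eventually (gt_mem_nhds ?_)
    simpa using Real.pi_pos
  filter_upwards [hn, hV.mem_nhds hp] with q hq hqV
  have h1 : x q / x p = Complex.exp (s p - s q) := by
    rw [← h q hqV, ← h p hp, ← Complex.exp_sub]
    congr 1; ring
  have h2 := abs_lt.1 ((Complex.abs_im_le_norm _).trans_lt hq)
  rw [h1, Complex.log_exp h2.1 h2.2.le]
  ring

theorem pd_of_exp_neg {V : Set (ℂ × ℂ × ℂ)} (hV : IsOpen V) {s x : ℂ × ℂ × ℂ → ℂ}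
    (hs : ContDiffOn ℂ ∞ s V) (h : ∀ p ∈ V, Complex.exp (-s p) = x p) {p : ℂ × ℂ × ℂ} (hp : p ∈ V)
    (v : ℂ × ℂ × ℂ) : pd v x p = -(pd v s p * x p) := by
  rw [pd_congr hV (g := fun q => Complex.exp (-s q)) (fun q hq => (h q hq).symm) hp, pd,
    ((hs.differentiableAt_of_isOpen hV hp).hasFDerivAt.fun_neg.cexp).fderiv, ← h p hp]
  simp [pd, mul_comm]

/-! ### The system on V -/

section Solution

variable {U : Opens ℂ} {X : Type*} [NormedAddCommGroup X] [NormedSpace ℂ X] [CompleteSpace X]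
  {S : FunctionSpace U X} {R : CompactDistribution (kernelDomain U)} {a α β : ℂ}
  {B : Pairing S R} {F : ℂ × ℂ × ℂ → X →L[ℂ] X} {Ω : Set (ℂ × ℂ × ℂ)}

set_option maxHeartbeats 400000 in
open HoloAlg in
theorem exists_isSolution (H : DressingFamily B a α β F Ω) {V : Set (ℂ × ℂ × ℂ)}
    (hV : IsOpen V) (hVΩ : V ⊆ Ω) {s : ℂ × ℂ × ℂ → ℂ} (hs : ContinuousOn s V)
    (hexp : ∀ p ∈ V, Complex.exp (-s p) = 1 - coeff B a α β F (-1) p) :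
    ∃ Pi, IsSolution a α β V s
      (fun p => -Dv (coeff B a α β F 0) p - 1 / 2 * Du (Dv s) p) Pi := by
  lift V to Opens (ℂ × ℂ × ℂ) using hV
  have hw : ∀ n, ContDiffOn ℂ ∞ (coeff B a α β F n) V := fun n => (H.contDiffOn_coeff n).mono hVΩ
  have hx : ContDiffOn ℂ ∞ (fun p => 1 - coeff B a α β F (-1) p) V := contDiffOn_const.sub (hw _)
  have hs' : ContDiffOn ℂ ∞ s V := contDiffOn_of_exp_neg V.isOpen hs hx hexp
  -- In the directions u and v these are the hypotheses of the recursions, with σ = s_u and τ = s_v.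
  have hσ : ∀ v, ∀ p ∈ V, pd v (coeff B a α β F (-1)) p =
      pd v s p * (1 - coeff B a α β F (-1) p) := fun v p hp => by
    have := pd_of_exp_neg V.isOpen hs' hexp hp v
    rw [pd_const_sub] at this
    exact neg_injective this
  let w : ℤ → HoloAlg V := fun n => ofFn _ (hw n)
  let sA : HoloAlg V := ofFn s hs'
  let x : HoloAlg V := ofFn _ hx
  let y : HoloAlg V := ofFn (fun p => Complex.exp (s p)) hs'.cexp
  let k : ℂ → HoloAlg V := algebraMap ℂ (HoloAlg V)
  have hk : ∀ z v, D v (k z) = 0 := fun z v => (D v).map_algebraMap z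
  have hxy : x * y = 1 := ext_ev fun q => by
    simp only [map_mul, map_one, x, y, ev_ofFn, ← hexp q q.2, ← Complex.exp_add]
    simp
  have hm : w (-1) = 1 - x := ext_ev fun q => by
    simp only [map_sub, map_one, x, w, ev_ofFn]; ring
  have hxs : ∀ v, D v x = -(D v sA * x) := fun v => ext_ev fun q => by
    simp only [map_neg, map_mul, x, sA, D_ofFn, ev_ofFn]
    exact pd_of_exp_neg V.isOpen hs' hexp q.2 v
  have r1 : ∀ n, D eU (D eV (w n)) + k a * D eU (w (n - 1)) + D eV (w (n + 1)) + k a * w n +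
      D eU sA * (D eV (w n) + k a * w (n - 1)) = (k a + D eV (w 0)) * w n := fun n =>
    ext_ev fun q => by
      simp only [map_add, map_mul, w, sA, k, D_ofFn, ev_ofFn, AlgHomClass.commutes]
      exact H.coeff_space n (hVΩ q.2) (hσ eU q q.2)
  have r2 : ∀ n, D eT (w n) = k α * (D eU (D eU (w n)) + 2 * D eU (w (n + 1))) +
      k β * (D eV (D eV (w n)) + 2 * k a * D eV (w (n - 1))) +
      2 * k β * D eV sA * (D eV (w n) + k a * w (n - 1)) - 2 * k α * D eU (w 0) * w n := fun n =>
    ext_ev fun q => by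
      simp only [map_add, map_sub, map_mul, map_ofNat, w, sA, k, D_ofFn, ev_ofFn, AlgHomClass.commutes]
      exact H.coeff_time n (hVΩ q.2) (hσ eV q q.2)
  have hr2 : 2 * k (1 / 2) = 1 := ext_ev fun q => by
    simp only [map_mul, map_ofNat, map_one, k, AlgHomClass.commutes]
    simp
  obtain ⟨q, e2, e3, e4⟩ := exists_potential (k := k)
    (fun z => ⟨hk z eU, hk z eV, hk z eT⟩) hr2 (fun f => D_comm eV eU f)
    (fun f => D_comm eT eU f) (fun f => D_comm eT eV f) hxy hm (hxs eU) (hxs eV) (hxs eT) r1 r2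
    rfl
  obtain ⟨Pi, hPi, rfl⟩ := exists_ofFn q
  have hc : ContDiffOn ℂ ∞ (fun p => -Dv (coeff B a α β F 0) p - 1 / 2 * Du (Dv s) p) V :=
    ((hw 0).pd V.isOpen eV).neg.sub (contDiffOn_const.mul ((hs'.pd V.isOpen eV).pd V.isOpen eU))
  have ec : -D eV (w 0) - k (1 / 2) * D eU (D eV sA) = ofFn _ hc := ext_ev fun q => by
    simp only [map_sub, map_neg, map_mul, w, sA, k, D_ofFn, ev_ofFn, AlgHomClass.commutes]
    rfl
  have hm' : ∀ f g (hf : ContDiffOn ℂ ∞ f V) (hg : ContDiffOn ℂ ∞ g V),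
      ofFn f hf * ofFn g hg = ofFn (fun q => f q * g q) (hf.mul hg) := fun _ _ _ _ => rfl
  rw [ec] at e3 e4
  refine ⟨Pi, hs'.differentiableOn (by simp), hc.differentiableOn (by simp),
    hPi.differentiableOn (by simp), fun p hp => ?_, fun p hp => ?_, fun p hp => ?_⟩
  · have := congrArg (ev ⟨p, hp⟩) e2
    simp only [map_add, map_sub, map_mul, map_pow, map_zero, sA, k, D_ofFn, ev_ofFn,
      AlgHomClass.commutes] at this
    exact this
  · have := congrArg (ev ⟨p, hp⟩) e4
    simp only [map_add, map_sub, map_mul, map_zero, map_ofNat, sA, k, D_ofFn, hm', ev_ofFn,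
      AlgHomClass.commutes] at this
    exact this
  · have := congrArg (ev ⟨p, hp⟩) e3
    simp only [map_sub, map_mul, map_ofNat, k, D_ofFn, ev_ofFn,
      AlgHomClass.commutes] at this
    exact this

end Solution

/-! ### The Cauchy transform of a compactly supported distribution -/

section CauchyDistribution

/-- A continuous function on `W` times a test function supported in `W` is integrable. -/
theorem integrable_mul_test {e : ℂ → ℂ} {W : Set ℂ} (he : ContinuousOn e W)
    (ψ : 𝓓((⊤ : Opens ℂ), ℂ)) (hψ : tsupport ψ ⊆ W) : Integrable fun l => e l * ψ l := by
  have h1 : IntegrableOn (fun l => e l * ψ l) (tsupport ψ) :=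
    ((he.mono hψ).mul ψ.continuous.continuousOn).integrableOn_compact ψ.hasCompactSupport
  refine (integrableOn_iff_integrable_of_support_subset fun l hl => ?_).1 h1
  by_contra hn
  exact hl (by simp [image_eq_zero_of_notMem_tsupport hn])

theorem integrable_test (ψ : 𝓓((⊤ : Opens ℂ), ℂ)) : Integrable ψ :=
  ψ.continuous.integrable_of_hasCompactSupport ψ.hasCompactSupport

theorem CompactDistribution.exists_norm_le_of_differentiableOn
    (Λ : CompactDistribution puncturedPlane) : ∃ (K : Set ℂ) (C : ℝ), IsCompact K ∧
      K ⊆ puncturedPlane ∧ 0 ≤ C ∧ ∀ (f : SmoothFn puncturedPlane) (M : ℝ), 0 ≤ M →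
        DifferentiableOn ℂ (f : ℂ → ℂ) K → (∀ z ∈ K, ‖(f : ℂ → ℂ) z‖ ≤ M) →
          ‖Λ.toLin f‖ ≤ C * M := by
  obtain ⟨K, hK, hK0, N, C, hb⟩ := Λ.bound
  obtain ⟨K', hK', hK'0, h⟩ := exists_compact_norm_iteratedFDeriv_le hK puncturedPlane.isOpen hK0
  obtain ⟨C', hC', h⟩ := h N
  refine ⟨K', |C| * C', hK', hK'0, by positivity, fun f M hM hf hfM => ?_⟩
  refine (hb f (C' * M) (by positivity) (h f M hM hf hfM)).trans ?_
  calc C * (C' * M) ≤ |C| * (C' * M) := by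
        gcongr
        exact le_abs_self C
    _ = _ := by ring

theorem norm_integral_test_le {K : Set ℂ} (hK : IsCompact K) (ψ : 𝓓((⊤ : Opens ℂ), ℂ)) {M : ℝ}
    (hψ : tsupport ψ ⊆ K) (h : ∀ z, ‖ψ z‖ ≤ M) : ‖∫ l, ψ l‖ ≤ M * volume.real K := by
  rw [← setIntegral_eq_integral_of_forall_compl_eq_zero (s := K) fun z hz =>
    image_eq_zero_of_notMem_tsupport fun hz' => hz (hψ hz')]
  exact norm_setIntegral_le_of_norm_le_const hK.measure_lt_top fun z _ => h z

theorem cauchy_add (ψ₁ ψ₂ : 𝓓((⊤ : Opens ℂ), ℂ)) : cauchy (ψ₁ + ψ₂) = cauchy ψ₁ + cauchy ψ₂ :=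
  Subtype.ext (funext fun ζ => cauchyFn_add ψ₁.continuous ψ₁.hasCompactSupport ψ₂.continuous
    ψ₂.hasCompactSupport ζ)

theorem cauchy_smul (c : ℂ) (ψ : 𝓓((⊤ : Opens ℂ), ℂ)) : cauchy (c • ψ) = c • cauchy ψ :=
  Subtype.ext (funext fun ζ => cauchyFn_const_mul (f := ψ) c ζ)

/-- The linear form `ψ ↦ ∬ ψ + Λ(C ψ)`, where `C` is the Cauchy transform. -/
noncomputable def cauchyLin (Λ : CompactDistribution puncturedPlane) :
    𝓓((⊤ : Opens ℂ), ℂ) →ₗ[ℂ] ℂ where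
  toFun ψ := (∫ l, ψ l) + Λ.toLin (cauchy ψ)
  map_add' ψ₁ ψ₂ := by
    have : ∫ l, (ψ₁ + ψ₂) l = (∫ l, ψ₁ l) + ∫ l, ψ₂ l :=
      integral_add (integrable_test ψ₁) (integrable_test ψ₂)
    rw [cauchy_add, map_add, this]
    ring
  map_smul' c ψ := by
    have : ∫ l, (c • ψ) l = c * ∫ l, ψ l := integral_const_mul c ψ
    rw [cauchy_smul, map_smul, this, smul_eq_mul, RingHom.id_apply, smul_eq_mul]
    ring

theorem continuous_cauchyLin (Λ : CompactDistribution puncturedPlane) :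
    Continuous (cauchyLin Λ) := by
  refine exists_distr_of_bound _ fun K hK _ => ?_
  obtain ⟨K₂, hK₂, -, N, C, hb⟩ := Λ.bound
  obtain ⟨C₁, hC₁, h₁⟩ := exists_norm_iteratedFDeriv_cauchyFn_le hK hK₂
  refine ⟨N, volume.real K + |C| * C₁, by positivity, fun ψ M hM hψ hψM => ?_⟩
  have h2 := norm_integral_test_le hK ψ hψ fun z => by simpa using hψM z 0 (Nat.zero_le _)
  have h3 := hb (cauchy ψ) (C₁ * M) (by positivity) fun z hz j hj =>
    h₁ ψ M j ψ.contDiff hψ hM (fun z => hψM z j hj) z hz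
  have h4 : C * (C₁ * M) ≤ |C| * (C₁ * M) := by
    gcongr
    exact le_abs_self C
  refine (norm_add_le _ _).trans ?_
  linarith

/-- The distribution `1 + (1/π) ∬ Λ(ζ) / (λ - ζ) dA(ζ)`. -/
noncomputable def cauchyDistr (Λ : CompactDistribution puncturedPlane) : Distr ⊤ :=
  ⟨cauchyLin Λ, continuous_cauchyLin Λ⟩

theorem cauchyDistr_apply (Λ : CompactDistribution puncturedPlane) (ψ : 𝓓((⊤ : Opens ℂ), ℂ)) :
    cauchyDistr Λ ψ = (∫ l, ψ l) + Λ.toLin (cauchy ψ) := rfl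

/-- The Cauchy transform of ∂̄ψ is -ψ, and the integral of ∂̄ψ is 0, so the constant 1 contributes
nothing. -/
theorem cauchyDistr_dbarTest (Λ : CompactDistribution puncturedPlane) (ψ : 𝓓((⊤ : Opens ℂ), ℂ)) :
    -cauchyDistr Λ (dbarTest ψ) =
      Λ.toLin ⟨ψ, (ψ.contDiff.contDiffOn : ContDiffOn ℝ ∞ ψ _)⟩ := by
  have h1 : ContDiff ℝ 1 ψ := ψ.contDiff.of_le (by exact_mod_cast le_top)
  have h2 : (dbarTest ψ : ℂ → ℂ) = dbar ψ := funext (dbarTest_apply ψ)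
  have h3 : cauchy (dbarTest ψ) =
      -(⟨ψ, (ψ.contDiff.contDiffOn : ContDiffOn ℝ ∞ ψ _)⟩ : SmoothFn puncturedPlane) :=
    Subtype.ext (funext fun ζ => by
      rw [cauchy_apply, h2, cauchyFn_dbar h1 ψ.hasCompactSupport]
      rfl)
  rw [cauchyDistr_apply, h3, map_neg, h2, integral_dbar h1 ψ.hasCompactSupport]
  ring

/-- Expansion of the Cauchy kernel inside a compactly supported distribution. -/
theorem hasSum_cauchyKernel {Λ : CompactDistribution puncturedPlane} {K W : Set ℂ} {C q D : ℝ}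
    (hK0 : K ⊆ puncturedPlane)
    (hb : ∀ (f : SmoothFn puncturedPlane) (M : ℝ), 0 ≤ M →
      DifferentiableOn ℂ (f : ℂ → ℂ) K → (∀ z ∈ K, ‖(f : ℂ → ℂ) z‖ ≤ M) → ‖Λ.toLin f‖ ≤ C * M)
    {e b : ℕ → ℂ → ℂ} (he : ∀ n, ContinuousOn (e n) W)
    (hbd : ∀ n, DifferentiableOn ℂ (b n) {0}ᶜ) (hKW : Disjoint K W) (hq : 0 ≤ q) (hq1 : q < 1)
    (hD : 0 ≤ D) (hterm : ∀ l ∈ W, ∀ ζ ∈ K, ∀ n, ‖e n l * b n ζ‖ ≤ D * q ^ n)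
    (hrem : ∀ l ∈ W, ∀ ζ ∈ K, ∀ N,
      ‖1 / (l - ζ) - ∑ n ∈ Finset.range N, e n l * b n ζ‖ ≤ D * q ^ N) :
    ∃ h : ℂ → ℂ, ContinuousOn h W ∧
      (∀ l, h l = ∑' n, 1 / (Real.pi : ℂ) * Λ.toLin (holoFn (b n) (hbd n)) * e n l) ∧
      (∀ l ∈ W, ∀ n, ‖1 / (Real.pi : ℂ) * Λ.toLin (holoFn (b n) (hbd n)) * e n l‖ ≤
        ‖1 / (Real.pi : ℂ)‖ * (C * D) * q ^ n) ∧
      ∀ ψ : 𝓓((⊤ : Opens ℂ), ℂ), tsupport ψ ⊆ W → Λ.toLin (cauchy ψ) = ∫ l, h l * ψ l := by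
  set c : ℂ := 1 / (Real.pi : ℂ) with hc
  set A : ℕ → ℂ := fun n => Λ.toLin (holoFn (b n) (hbd n)) with hA
  have hsum : Summable fun n => ‖c‖ * (C * D) * q ^ n :=
    (summable_geometric_of_lt_one hq hq1).mul_left _
  have hbound : ∀ l ∈ W, ∀ n, ‖c * A n * e n l‖ ≤ ‖c‖ * (C * D) * q ^ n := fun l hl n => by
    have h1 := hb (e n l • holoFn (b n) (hbd n)) (D * q ^ n) (by positivity)
      (((hbd n).mono hK0).const_smul (e n l)) fun ζ hζ => hterm l hl ζ hζ n
    rw [map_smul, smul_eq_mul] at h1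
    calc ‖c * A n * e n l‖ = ‖c‖ * ‖e n l * A n‖ := by rw [← norm_mul]; congr 1; ring
      _ ≤ ‖c‖ * (C * (D * q ^ n)) := by gcongr
      _ = _ := by ring
  refine ⟨fun l => ∑' n, c * A n * e n l, continuousOn_tsum
    (fun n => continuousOn_const.mul (he n)) hsum fun n l hl => hbound l hl n, fun _ => rfl, hbound,
    fun ψ hψ => ?_⟩
  have hint : ∀ n, Integrable fun l => e n l * ψ l := fun n => integrable_mul_test (he n) ψ hψ
  have hint' : ∀ n, Integrable fun l => c * A n * (e n l * ψ l) := fun n => (hint n).const_mul _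
  have hzero : ∀ l ∉ W, ψ l = 0 := fun l hl =>
    image_eq_zero_of_notMem_tsupport fun hl' => hl (hψ hl')
  have hF : ∀ n l, ‖c * A n * (e n l * ψ l)‖ ≤ ‖c‖ * (C * D) * q ^ n * ‖ψ l‖ := fun n l => by
    by_cases hl : l ∈ W
    · rw [← mul_assoc, norm_mul]
      gcongr
      exact hbound l hl n
    · simp [hzero l hl]
  have hs1 : Summable fun n => ∫ l, ‖c * A n * (e n l * ψ l)‖ := by
    refine Summable.of_nonneg_of_le (fun n => integral_nonneg fun _ => norm_nonneg _) (fun n => ?_)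
      (hsum.mul_right (∫ l, ‖ψ l‖))
    rw [← integral_const_mul]
    exact integral_mono (hint' n).norm ((integrable_test ψ).norm.const_mul _) (hF n)
  have hlim := (hasSum_integral_of_summable_integral_norm hint' hs1).tendsto_sum_nat
  have he1 : ∫ l, ∑' n, c * A n * (e n l * ψ l) = ∫ l, (∑' n, c * A n * e n l) * ψ l := by
    refine integral_congr_ae (ae_of_all _ fun l => ?_)
    simp only [← tsum_mul_right, mul_assoc]
  rw [he1] at hlim
  refine tendsto_nhds_unique ?_ hlim
  rw [tendsto_iff_norm_sub_tendsto_zero]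
  have hgeo : Tendsto (fun N => C * (‖c‖ * (D * q ^ N * ∫ l, ‖ψ l‖))) atTop (𝓝 0) := by
    have := tendsto_pow_atTop_nhds_zero_of_lt_one hq hq1
    simpa using (((this.const_mul D).mul_const (∫ l, ‖ψ l‖)).const_mul ‖c‖).const_mul C
  refine squeeze_zero (fun _ => norm_nonneg _) (fun N => ?_) hgeo
  -- `f` is minus the truncation error of the kernel integrated against ψ. As ψ vanishes on `K`, its
  -- Cauchy transform is complex differentiable there, so the sup bound `hb` applies.
  set f : SmoothFn puncturedPlane := ∑ n ∈ Finset.range N,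
    (c * ∫ l, e n l * ψ l) • holoFn (b n) (hbd n) - cauchy ψ with hf
  have hfΛ : (∑ n ∈ Finset.range N, ∫ l, c * A n * (e n l * ψ l)) - Λ.toLin (cauchy ψ) =
      Λ.toLin f := by
    rw [hf, map_sub, map_sum]
    congr 1
    refine Finset.sum_congr rfl fun n _ => ?_
    rw [map_smul, smul_eq_mul, integral_const_mul]
    simp only [hA]
    ring
  have hfz : ∀ ζ, (f : ℂ → ℂ) ζ =
      (∑ n ∈ Finset.range N, (c * ∫ l, e n l * ψ l) * b n ζ) - cauchyFn ψ ζ := fun ζ => by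
    rw [hf]
    simp only [Submodule.coe_sub, Submodule.coe_sum, Submodule.coe_smul, Pi.sub_apply,
      Finset.sum_apply, Pi.smul_apply, smul_eq_mul, holoFn_apply, cauchy_apply]
  rw [hfΛ]
  have hψ1 : ContDiff ℝ 1 ψ := ψ.contDiff.of_le (by exact_mod_cast le_top)
  have hnot : ∀ ζ ∈ K, ψ ζ = 0 := fun ζ hζ => hzero ζ (Set.disjoint_left.1 hKW hζ)
  refine hb f _ (by positivity) ?_ fun ζ hζ => ?_
  · have : (f : ℂ → ℂ) = fun ζ =>
      (∑ n ∈ Finset.range N, (c * ∫ l, e n l * ψ l) * b n ζ) - cauchyFn ψ ζ := funext hfz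
    rw [this]
    refine DifferentiableOn.sub (DifferentiableOn.fun_sum fun n _ =>
      ((hbd n).mono hK0).const_mul _) fun ζ hζ => DifferentiableAt.differentiableWithinAt ?_
    refine differentiableAt_of_dbar_eq_zero
      ((contDiff_cauchyFn ψ.contDiff ψ.hasCompactSupport).differentiable (by simp) ζ) ?_
    rw [dbar_cauchyFn hψ1 ψ.hasCompactSupport, hnot ζ hζ, neg_zero]
  · have hi1 := integrable_div_sub ψ.continuous ψ.hasCompactSupport ζ
    have hi2 : ∀ n ∈ Finset.range N, Integrable fun l => e n l * ψ l * b n ζ := fun n _ =>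
      (hint n).mul_const _
    have h1 : (f : ℂ → ℂ) ζ =
        -(c * ∫ l, (1 / (l - ζ) - ∑ n ∈ Finset.range N, e n l * b n ζ) * ψ l) := by
      have h2 : (fun l => (1 / (l - ζ) - ∑ n ∈ Finset.range N, e n l * b n ζ) * ψ l) =
          fun l => ψ l / (l - ζ) - ∑ n ∈ Finset.range N, e n l * ψ l * b n ζ := by
        funext l
        rw [sub_mul, Finset.sum_mul]
        congr 1
        · ring
        · exact Finset.sum_congr rfl fun n _ => by ring
      rw [hfz, h2, integral_sub hi1 (integrable_finsetSum _ hi2), integral_finsetSum _ hi2, cauchyFn,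
        mul_sub, Finset.mul_sum, neg_sub]
      congr 1
      refine Finset.sum_congr rfl fun n _ => ?_
      rw [integral_mul_const]
      ring
    rw [h1, norm_neg, norm_mul]
    gcongr
    rw [← integral_const_mul]
    refine norm_integral_le_of_norm_le ((integrable_test ψ).norm.const_mul _)
      (ae_of_all _ fun l => ?_)
    by_cases hl : l ∈ W
    · rw [norm_mul]
      gcongr
      exact hrem l hl ζ hζ N
    · simp [hzero l hl]

end CauchyDistribution

/-! ### Expansions at infinity and at zero -/

section Expansions

theorem cauchyKernel_geometric {l ζ : ℂ} (hl : l ≠ 0) (hlζ : l - ζ ≠ 0) (N : ℕ) :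
    1 / (l - ζ) - ∑ n ∈ Finset.range N, l⁻¹ ^ (n + 1) * ζ ^ n = (ζ * l⁻¹) ^ N * (1 / (l - ζ)) := by
  induction N with
  | zero => simp
  | succ N ih =>
    have h1 : l⁻¹ ^ (N + 1) * ζ ^ N = (ζ * l⁻¹) ^ N * l⁻¹ := by rw [mul_pow, pow_succ]; ring
    rw [Finset.sum_range_succ, ← sub_sub, ih, h1, pow_succ]
    generalize (ζ * l⁻¹) ^ N = w
    field_simp
    ring

theorem norm_cauchyKernel_geometric {l ζ : ℂ} {ρ : ℝ} (hρ : 0 < ρ) (h : 2 * ‖ζ‖ ≤ ‖l‖)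
    (h2 : ρ ≤ ‖l - ζ‖) (hl : l ≠ 0) (N : ℕ) :
    ‖1 / (l - ζ) - ∑ n ∈ Finset.range N, l⁻¹ ^ (n + 1) * ζ ^ n‖ ≤ 1 / ρ * (1 / 2) ^ N := by
  have h0 : 0 < ‖l‖ := norm_pos_iff.2 hl
  have hlζ : l - ζ ≠ 0 := norm_pos_iff.1 (hρ.trans_le h2)
  rw [cauchyKernel_geometric hl hlζ, norm_mul, norm_pow, mul_comm, norm_div, norm_one, norm_mul,
    norm_inv]
  gcongr
  rw [← div_eq_mul_inv, div_le_div_iff₀ h0 two_pos]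
  linarith

theorem norm_pow_mul_pow_le {l ζ : ℂ} {ρ : ℝ} (hρ : 0 < ρ) (h : 2 * ‖ζ‖ ≤ ‖l‖) (hl : ρ ≤ ‖l‖)
    (n : ℕ) : ‖l⁻¹ ^ (n + 1) * ζ ^ n‖ ≤ 1 / ρ * (1 / 2) ^ n := by
  have h0 : 0 < ‖l‖ := hρ.trans_le hl
  have : l⁻¹ ^ (n + 1) * ζ ^ n = l⁻¹ * (ζ * l⁻¹) ^ n := by rw [mul_pow, pow_succ]; ring
  rw [this, norm_mul, norm_pow, norm_mul, norm_inv, inv_eq_one_div]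
  gcongr
  rw [one_div, ← div_eq_mul_inv, div_le_div_iff₀ h0 two_pos]
  linarith

theorem representedOn_one_add {Λ : CompactDistribution puncturedPlane} {h : ℂ → ℂ} {W : Set ℂ}
    (hc : ContinuousOn h W) (h1 : ∀ ψ : 𝓓((⊤ : Opens ℂ), ℂ), tsupport ψ ⊆ W →
      Λ.toLin (cauchy ψ) = ∫ l, h l * ψ l) :
    RepresentedOn (cauchyDistr Λ) (fun l => 1 + h l) W := by
  refine ⟨continuousOn_const.add hc, fun ψ hψ => ?_⟩
  simp only [add_mul, one_mul]
  rw [integral_add (integrable_test ψ) (integrable_mul_test hc ψ hψ), cauchyDistr_apply, h1 ψ hψ]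

/-- The moment `(1/π) ∬ ζⁿ Λ(ζ) dA(ζ)`. -/
noncomputable def CompactDistribution.moment (Λ : CompactDistribution puncturedPlane) (n : ℤ) : ℂ :=
  1 / (Real.pi : ℂ) * Λ.toLin (holoFn _ (differentiableOn_zpow_punctured n))

/-- Where |l| exceeds twice the radius of a disc containing `K`, 1/(l - ζ) = ∑ l⁻ⁿ⁻¹ζⁿ has ratio at
most 1/2; the power l⁻ⁿ thus carries the moment of index n - 1. -/
theorem cauchyDistr_expansion_infty (Λ : CompactDistribution puncturedPlane) :
    ∃ (h : ℂ → ℂ) (r : ℝ), 0 < r ∧ RepresentedOn (cauchyDistr Λ) h {l | r < ‖l‖} ∧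
      (∀ l : ℂ, r < ‖l‖ →
        HasSum (fun n : ℕ => (if n = 0 then 1 else Λ.moment (n - 1)) * l⁻¹ ^ n) (h l)) ∧
      Tendsto h (cocompact ℂ) (𝓝 1) := by
  obtain ⟨K, C, hK, hK0, hC, hb⟩ := Λ.exists_norm_le_of_differentiableOn
  obtain ⟨ρ₀, hρ₀⟩ := hK.isBounded.exists_norm_le
  set ρ : ℝ := |ρ₀| + 1
  have hρ : 0 < ρ := by positivity
  have hKρ : ∀ ζ ∈ K, ‖ζ‖ ≤ ρ := fun ζ hζ =>
    (hρ₀ ζ hζ).trans ((le_abs_self _).trans (by simp [ρ]))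
  have hW : ∀ l : ℂ, 2 * ρ < ‖l‖ → l ≠ 0 := fun l hl =>
    norm_pos_iff.1 (lt_trans (by positivity) hl)
  have hinv : ContinuousOn (fun l : ℂ => l⁻¹) {l | 2 * ρ < ‖l‖} := fun l hl =>
    (continuousAt_inv₀ (hW l hl)).continuousWithinAt
  obtain ⟨h, hcont, hh, hbd, hrep⟩ := hasSum_cauchyKernel (W := {l : ℂ | 2 * ρ < ‖l‖})
    (q := 1 / 2) (D := 1 / ρ) hK0 hb (e := fun n l => l⁻¹ ^ (n + 1)) (b := fun n ζ => ζ ^ (n : ℤ))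
    (fun n => hinv.pow (n + 1)) (fun n => differentiableOn_zpow_punctured n)
    (Set.disjoint_left.2 fun ζ hζ hζ' => by
      have := hKρ ζ hζ
      have h2 : 2 * ρ < ‖ζ‖ := hζ'
      linarith) (by norm_num) (by norm_num) (by positivity)
    (fun l hl ζ hζ n => by
      have h1 := hKρ ζ hζ
      have h2 : 2 * ρ < ‖l‖ := hl
      simp only [zpow_natCast]
      exact norm_pow_mul_pow_le hρ (by linarith) (by linarith) n)
    (fun l hl ζ hζ N => by
      have h1 := hKρ ζ hζ
      have h2 : 2 * ρ < ‖l‖ := hl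
      have h3 := norm_sub_norm_le l ζ
      simp only [zpow_natCast]
      exact norm_cauchyKernel_geometric hρ (by linarith) (by linarith) (hW l hl) N)
  have hgeo : Summable fun n : ℕ => ‖1 / (Real.pi : ℂ)‖ * (C * (1 / ρ)) * (1 / 2 : ℝ) ^ n :=
    (summable_geometric_of_lt_one (by norm_num) (by norm_num)).mul_left _
  refine ⟨fun l => 1 + h l, 2 * ρ, by positivity, representedOn_one_add hcont hrep,
    fun l hl => ?_, ?_⟩
  · rw [← hasSum_nat_add_iff' 1]
    have hs : Summable _ := Summable.of_norm_bounded hgeo (hbd l hl)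
    have := hs.hasSum
    rw [← hh l] at this
    simp only [Finset.sum_range_one, if_true, pow_zero, mul_one, add_sub_cancel_left,
      Nat.succ_ne_zero, if_false, Nat.cast_add, Nat.cast_one, add_sub_cancel_right]
    exact this
  · have h0 : Tendsto h (cocompact ℂ) (𝓝 (∑' _ : ℕ, 0)) := by
      rw [show h = _ from funext hh]
      refine tendsto_tsum_of_dominated_convergence hgeo (fun n => ?_) ?_
      · have h1 : Tendsto (fun l : ℂ => l⁻¹) (cocompact ℂ) (𝓝 0) := by
          rw [← Metric.cobounded_eq_cocompact]
          exact tendsto_inv₀_cobounded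
        simpa using (h1.pow (n + 1)).const_mul
          (1 / (Real.pi : ℂ) * Λ.toLin (holoFn _ (differentiableOn_zpow_punctured n)))
      · filter_upwards [(tendsto_norm_cocompact_atTop (E := ℂ)).eventually_gt_atTop (2 * ρ)]
          with l hl n using hbd l hl n
    simpa using h0.const_add 1

/-- The same series with l and ζ exchanged, since `K` keeps away from 0: 1/(l - ζ) = -∑ lⁿζ⁻ⁿ⁻¹,
whence the sign and the negative indices. -/
theorem cauchyDistr_expansion_zero (Λ : CompactDistribution puncturedPlane) :
    ∃ (h : ℂ → ℂ) (r : ℝ), 0 < r ∧ RepresentedOn (cauchyDistr Λ) h {l | ‖l‖ < r} ∧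
      ∀ l : ℂ, ‖l‖ < r →
        HasSum (fun n : ℕ => ((if n = 0 then 1 else 0) - Λ.moment (-n - 1)) * l ^ n) (h l) := by
  obtain ⟨K, C, hK, hK0, hC, hb⟩ := Λ.exists_norm_le_of_differentiableOn
  obtain ⟨ρ₀, hρ₀, hball⟩ := Metric.isOpen_iff.1 hK.isClosed.isOpen_compl 0
    (fun h => hK0 h rfl)
  set ρ : ℝ := ρ₀ / 2 with hρdef
  have hρ : 0 < ρ := by positivity
  have hKρ : ∀ ζ ∈ K, 2 * ρ ≤ ‖ζ‖ := fun ζ hζ => by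
    by_contra hlt
    exact hball (by simp only [mem_ball_zero_iff]; linarith) hζ
  have hKne : ∀ ζ ∈ K, ζ ≠ 0 := fun ζ hζ => hK0 hζ
  obtain ⟨h, hcont, hh, hbd, hrep⟩ := hasSum_cauchyKernel (W := {l : ℂ | ‖l‖ < ρ})
    (q := 1 / 2) (D := 1 / ρ) hK0 hb (e := fun n l => -l ^ n) (b := fun n ζ => ζ ^ (-(n : ℤ) - 1))
    (fun n => (continuousOn_id.pow n).neg) (fun n => differentiableOn_zpow_punctured _)
    (Set.disjoint_left.2 fun ζ hζ hζ' => by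
      have := hKρ ζ hζ
      have h2 : ‖ζ‖ < ρ := hζ'
      linarith) (by norm_num) (by norm_num) (by positivity)
    (fun l hl ζ hζ n => by
      have h1 := hKρ ζ hζ
      have h2 : ‖l‖ < ρ := hl
      have h3 := norm_pow_mul_pow_le (l := ζ) (ζ := l) hρ (by linarith) (by linarith) n
      have h4 : ζ ^ (-(n : ℤ) - 1) = ζ⁻¹ ^ (n + 1) := by
        rw [← neg_add', zpow_neg, inv_pow]; norm_cast
      rw [h4, neg_mul, norm_neg, mul_comm]
      exact h3)
    (fun l hl ζ hζ N => by
      have h1 := hKρ ζ hζ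
      have h2 : ‖l‖ < ρ := hl
      have h3 := norm_sub_norm_le ζ l
      have h5 := norm_cauchyKernel_geometric (l := ζ) (ζ := l) hρ (by linarith) (by linarith)
        (hKne ζ hζ) N
      have h4 : ∀ n : ℕ, ζ ^ (-(n : ℤ) - 1) = ζ⁻¹ ^ (n + 1) := fun n => by
        rw [← neg_add', zpow_neg, inv_pow]; norm_cast
      have h6 : ∑ n ∈ Finset.range N, -l ^ n * ζ ^ (-(n : ℤ) - 1) =
          -∑ n ∈ Finset.range N, ζ⁻¹ ^ (n + 1) * l ^ n := by
        rw [← Finset.sum_neg_distrib]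
        exact Finset.sum_congr rfl fun n _ => by rw [h4]; ring
      rw [← norm_neg] at h5
      rw [h6, ← neg_sub ζ l, one_div_neg_eq_neg_one_div]
      refine (congrArg norm ?_).trans_le h5
      ring)
  have hgeo : Summable fun n : ℕ => ‖1 / (Real.pi : ℂ)‖ * (C * (1 / ρ)) * (1 / 2 : ℝ) ^ n :=
    (summable_geometric_of_lt_one (by norm_num) (by norm_num)).mul_left _
  refine ⟨fun l => 1 + h l, ρ, hρ, representedOn_one_add hcont hrep, fun l hl => ?_⟩
  have hs : Summable _ := Summable.of_norm_bounded hgeo (hbd l hl)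
  have h1 := hs.hasSum
  rw [← hh l] at h1
  convert (hasSum_ite_eq 0 (1 : ℂ)).add h1 using 2 with n
  by_cases hn : n = 0
  · simp [hn, CompactDistribution.moment, sub_eq_add_neg]
  · simp [hn, CompactDistribution.moment]

end Expansions

/-! ### Integral equation and ∂̄-problem -/

section Equation

variable {U : Opens ℂ} {X : Type*} [NormedAddCommGroup X] [NormedSpace ℂ X]
  {S : FunctionSpace U X} {R : CompactDistribution (kernelDomain U)} {a α β : ℂ}

variable (a α β) in
/-- Multiplication by `exp(-φ)`. -/
noncomputable def expNegPhaseMul (p : ℂ × ℂ × ℂ) :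
    SmoothFn puncturedPlane →ₗ[ℂ] SmoothFn puncturedPlane where
  toFun f := ⟨fun l => Complex.exp (-phase a α β p l) * (f : ℂ → ℂ) l,
    ContDiffOn.mul (contDiffOn_of_punctured le_rfl (differentiableOn_phase a α β p).neg.cexp) f.2⟩
  map_add' _ _ := Subtype.ext (funext fun _ => mul_add _ _ _)
  map_smul' c _ := Subtype.ext (funext fun _ => mul_left_comm _ c _)

variable (a α β) in
/-- The right-hand side of the `∂̄`-problem, as a compactly supported distribution. -/
noncomputable def Pairing.sourceDistr (B : Pairing S R) (p : ℂ × ℂ × ℂ) (x : X) :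
    CompactDistribution puncturedPlane where
  toLin := (B.toFun (S.mul _ (differentiableOn_phase a α β p).cexp x)).comp (expNegPhaseMul a α β p)
  bound := by
    obtain ⟨K, hK, hK0, N, C, hb⟩ := B.bound
    have hg : ContDiffOn ℝ ∞ (fun l => Complex.exp (-phase a α β p l)) (puncturedPlane : Set ℂ) :=
      contDiffOn_of_punctured le_rfl (differentiableOn_phase a α β p).neg.cexp
    obtain ⟨C₁, hC₁, h₁⟩ := exists_norm_iteratedFDeriv_mul_le puncturedPlane.isOpen hK hK0 hg N
    set y := S.mul _ (differentiableOn_phase a α β p).cexp x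
    refine ⟨K, hK, hK0, N, C * ‖y‖ * C₁, fun f M hM hf => ?_⟩
    have h2 := hb y (expNegPhaseMul a α β p f) (C₁ * M) (by positivity) (h₁ f M hM f.2 hf)
    rw [mul_assoc (C * ‖y‖)]
    exact h2

theorem Pairing.isIntegralSolution_iff (B : Pairing S R) (p : ℂ × ℂ × ℂ) (χ : Distr ⊤) :
    B.IsIntegralSolution a α β p χ ↔
      ∃ x, S.IsRestriction χ x ∧ χ = cauchyDistr (B.sourceDistr a α β p x) :=
  ⟨fun ⟨x, hx, h⟩ => ⟨x, hx, ContinuousLinearMap.ext h⟩,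
    fun ⟨x, hx, h⟩ => ⟨x, hx, fun ψ => by rw [h]; rfl⟩⟩

/-- On `U` the distribution built from `x` is 1 + Ax, so the equation on ℂ is equivalent to the one
in `X`. -/
theorem isRestriction_cauchyDistr_iff {B : Pairing S R} {p : ℂ × ℂ × ℂ} {A : X →L[ℂ] X}
    (hA : B.IsDressingOperator a α β p A) (x : X) :
    S.IsRestriction (cauchyDistr (B.sourceDistr a α β p x)) x ↔ (1 - A) x = S.one := by
  have h1 : ∀ ψ : 𝓓(U, ℂ), cauchyDistr (B.sourceDistr a α β p x) (extendTest ψ) =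
      S.toDistr (S.one + A x) ψ := fun ψ => by
    rw [map_add, add_apply, S.one_apply, hA]
    rfl
  rw [sub_apply, one_apply_eq_self, sub_eq_iff_eq_add]
  exact ⟨fun h => S.ext fun ψ => (h ψ).trans (h1 ψ), fun h ψ => by rw [h1, ← h]⟩

theorem Pairing.isDbarSolution_cauchyDistr {B : Pairing S R} {p : ℂ × ℂ × ℂ} {x : X}
    (h : S.IsRestriction (cauchyDistr (B.sourceDistr a α β p x)) x) :
    B.IsDbarSolution a α β p (cauchyDistr (B.sourceDistr a α β p x)) :=
  ⟨x, h, cauchyDistr_dbarTest _⟩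

theorem tendsToOneAtInfinity_cauchyDistr (Λ : CompactDistribution puncturedPlane) :
    TendsToOneAtInfinity (cauchyDistr Λ) := by
  obtain ⟨h, r, -, hrep, -, hlim⟩ := cauchyDistr_expansion_infty Λ
  exact ⟨h, r, hrep, hlim⟩

theorem RepresentedOn.sub {χ₁ χ₂ : Distr ⊤} {h₁ h₂ : ℂ → ℂ} {W₁ W₂ W : Set ℂ}
    (H₁ : RepresentedOn χ₁ h₁ W₁) (H₂ : RepresentedOn χ₂ h₂ W₂) (hW₁ : W ⊆ W₁) (hW₂ : W ⊆ W₂) :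
    RepresentedOn (χ₁ - χ₂) (fun l => h₁ l - h₂ l) W := by
  refine ⟨(H₁.1.mono hW₁).sub (H₂.1.mono hW₂), fun ψ hψ => ?_⟩
  simp only [sub_mul]
  rw [integral_sub (integrable_mul_test H₁.1 ψ (hψ.trans hW₁))
    (integrable_mul_test H₂.1 ψ (hψ.trans hW₂)), sub_apply, H₁.2 ψ (hψ.trans hW₁),
    H₂.2 ψ (hψ.trans hW₂)]

theorem eq_of_dbar_eq {χ₁ χ₂ : Distr ⊤} (h : ∀ ψ, χ₁ (dbarTest ψ) = χ₂ (dbarTest ψ))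
    (h₁ : TendsToOneAtInfinity χ₁) (h₂ : TendsToOneAtInfinity χ₂) : χ₁ = χ₂ := by
  obtain ⟨f₁, r₁, hr₁, ht₁⟩ := h₁
  obtain ⟨f₂, r₂, hr₂, ht₂⟩ := h₂
  rw [← sub_eq_zero]
  refine distr_eq_zero_of_dbar (r := max r₁ r₂) (fun ψ => by rw [sub_apply, h, sub_self])
    (hr₁.sub hr₂ (fun l hl => (le_max_left r₁ r₂).trans_lt hl)
      fun l hl => (le_max_right r₁ r₂).trans_lt hl) ?_
  simpa using ht₁.sub ht₂

/-- A normalized solution and 1 plus the Cauchy transform of its source have the same ∂̄-derivative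
and the same limit at infinity; Liouville identifies them. -/
theorem Pairing.IsDbarSolution.isIntegralSolution {B : Pairing S R} {p : ℂ × ℂ × ℂ}
    {χ : Distr ⊤} (h : B.IsDbarSolution a α β p χ) (h1 : TendsToOneAtInfinity χ) :
    B.IsIntegralSolution a α β p χ := by
  obtain ⟨x, hx, hχ⟩ := h
  refine (B.isIntegralSolution_iff p χ).2 ⟨x, hx, eq_of_dbar_eq (fun ψ => ?_) h1
    (tendsToOneAtInfinity_cauchyDistr _)⟩
  exact neg_injective ((hχ ψ).trans (cauchyDistr_dbarTest (B.sourceDistr a α β p x) ψ).symm)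

variable [CompleteSpace X]

theorem Pairing.moment_sourceDistr (B : Pairing S R) (p : ℂ × ℂ × ℂ) (x : X) (n : ℤ) :
    (B.sourceDistr a α β p x).moment n = B.moment a α β n p (S.waveOp a α β p x) := by
  rw [CompactDistribution.moment, Pairing.moment, smul_apply, smul_eq_mul, functional_apply]
  exact congrArg _ (B.toFun_congr _ fun z _ => mul_comm _ _)

variable (S a α β) in
/-- The solution of the integral equation, as an element of `X`. -/
noncomputable def dressedSol (F : ℂ × ℂ × ℂ → X →L[ℂ] X) (p : ℂ × ℂ × ℂ) : X :=
  S.waveOp a α β (-p) (waveSol S a α β F p)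

theorem waveOp_dressedSol (F : ℂ × ℂ × ℂ → X →L[ℂ] X) (p : ℂ × ℂ × ℂ) :
    S.waveOp a α β p (dressedSol S a α β F p) = waveSol S a α β F p := by
  rw [dressedSol, ← mul_apply_eq_comp, S.waveOp_mul_neg, one_apply_eq_self]

theorem apply_dressedSol {F : ℂ × ℂ × ℂ → X →L[ℂ] X} {p : ℂ × ℂ × ℂ} (h : IsUnit (1 - F p)) :
    (1 - F p) (dressedSol S a α β F p) = S.one := by
  have h1 : 1 - conjOp S a α β F p = S.waveOp a α β p * (1 - F p) * S.waveOp a α β (-p) := by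
    rw [conjOp, mul_sub, sub_mul, mul_one, S.waveOp_mul_neg]
  have h2 := apply_waveSol (S := S) (a := a) (α := α) (β := β) h
  rw [h1, mul_apply_eq_comp, mul_apply_eq_comp] at h2
  have h3 : S.wave a α β 0 p = S.waveOp a α β p S.one := by
    rw [FunctionSpace.wave, S.zmul_zero, one_apply_eq_self]
  have h4 : Function.Injective (S.waveOp a α β p) := Function.LeftInverse.injective
    (g := S.waveOp a α β (-p)) fun z => by
      rw [← mul_apply_eq_comp, S.waveOp_neg_mul, one_apply_eq_self]
  exact h4 (h2.trans h3)

end Equation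

end KaupBroer

/-! ### Proof of the main theorem -/

theorem theorem1 {X : Type*} [NormedAddCommGroup X] [NormedSpace ℂ X] [CompleteSpace X]
    {U : Opens ℂ} (S : FunctionSpace U X)
    (R : CompactDistribution (kernelDomain U)) (B : Pairing S R)
    (a α β : ℂ) (Ω : Set (ℂ × ℂ × ℂ)) (hΩ : IsOpen Ω)
    (F : ℂ × ℂ × ℂ → X →L[ℂ] X)
    (hF : ∀ p ∈ Ω, B.IsDressingOperator a α β p (F p))
    (hfred : ∀ p ∈ Ω, (1 - F p).IsFredholm ∧ (1 - F p).toLinearMap.index = 0 ∧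
      (1 - F p).toLinearMap.ker = ⊥) :
    (∀ p ∈ Ω, ∃! x : X, (1 - F p) x = S.one) ∧
    ∃ (χ : ℂ × ℂ × ℂ → Distr ⊤) (χ0 χinf : ℕ → ℂ × ℂ × ℂ → ℂ),
      (∀ p ∈ Ω,
        B.IsIntegralSolution a α β p (χ p) ∧
        (∀ χ' : Distr ⊤, B.IsIntegralSolution a α β p χ' → χ' = χ p) ∧
        B.IsDbarSolution a α β p (χ p) ∧ TendsToOneAtInfinity (χ p) ∧
        (∀ χ' : Distr ⊤, B.IsDbarSolution a α β p χ' → TendsToOneAtInfinity χ' → χ' = χ p) ∧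
        HasExpansions (χ p) (fun n => χ0 n p) (fun n => χinf n p)) ∧
      (∀ n, DifferentiableOn ℂ (χ0 n) Ω ∧ DifferentiableOn ℂ (χinf n) Ω) ∧
      ∀ (V : Set (ℂ × ℂ × ℂ)), IsOpen V → V ⊆ Ω →
        ∀ s : ℂ × ℂ × ℂ → ℂ, ContinuousOn s V → (∀ p ∈ V, Complex.exp (-s p) = χ0 0 p) →
          ∃ Pi : ℂ × ℂ × ℂ → ℂ,
            IsSolution a α β V s (fun p => -Dv (χinf 1) p - 1 / 2 * Du (Dv s) p) Pi := by
  have H : DressingFamily B a α β F Ω :=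
    ⟨hΩ, hF, fun p hp => isUnit_of_isFredholm (hfred p hp).1 (hfred p hp).2.1 (hfred p hp).2.2⟩
  have hsol : ∀ p ∈ Ω, (1 - F p) (dressedSol S a α β F p) = S.one := fun p hp =>
    apply_dressedSol (H.isUnit p hp)
  have huniq : ∀ p ∈ Ω, ∀ x, (1 - F p) x = S.one → x = dressedSol S a α β F p := fun p hp x hx =>
    (ContinuousLinearMap.isUnit_iff_bijective.1 (H.isUnit p hp)).1 (hx.trans (hsol p hp).symm)
  have hmom : ∀ p n, (B.sourceDistr a α β p (dressedSol S a α β F p)).moment n =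
      coeff B a α β F n p := fun p n => by
    rw [B.moment_sourceDistr, waveOp_dressedSol, coeff]
  have hcoeff : ∀ n, DifferentiableOn ℂ (coeff B a α β F n) Ω := fun n =>
    (H.contDiffOn_coeff n).differentiableOn (by simp)
  refine ⟨fun p hp => ⟨_, hsol p hp, huniq p hp⟩,
    fun p => cauchyDistr (B.sourceDistr a α β p (dressedSol S a α β F p)),
    fun n p => (if n = 0 then 1 else 0) - coeff B a α β F (-n - 1) p,
    fun n p => if n = 0 then 1 else coeff B a α β F (n - 1) p, fun p hp => ?_, fun n => ⟨?_, ?_⟩,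
    fun V hV hVΩ s hs hexp => ?_⟩
  · have hr := (isRestriction_cauchyDistr_iff (hF p hp) _).2 (hsol p hp)
    have hI : ∀ χ' : Distr ⊤, B.IsIntegralSolution a α β p χ' →
        χ' = cauchyDistr (B.sourceDistr a α β p (dressedSol S a α β F p)) := fun χ' h => by
      obtain ⟨x, hx, rfl⟩ := (B.isIntegralSolution_iff p χ').1 h
      rw [huniq p hp x ((isRestriction_cauchyDistr_iff (hF p hp) x).1 hx)]
    refine ⟨(B.isIntegralSolution_iff p _).2 ⟨_, hr, rfl⟩, hI, B.isDbarSolution_cauchyDistr hr,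
      tendsToOneAtInfinity_cauchyDistr _, fun χ' h h1 => hI χ' (h.isIntegralSolution h1), ?_, ?_⟩
    · simp only [← hmom]
      exact cauchyDistr_expansion_zero _
    · obtain ⟨h, r, hr, hrep, hsum, -⟩ := cauchyDistr_expansion_infty
        (B.sourceDistr a α β p (dressedSol S a α β F p))
      simp only [hmom] at hsum
      exact ⟨h, r, hr, hrep, hsum⟩
  · exact (hcoeff _).const_sub _
  · by_cases hn : n = 0
    · simp only [hn, if_true]
      exact differentiableOn_const _
    · simp only [hn, if_false]
      exact hcoeff _
  -- Here χ^0_0 = 1 - w_{-1} and χ^∞_1 = w_0, the two coefficients in which the system was derived.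
  · have h := exists_isSolution H hV hVΩ hs fun p hp => by simpa using hexp p hp
    simpa using h
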